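/- Let $k$ be an algebraically closed field of characteristic $0$ or $p>0$ (put $p^{e}:=1$, and require all $e_i=0$ below, in characteristic $0$). **Triplets.** We consider triplets $(W,\mathcal R,E)$ locally at a closed point $P$: $W$ is a nonsingular variety over $k$; $\mathcal R=\bigoplus_{a\ge 0}(\mathcal I_a,a)$ is an idealistic filtration, i.e. $\mathcal O_W=\mathcal I_0\supset\mathcal I_1\supset\cdots$ and $\mathcal I_a\mathcal I_b\subset\mathcal I_{a+b}$; $E$ is a simple normal crossing divisor; components are counted only if they pass through $P$. $\mathcal G(S)$ is the smallest idealistic filtration containing $S$. $\mathcal D\mathcal R=\mathcal G\{(\delta f,\max\{a-\deg\delta,0\})\mid (f,a)\in\mathcal R,\ \delta\text{ a differential operator}\}$ is the differential saturation. $\mathrm{Sing}(\mathcal R)=\{Q\mid \mathrm{ord}_Q(\mathcal I_a)\ge a\ \forall a\}$. **$\sigma$.** The leading algebra is $L_P(\mathcal R)=\bigoplus_a\{f \bmod \mathfrak m_P^{a+1}\mid (f,a)\in\mathcal R_P, f\in\mathfrak m_P^a\}$. One has $L_P(\mathcal D\mathcal R)=k[x_1^{p^{e_1}},\dots,x_t^{p^{e_t}}]$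 for some regular system of parameters $(x_1,\dots,x_d)$, and $\sigma(\mathcal R)=(d-\#\{i\mid e_i\le n\})_{n\ge0}$, with sequences ordered lexicographically. **LGS and $\widetilde\mu$.** Let $E=E_{\rm young}\sqcup E_{\rm aged}$. A leading generator system $\mathbb H=\{(h_i,p^{e_i})\}_{i=1}^t\subset\widehat{\mathcal R_P}$ and a regular system of parameters $X=(x_1,\dots,x_d)$ of $\widehat{\mathcal O_{W,P}}$ satisfy $(\heartsuit)$ if the leading algebra of $\mathcal D\mathcal R$ is $k[x_1^{p^{e_1}},\dots,x_t^{p^{e_t}}]$, $h_i\equiv x_i^{p^{e_i}}\bmod \mathfrak m^{p^{e_i}+1}$, $\widehat{\mathcal R_P}$ is saturated under the (divided power) derivatives $\frac1{n!}\partial^n/\partial x_i^n$ $(i\le t)$, with the level dropping by $n$, and each component of $E_{\rm young}$ is defined by one of $x_{t+1},\dots,x_d$. Each $f$ has a unique expansion $f=\sum_B c_{f,B}H^B$ with $c_{f,B}=\sum_K b_KX^K$, $b_K\in k[[x_{t+1},\dots,x_d]]$, $0\le k_i<p^{e_i}$ for $i\le t$ and $k_i=0$ for $i>t$; $c_{f,\mathbb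 O}$ is its constant term. Put $\mu_P=\inf \mathrm{ord}_P(c_{f,\mathbb O})/a$ and $\mu_{P,D}=\inf\mathrm{ord}_{D}(c_{f,\mathbb O})/a$ over $(f,a)\in\mathcal R_P$, $a>0$; $\widetilde\mu=\mu_P-\sum_{D\subset E_{\rm young}}\mu_{P,D}$ (and $\widetilde\mu=\infty$ if $\mu_P=\infty$); and $s=\#E_{\rm aged}$. **Modifications.** Let $\mathbb M=\prod_{D\subset E_{\rm young}}x_D^{\mu_{P,D}}$. Let $\mathcal Q_1$ be the filtration with fractional levels generated over $\widehat{\mathcal O_{W,P}}$ by the elements $(f\otimes1,a)$ and $(c_{f,\mathbb O}\otimes\mathbb M^{-a},\widetilde\mu a)$ for $(f,a)\in\mathcal R_P$, where the second tensor factor consists of (polynomials in) monomials with fractional exponents; let $\mathcal Q_2$ be its saturation under the differential operators logarithmic along $E_{\rm young}$, acting on the first factor; and let $\mathcal C$ be obtained from the integral level part of $\mathcal Q_2$ by $\sum f\otimes x^\gamma\mapsto\sum f x^{\lceil\gamma\rceil}$. The *newly constructed* $\mathrm{Comp}(\mathcal R)$ is the idealistic filtration on $\mathcal O_{W,P}$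 whose completion is $\mathcal C$, and the *newly constructed* $\mathrm{Bdry}(\mathrm{Comp}(\mathcal R))$ is $\mathcal G(\mathrm{Comp}(\mathcal R)\cup\{(x_D,1)\mid D\subset E_{\rm aged}\})$. **Sequences.** In year $0$ one starts with a triplet $(W,\mathcal R_0,E)$ with $\bigoplus_a (\mathcal I_a,a)$ a finitely generated $\mathcal O_W$-algebra, $\mathcal I_1\ne0$ and $P\in\mathrm{Sing}(\mathcal R_0)$, puts $\mathcal R=\mathcal D\mathcal R_0$, $E_{\rm young}=\emptyset$, chooses $\mathbb H,X$ with $(\heartsuit)$, and newly constructs $\mathrm{Comp}(\mathcal R)$ and $\mathcal R'=\mathrm{Bdry}(\mathrm{Comp}(\mathcal R))$; no modification is made whenever $(\widetilde\mu,s)=(\infty,0)$ or $(0,0)$. One passes to the next year by blowing up a nonsingular center $C\ni P$, transversal to $E$ (possibly contained in it), with $C\subset\mathrm{Sing}(\mathcal R)$, and $C\subset\mathrm{Sing}(\mathcal R')$ if the modification was made, and by choosing a closed point $\widetilde P$ over $P$ in $\mathrm{Sing}$ of the transformation. Here the transformation of a filtration is generated by the ideals $\mathcal I(\pi^{-1}C)^{-a}\mathcal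 I_a\mathcal O_{\widetilde W}$ at the levels $a$. If $\sigma$ stays the same, the new $\mathcal R$ and $\mathbb H$ are the transformations of the old ones, $\pi^{-1}(C)$ is added to the strict transform of $E_{\rm young}$, and $E_{\rm aged}$ is replaced by its strict transform; otherwise the new $\mathcal R$ is the differential saturation of the transformation, $E_{\rm young}=\emptyset$, all components are aged and a new $\mathbb H$ is chosen. In either case the new $\mathbb H$, with some new $X$, satisfies $(\heartsuit)$. $\mathrm{Comp}(\mathcal R)$ is the transformation of the previous one if $(\sigma,\widetilde\mu)$ stays the same and is newly constructed otherwise; $\mathcal R'=\mathrm{Bdry}(\mathrm{Comp}(\mathcal R))$ is the transformation of the previous one if $(\sigma,\widetilde\mu,s)$ stays the same and is newly constructed otherwise. **Proposition.** Let $(W,\mathcal R,E)$ be the triplet in any year of such a sequence, with $(\widetilde\mu,s)\ne(\infty,0),(0,0)$, and let $(W',\mathcal R',E')=(W,\mathrm{Bdry}(\mathrm{Comp}(\mathcal R)),E_{\rm young})$ be its modification. Write $\sigma=\sigma(\mathcal R)$, $\sigma'=\sigma(\mathcal R')$. Then both invariants are defined (the leading algebras have the form above) and, lexicographically, $$(\sigma',\#E')<(\sigma,\#E).$$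 More precisely: if $\widetilde\mu\ne0,\infty$, then $L_P(\mathcal D\mathcal R)\subsetneq L_P(\mathcal D\mathcal R')$ and $\sigma'<\sigma$; if $\widetilde\mu=0$ or $\infty$, then $s\neq0$ and $\#E'<\#E$. -/

import Mathlib

open IsLocalRing
open scoped NNReal ENNReal

universe u v

noncomputable section

namespace Idealistic

/-! ## Idealistic filtrations on a ring -/

/-- An idealistic filtration on `A`: a graded family of ideals `I_a` (the pair `(f, a)` belongs to it
when `f ∈ I_a`) with `A = I_0 ⊇ I_1 ⊇ I_2 ⊇ ⋯` and `I_a I_b ⊆ I_{a+b}`. -/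
@[ext]
structure IdealisticFiltration (A : Type*) [CommRing A] where
  ideal : ℕ → Ideal A
  ideal_zero : ideal 0 = ⊤
  anti : Antitone ideal
  mul_le : ∀ a b, ideal a * ideal b ≤ ideal (a + b)

/-- The pairs `(b, level)` generated by `G`, for an `A`-algebra `B`: the smallest family of
`A`-submodules of `B`, one for each level, which decreases with the level, is multiplicative,
contains `1` at level `0` and contains `G`. -/
inductive Generated (A : Type*) {B Γ : Type*} [CommRing A] [CommRing B] [Algebra A B]
    [AddCommMonoid Γ] [PartialOrder Γ] (G : Set (B × Γ)) : B → Γ → Prop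
  | of {b : B} {γ : Γ} : (b, γ) ∈ G → Generated A G b γ
  | one : Generated A G 1 0
  | zero (γ : Γ) : Generated A G 0 γ
  | add {b c : B} {γ : Γ} : Generated A G b γ → Generated A G c γ → Generated A G (b + c) γ
  | smul (r : A) {b : B} {γ : Γ} : Generated A G b γ → Generated A G (r • b) γ
  | mul {b c : B} {γ δ : Γ} :
      Generated A G b γ → Generated A G c δ → Generated A G (b * c) (γ + δ)
  | lower {b : B} {γ δ : Γ} : δ ≤ γ → Generated A G b γ → Generated A G b δ

/-- Differential operators of order at most `n` of the `k`-algebra `A` (Grothendieck):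
`k`-linear maps whose commutators with multiplications have order at most `n - 1`. -/
def IsDiffOp (k : Type*) {A : Type*} [CommRing k] [CommRing A] [Algebra k A] :
    ℕ → (A →ₗ[k] A) → Prop
  | 0, δ => ∀ r : A, δ ∘ₗ LinearMap.mulLeft k r = LinearMap.mulLeft k r ∘ₗ δ
  | n + 1, δ => ∀ r : A,
      IsDiffOp k n (δ ∘ₗ LinearMap.mulLeft k r - LinearMap.mulLeft k r ∘ₗ δ)

namespace IdealisticFiltration

variable {A B : Type*} [CommRing A] [CommRing B]

/-- The smallest idealistic filtration containing the set `G` of pairs `(f, a)`. -/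
def generate (G : Set (A × ℕ)) : IdealisticFiltration A where
  ideal a :=
    { carrier := {f | Generated A G f a}
      add_mem' := fun h h' => Generated.add h h'
      zero_mem' := Generated.zero a
      smul_mem' := fun r _ h => Generated.smul r h }
  ideal_zero := (Ideal.eq_top_iff_one _).2 Generated.one
  anti := fun _ _ hab _ h => Generated.lower hab h
  mul_le := fun _ _ => Ideal.mul_le.2 fun _ h _ h' => Generated.mul h h'

/-- The extension of an idealistic filtration along a ring homomorphism. -/
def map (φ : A →+* B) (R : IdealisticFiltration A) : IdealisticFiltration B where
  ideal a := (R.ideal a).map φ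
  ideal_zero := by rw [R.ideal_zero, Ideal.map_top]
  anti := fun _ _ h => Ideal.map_mono (R.anti h)
  mul_le := fun a b => by rw [← Ideal.map_mul]; exact Ideal.map_mono (R.mul_le a b)

/-- The graded algebra `⨁ I_a T^a ⊆ A[T]` of an idealistic filtration. -/
def gradedAlgebra (R : IdealisticFiltration A) : Subalgebra A (Polynomial A) where
  carrier := {p | ∀ a, p.coeff a ∈ R.ideal a}
  mul_mem' := fun {p q} hp hq a => by
    rw [Polynomial.coeff_mul]
    refine Ideal.sum_mem _ fun c hc => ?_
    rw [← Finset.HasAntidiagonal.mem_antidiagonal.1 hc]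
    exact R.mul_le _ _ (Ideal.mul_mem_mul (hp _) (hq _))
  add_mem' := fun {p q} hp hq a => by
    rw [Polynomial.coeff_add]; exact Ideal.add_mem _ (hp a) (hq a)
  algebraMap_mem' := fun r a => by
    rw [Polynomial.algebraMap_apply, Polynomial.coeff_C]
    split_ifs with h
    · subst h; rw [R.ideal_zero]; trivial
    · exact Ideal.zero_mem _

/-- Idealistic filtrations of i.f.g. type: the graded algebra is finitely generated. -/
def IsIFG (R : IdealisticFiltration A) : Prop := R.gradedAlgebra.FG

/-- The differential saturation, generated by the pairs `(δ f, max (a - deg δ, 0))` with `(f, a)` in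
the filtration and `δ` a differential operator. -/
def diffSat (k : Type*) [CommRing k] [Algebra k A] (R : IdealisticFiltration A) :
    IdealisticFiltration A :=
  generate {p | ∃ (f : A) (a n : ℕ) (δ : A →ₗ[k] A),
    f ∈ R.ideal a ∧ IsDiffOp k n δ ∧ p = (δ f, a - n)}

/-- The closed point of the local ring `A` is in the singular locus: `ord I_a ≥ a` for all `a`. -/
def ClosedPointInSing [IsLocalRing A] (R : IdealisticFiltration A) : Prop :=
  ∀ a, R.ideal a ≤ maximalIdeal A ^ a

/-- The regularly embedded subvariety defined by `C` is in the singular locus: `ord I_a ≥ a`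
along it, for all `a`. -/
def CenterInSing (R : IdealisticFiltration A) (C : Ideal A) : Prop :=
  ∀ a, R.ideal a ≤ C ^ a

/-- The transformation under a blow up `φ` with exceptional divisor `y = 0`, generated by the
ideals `y^{-a} I_a` at the levels `a`. -/
def transform (φ : A →+* B) (y : B) (R : IdealisticFiltration A) : IdealisticFiltration B :=
  generate {p | y ^ p.2 * p.1 ∈ (R.ideal p.2).map φ}

/-- The component of degree `a` of the leading algebra:
`{f mod m^(a+1) | f ∈ I_a, f ∈ m^a}`, a subset of `m^a / m^(a+1) ⊆ A / m^(a+1)`. -/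
def leadingPart [IsLocalRing A] (R : IdealisticFiltration A) (a : ℕ) :
    Set (A ⧸ maximalIdeal A ^ (a + 1)) :=
  Ideal.Quotient.mk (maximalIdeal A ^ (a + 1)) '' {f | f ∈ R.ideal a ∧ f ∈ maximalIdeal A ^ a}

end IdealisticFiltration

open IdealisticFiltration

/-! ## Regular systems of parameters, the leading algebra and the invariant `σ` -/

/-- `x` is a regular system of parameters of the local ring `A`. -/
def IsRegularSystem {A : Type*} [CommRing A] [IsLocalRing A] {ι : Type*} [Fintype ι]
    (x : ι → A) : Prop :=
  Ideal.span (Set.range x) = maximalIdeal A ∧ ringKrullDim A = (Fintype.card ι : WithBot ℕ∞)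

/-- The leading algebra of `R` is `k[x_1^{p^{e_1}}, …, x_t^{p^{e_t}}]`, where `x_1, …, x_t` are the
parameters with index in the first summand and `p` is the exponential characteristic of `k`; all the
`e_i` are `0` in characteristic zero. -/
def HasLeadingForm (k : Type*) {A : Type*} [Field k] [CommRing A] [IsLocalRing A] [Algebra k A]
    (R : IdealisticFiltration A) {t r : ℕ} (x : Fin t ⊕ Fin r → A) (e : Fin t → ℕ) : Prop :=
  (ringExpChar k = 1 → ∀ i, e i = 0) ∧
  ∀ a, R.leadingPart a = (Submodule.span k
    {w | ∃ α : Fin t → ℕ, ∑ i, α i * ringExpChar k ^ e i = a ∧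
      w = Ideal.Quotient.mk (maximalIdeal A ^ (a + 1))
        (∏ i, (x (Sum.inl i) ^ ringExpChar k ^ e i) ^ α i)} :
    Set (A ⧸ maximalIdeal A ^ (a + 1)))

/-- `s` is the value of `σ` at the closed point: the leading algebra of the differential saturation
is `k[x_1^{p^{e_1}}, …, x_t^{p^{e_t}}]` for a regular system of parameters `x_1, …, x_d`, and
`s n = d - #{i | e_i ≤ n}`. -/
def IsSigma (k : Type*) {A : Type*} [Field k] [CommRing A] [IsLocalRing A] [Algebra k A]
    (R : IdealisticFiltration A) (s : ℕ → ℕ) : Prop :=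
  ∃ (t r : ℕ) (x : Fin t ⊕ Fin r → A) (e : Fin t → ℕ),
    IsRegularSystem x ∧ HasLeadingForm k (R.diffSat k) x e ∧
    s = fun n => (t + r) - (Finset.univ.filter fun i => e i ≤ n).card

open Classical in
/-- The invariant `σ` of an idealistic filtration at the closed point of a local ring. -/
def sigma (k : Type*) {A : Type*} [Field k] [CommRing A] [IsLocalRing A] [Algebra k A]
    (R : IdealisticFiltration A) : ℕ → ℕ :=
  if h : ∃ s, IsSigma k R s then h.choose else fun _ => 0

/-! ## Local rings of nonsingular varieties, boundaries and blow ups -/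

/-- `A` is the local ring of a nonsingular variety over the algebraically closed field `k` at a
closed point. -/
structure IsClosedPointRing (k A : Type*) [Field k] [CommRing A] [IsLocalRing A] [Algebra k A] :
    Prop where
  regular : IsRegularLocalRing A
  essFiniteType : Algebra.EssFiniteType k A
  residue : ∀ f : A, ∃ c : k, f - algebraMap k A c ∈ maximalIdeal A

section Boundary

variable {A B : Type*} [CommRing A] [CommRing B]

/-- `E`, the set of the ideals of the components through the closed point, is a simple normal
crossing divisor. -/
def IsSNC [IsLocalRing A] (E : Set (Ideal A)) : Prop :=
  ∃ (d : ℕ) (x : Fin d → A), IsRegularSystem x ∧ ∀ D ∈ E, ∃ i, D = Ideal.span {x i}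

/-- `C` is the ideal of a nonsingular center through the closed point, transversal to `E` (and
possibly contained in components of `E`). -/
def IsTransversalCenter [IsLocalRing A] (E : Set (Ideal A)) (C : Ideal A) : Prop :=
  ∃ (d : ℕ) (x : Fin d → A), IsRegularSystem x ∧
    (∃ J : Finset (Fin d), J.Nonempty ∧ C = Ideal.span (x '' (J : Set (Fin d)))) ∧
    ∀ D ∈ E, ∃ i, D = Ideal.span {x i}

/-- `φ : A → B` is the homomorphism of local rings given by the blow up with center `C` and a point
of it over the closed point of `A`; the exceptional divisor is `φ y = 0`. That is, `y ∈ C`, and `B`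
is a localization of the subring `A[C / y]` at a prime over the maximal ideal. -/
structure IsLocalBlowUp {k : Type*} [Field k] [Algebra k A] [Algebra k B]
    (φ : A →ₐ[k] B) (C : Ideal A) (y : A) : Prop where
  domain : IsDomain B
  injective : Function.Injective φ
  localHom : IsLocalHom φ
  mem : y ∈ C
  map_center : C.map φ = Ideal.span {φ y}
  localization : ∀ f : B,
    ∃ b ∈ Algebra.adjoin k (Set.range φ ∪ {z | ∃ c ∈ C, z * φ y = φ c}),
    ∃ c ∈ Algebra.adjoin k (Set.range φ ∪ {z | ∃ c ∈ C, z * φ y = φ c}),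
      IsUnit c ∧ f * c = b

/-- The strict transform of the divisor with ideal `D`; the exceptional divisor is `y = 0`. -/
def strictTransform (φ : A →+* B) (y : B) (D : Ideal A) : Ideal B where
  carrier := {g | ∃ n : ℕ, y ^ n * g ∈ D.map φ}
  add_mem' := by
    rintro g g' ⟨n, hn⟩ ⟨m, hm⟩
    refine ⟨n + m, ?_⟩
    have h1 := Ideal.mul_mem_left (D.map φ) (y ^ m) hn
    have h2 := Ideal.mul_mem_left (D.map φ) (y ^ n) hm
    have h3 := Ideal.add_mem _ h1 h2
    have h4 : y ^ (n + m) * (g + g') = y ^ m * (y ^ n * g) + y ^ n * (y ^ m * g') := by ring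
    rw [h4]; exact h3
  zero_mem' := ⟨0, by simp⟩
  smul_mem' := by
    rintro r g ⟨n, hn⟩
    refine ⟨n, ?_⟩
    have h1 := Ideal.mul_mem_left (D.map φ) r hn
    have h4 : y ^ n * (r • g) = r * (y ^ n * g) := by rw [smul_eq_mul]; ring
    rw [h4]; exact h1

/-- The strict transforms, of the components in `E`, that pass through the new closed point. -/
def strictBoundary (φ : A →+* B) (y : B) (E : Set (Ideal A)) : Set (Ideal B) :=
  {D' | D' ≠ ⊤ ∧ ∃ D ∈ E, D' = strictTransform φ y D}

end Boundary

/-! ## Leading generator systems at the formal level -/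

/-- A regular system of parameters `x_1, …, x_t, x_{t+1}, …, x_d` of the completion of `O`, given as
an identification of the completion with the power series ring in the variables indexed by
`Fin t ⊕ Fin r` (so `d = t + r`), together with elements `h_1, …, h_t` of the completion and
exponents `e_1, …, e_t`. -/
structure FormalSystem (k : Type u) (O : Type v) [Field k] [CommRing O] [Algebra k O] where
  t : ℕ
  r : ℕ
  coord : O →ₐ[k] MvPowerSeries (Fin t ⊕ Fin r) k
  e : Fin t → ℕ
  h : Fin t → MvPowerSeries (Fin t ⊕ Fin r) k

/-- The divided power (Hasse) derivative `(1 / n!) ∂ⁿ / ∂ x_iⁿ` of power series. -/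
def hasseDeriv {k V : Type*} [Field k] (i : V) (n : ℕ) (f : MvPowerSeries V k) :
    MvPowerSeries V k :=
  fun m => ((m i + n).choose n : k) * MvPowerSeries.coeff (m + Finsupp.single i n) f

namespace FormalSystem

variable {k : Type u} {O : Type v} [Field k] [CommRing O] [IsLocalRing O] [Algebra k O]

/-- The completion of `O`, in the given coordinates. -/
abbrev Ring (H : FormalSystem k O) : Type u := MvPowerSeries (Fin H.t ⊕ Fin H.r) k

/-- The parameter `x_i`. -/
def x (H : FormalSystem k O) (i : Fin H.t ⊕ Fin H.r) : H.Ring := MvPowerSeries.X i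

/-- The level `p^{e_i}` of `h_i`. -/
def q (H : FormalSystem k O) (i : Fin H.t) : ℕ := ringExpChar k ^ H.e i

/-- The completion of the filtration. -/
def complete (H : FormalSystem k O) (R : IdealisticFiltration O) : IdealisticFiltration H.Ring :=
  R.map (H.coord : O →+* H.Ring)

/-- `coord` exhibits the power series ring as the completion of the local ring `O`: it induces
isomorphisms modulo all the powers of the maximal ideals. -/
def IsCompletion (H : FormalSystem k O) : Prop :=
  (∀ n, (maximalIdeal H.Ring ^ n).comap H.coord = maximalIdeal O ^ n) ∧
  ∀ (n : ℕ) (f : H.Ring), ∃ g : O, f - H.coord g ∈ maximalIdeal H.Ring ^ n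

/-- `h_1, …, h_t` (with the levels `p^{e_i}`) is a leading generator system of (the differential
saturation of) `R`, lying in the completion of `R`; it is associated to the regular system of
parameters `x_1, …, x_d`; the completion of `R` is saturated for the derivatives in `x_1, …, x_t`;
and the young components are defined by some of `x_{t+1}, …, x_d`. -/
structure Heart (H : FormalSystem k O) (R : IdealisticFiltration O) (young : Set (Ideal O)) :
    Prop where
  completion : H.IsCompletion
  leading : HasLeadingForm k (H.complete (R.diffSat k)) H.x H.e
  mem : ∀ i, H.h i ∈ (H.complete R).ideal (H.q i)
  congr : ∀ i, H.h i - H.x (Sum.inl i) ^ H.q i ∈ maximalIdeal H.Ring ^ (H.q i + 1)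
  saturated : ∀ (i : Fin H.t) (n a : ℕ) (f : H.Ring), f ∈ (H.complete R).ideal a →
    hasseDeriv (Sum.inl i) n f ∈ (H.complete R).ideal (a - n)
  transversal : ∀ D ∈ young, ∃ j : Fin H.r, D.map H.coord = Ideal.span {H.x (Sum.inr j)}

/-- `f = ∑_B c_B H^B` is the power series expansion with respect to the system: the coefficients
`c_B` are of the form `∑_K b_K X^K` with `b_K ∈ k[[x_{t+1}, …, x_d]]`, where `0 ≤ k_i ≤ p^{e_i} - 1`
for `i ≤ t` and `k_i = 0` for `i > t`. -/
def IsExpansion (H : FormalSystem k O) (f : H.Ring) (c : (Fin H.t → ℕ) → H.Ring) : Prop :=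
  (∀ (B : Fin H.t → ℕ) (m : Fin H.t ⊕ Fin H.r →₀ ℕ), MvPowerSeries.coeff m (c B) ≠ 0 →
    ∀ i, m (Sum.inl i) < H.q i) ∧
  ∀ N : ℕ, f - ∑ B ∈ Fintype.piFinset (fun _ : Fin H.t => Finset.range N),
    c B * ∏ i, H.h i ^ B i ∈ maximalIdeal H.Ring ^ N

/-- `c₀` is the constant term of the power series expansion of `f`. -/
def IsConstTerm (H : FormalSystem k O) (f c₀ : H.Ring) : Prop :=
  ∃ c, H.IsExpansion f c ∧ c 0 = c₀

/-- `μ_P(R)`, the infimum of `ord_P (c_{f,0}) / a` over `(f, a) ∈ R` with `a > 0`. -/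
def muP (H : FormalSystem k O) (R : IdealisticFiltration O) : ℝ≥0∞ :=
  ⨅ (a : ℕ) (_ : 0 < a) (f : O) (_ : f ∈ R.ideal a) (c : H.Ring)
    (_ : H.IsConstTerm (H.coord f) c), (c.order : ℝ≥0∞) / (a : ℝ≥0∞)

/-- `μ_{P,D}(R)` for the component `D` defined by the `j`-th of the parameters `x_{t+1}, …, x_d`:
the infimum of `ord_D (c_{f,0}) / a` over `(f, a) ∈ R` with `a > 0`. -/
def muD (H : FormalSystem k O) (R : IdealisticFiltration O) (j : Fin H.r) : ℝ≥0∞ :=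
  ⨅ (a : ℕ) (_ : 0 < a) (f : O) (_ : f ∈ R.ideal a) (c : H.Ring)
    (_ : H.IsConstTerm (H.coord f) c),
    ((emultiplicity (H.x (Sum.inr j)) c : ℕ∞) : ℝ≥0∞) / (a : ℝ≥0∞)

open Classical in
/-- The indices of the parameters which define the components of the young boundary. -/
def youngIndex (H : FormalSystem k O) (young : Set (Ideal O)) : Finset (Fin H.r) :=
  Finset.univ.filter fun j => ∃ D ∈ young, D.map H.coord = Ideal.span {H.x (Sum.inr j)}

open Classical in
/-- The weak order modulo the leading generator system, `μ_P - ∑_D μ_{P,D}` over the young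
components, which is `∞` when `μ_P` is. (The difference is never negative, so that
the truncated subtraction is harmless.) -/
def muTilde (H : FormalSystem k O) (R : IdealisticFiltration O) (young : Set (Ideal O)) : ℝ≥0∞ :=
  if H.muP R = ⊤ then ⊤ else H.muP R - ∑ j ∈ H.youngIndex young, H.muD R j

/-! ### The companion modification -/

/-- The ring `Ô ⊗_k k[x_1^{γ}, …, x_d^{γ} | γ ∈ ℝ]` of sums of `f ⊗ x^γ`, with `f` in the completion
of `O` and with monomials `x^γ` in the parameters with real exponents. It contains all the products
`f ⊗ (M⁻¹)^a` used below, whose exponents have a common denominator. -/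
abbrev GenRing (H : FormalSystem k O) : Type u :=
  AddMonoidAlgebra H.Ring (Fin H.t ⊕ Fin H.r → ℝ)

open Classical in
/-- The exponents of the monomial `(M⁻¹)^a`, where `M` is the product of the `x_D ^ μ_{P,D}(R)` over
the young components `D`. -/
def invMonomial (H : FormalSystem k O) (R : IdealisticFiltration O) (young : Set (Ideal O))
    (a : ℕ) : Fin H.t ⊕ Fin H.r → ℝ :=
  Sum.elim (fun _ => 0)
    fun j => if j ∈ H.youngIndex young then -((H.muD R j).toReal * a) else 0

/-- The generators `(f ⊗ 1, a)` and `(c_{f,0} ⊗ (M⁻¹)^a, μ̃ a)`, for `(f, a) ∈ R`. When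
`μ̃ = ∞`, all the `c_{f,0}` with `a > 0` vanish. -/
def companionGenerators (H : FormalSystem k O) (R : IdealisticFiltration O)
    (young : Set (Ideal O)) : Set (H.GenRing × ℝ≥0) :=
  {p | ∃ (a : ℕ) (f : O), f ∈ R.ideal a ∧
    p = (AddMonoidAlgebra.single 0 (H.coord f), (a : ℝ≥0))} ∪
  {p | ∃ (a : ℕ) (f : O) (c : H.Ring), f ∈ R.ideal a ∧ H.IsConstTerm (H.coord f) c ∧
    p = (AddMonoidAlgebra.single (H.invMonomial R young a) c,
      (H.muTilde R young * (a : ℝ≥0∞)).toNNReal)}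

/-- Step 1: the idealistic filtration in the generalized sense, with real levels, generated by the
generators above. -/
def companionQ₁ (H : FormalSystem k O) (R : IdealisticFiltration O) (young : Set (Ideal O)) :
    Set (H.GenRing × ℝ≥0) :=
  {p | Generated H.Ring (H.companionGenerators R young) p.1 p.2}

/-- Differential operators of order at most `n` of the completion which are logarithmic with respect
to the young boundary: they preserve all the powers of the ideals of its components. -/
def IsLogDiffOp (H : FormalSystem k O) (young : Set (Ideal O)) (n : ℕ)
    (δ : H.Ring →ₗ[k] H.Ring) : Prop :=
  IsDiffOp k n δ ∧ ∀ j ∈ H.youngIndex young, ∀ (m : ℕ) (f : H.Ring),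
    H.x (Sum.inr j) ^ m ∣ f → H.x (Sum.inr j) ^ m ∣ δ f

/-- Step 2: the logarithmic differential saturation. The operators act on the first factor of
`f ⊗ x^γ`. -/
def companionQ₂ (H : FormalSystem k O) (R : IdealisticFiltration O) (young : Set (Ideal O)) :
    Set (H.GenRing × ℝ≥0) :=
  {p | Generated H.Ring {p : H.GenRing × ℝ≥0 | ∃ (w : H.GenRing) (l : ℝ≥0) (n : ℕ)
      (δ : H.Ring →ₗ[k] H.Ring), (w, l) ∈ H.companionQ₁ R young ∧ H.IsLogDiffOp young n δ ∧
      (∀ γ, p.1.coeff γ = δ (w.coeff γ)) ∧ p.2 = l - n} p.1 p.2}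

/-- Round up and contraction, `∑ f ⊗ x^γ ↦ ∑ f x^⌈γ⌉`, a priori with values in the fraction field. -/
def ruc (H : FormalSystem k O) (w : H.GenRing) : FractionRing H.Ring :=
  w.coeff.sum fun γ f => algebraMap H.Ring (FractionRing H.Ring) f *
    ∏ i, algebraMap H.Ring (FractionRing H.Ring) (H.x i) ^ ⌈γ i⌉

/-- Steps 3 to 5: round up and contraction of the integral level part. -/
def formalCompanion (H : FormalSystem k O) (R : IdealisticFiltration O) (young : Set (Ideal O)) :
    IdealisticFiltration H.Ring :=
  generate {p | ∃ w : H.GenRing, (w, (p.2 : ℝ≥0)) ∈ H.companionQ₂ R young ∧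
    algebraMap H.Ring (FractionRing H.Ring) p.1 = H.ruc w}

/-- `K` is the companion modification of `R` at the algebraic level: its completion is the companion
modification at the formal level. -/
def IsCompanion (H : FormalSystem k O) (R : IdealisticFiltration O) (young : Set (Ideal O))
    (K : IdealisticFiltration O) : Prop :=
  H.complete K = H.formalCompanion R young

end FormalSystem

/-- The boundary modification, generated by `K` and the `(x_D, 1)` for the aged components `D`. -/
def boundaryModification {O : Type*} [CommRing O] (K : IdealisticFiltration O)
    (aged : Set (Ideal O)) : IdealisticFiltration O :=
  generate ({p | p.1 ∈ K.ideal p.2} ∪ {p | p.2 = 1 ∧ ∃ D ∈ aged, p.1 ∈ D})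

/-! ## The years of a resolution sequence -/

/-- The data in one year of a resolution sequence, at the chosen closed point: the local ring, the
idealistic filtration `R`, the components through the point of the young and the aged part of the
boundary, the leading generator system chosen, and the modifications `comp = Comp(R)` and
`bdry = R' = Bdry(Comp(R))`. -/
structure Year (k : Type u) [Field k] where
  O : Type v
  [commRing : CommRing O]
  [isLocalRing : IsLocalRing O]
  [algebra : Algebra k O]
  R : IdealisticFiltration O
  young : Set (Ideal O)
  aged : Set (Ideal O)
  lgs : FormalSystem k O
  comp : IdealisticFiltration O
  bdry : IdealisticFiltration O

namespace Year

attribute [instance] Year.commRing Year.isLocalRing Year.algebra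

variable {k : Type u} [Field k]

/-- The components of the boundary `E` through the point. -/
def boundary (Y : Year.{u, v} k) : Set (Ideal Y.O) := Y.young ∪ Y.aged

/-- The invariant `σ` of `(W, R, E)`. -/
def sigma (Y : Year.{u, v} k) : ℕ → ℕ := Idealistic.sigma k Y.R

/-- The invariant `μ̃` of `(W, R, E)`. -/
def mu (Y : Year.{u, v} k) : ℝ≥0∞ := Y.lgs.muTilde Y.R Y.young

/-- The invariant `s` of `(W, R, E)`. -/
def s (Y : Year.{u, v} k) : ℕ := Y.aged.ncard

/-- The number `#E` of the components of the boundary through the point. -/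
def numE (Y : Year.{u, v} k) : ℕ := Y.boundary.ncard

/-- The boundary `E'` of the modification `(W', R', E')`. -/
def boundary' (Y : Year.{u, v} k) : Set (Ideal Y.O) := Y.young

/-- The invariant `σ'` of `(W', R', E')`. -/
def sigma' (Y : Year.{u, v} k) : ℕ → ℕ := Idealistic.sigma k Y.bdry

/-- The number `#E'`. -/
def numE' (Y : Year.{u, v} k) : ℕ := Y.boundary'.ncard

/-- `(σ, μ̃, s)` is `(σ, ∞, 0)` or `(σ, 0, 0)`, in which case no modification is constructed. -/
def Terminal (Y : Year.{u, v} k) : Prop := (Y.mu = ⊤ ∨ Y.mu = 0) ∧ Y.s = 0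

/-- The year `0` of a resolution sequence for `(W, R₀, E)`: `R₀` is replaced by its differential
saturation, and the whole boundary is aged. -/
structure IsStart (Y : Year.{u, v} k) (R₀ : IdealisticFiltration Y.O) : Prop where
  point : IsClosedPointRing k Y.O
  ifg : R₀.IsIFG
  ne_bot : R₀.ideal 1 ≠ ⊥
  sing : R₀.ClosedPointInSing
  snc : IsSNC Y.aged
  R_eq : Y.R = R₀.diffSat k
  young_eq : Y.young = ∅
  heart : Y.lgs.Heart Y.R Y.young
  comp_eq : ¬ Y.Terminal → Y.lgs.IsCompanion Y.R Y.young Y.comp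
  bdry_eq : ¬ Y.Terminal → Y.bdry = boundaryModification Y.comp Y.aged

/-- The leading generator system of `Z` is the transformation of the one of `Y`. -/
def IsTransformedLGS (Y Z : Year.{u, v} k) (φ : Y.O →ₐ[k] Z.O) (y : Y.O) : Prop :=
  ∃ ψ : Y.lgs.Ring →+* Z.lgs.Ring, (∀ f, ψ (Y.lgs.coord f) = Z.lgs.coord (φ f)) ∧
    ∃ τ : Fin Y.lgs.t ≃ Fin Z.lgs.t, ∀ i, Z.lgs.e (τ i) = Y.lgs.e i ∧
      ψ (Y.lgs.h i) = Z.lgs.coord (φ y) ^ Y.lgs.q i * Z.lgs.h (τ i)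

/-- The value of `σ` in the year `Z` after `Y` is the same as in the year `Y`. -/
def SameSigma (Y Z : Year.{u, v} k) (φ : Y.O →ₐ[k] Z.O) (y : Y.O) : Prop :=
  Idealistic.sigma k (Y.R.transform (φ : Y.O →+* Z.O) (φ y)) = Y.sigma

/-- `Z` is a year that follows `Y` in a resolution sequence: the ambient space is blown up with
center `C`, and `φ`, `y` describe the blow up at the new closed point. -/
structure IsNext (Y Z : Year.{u, v} k) (φ : Y.O →ₐ[k] Z.O) (C : Ideal Y.O) (y : Y.O) : Prop where
  point : IsClosedPointRing k Z.O
  center : IsTransversalCenter Y.boundary C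
  center_sing : Y.R.CenterInSing C
  /-- When there is a modification, one blows up for resolution of singularities of it. -/
  center_sing' : ¬ Y.Terminal → Y.bdry.CenterInSing C
  blowUp : IsLocalBlowUp φ C y
  sing : (Y.R.transform (φ : Y.O →+* Z.O) (φ y)).ClosedPointInSing
  R_same : SameSigma Y Z φ y → Z.R = Y.R.transform (φ : Y.O →+* Z.O) (φ y)
  R_drop : ¬ SameSigma Y Z φ y → Z.R = (Y.R.transform (φ : Y.O →+* Z.O) (φ y)).diffSat k
  young_same : SameSigma Y Z φ y →
    Z.young = strictBoundary (φ : Y.O →+* Z.O) (φ y) Y.young ∪ {Ideal.span {φ y}}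
  young_drop : ¬ SameSigma Y Z φ y → Z.young = ∅
  aged_same : SameSigma Y Z φ y → Z.aged = strictBoundary (φ : Y.O →+* Z.O) (φ y) Y.aged
  aged_drop : ¬ SameSigma Y Z φ y →
    Z.aged = strictBoundary (φ : Y.O →+* Z.O) (φ y) Y.boundary ∪ {Ideal.span {φ y}}
  heart : Z.lgs.Heart Z.R Z.young
  lgs_same : SameSigma Y Z φ y → IsTransformedLGS Y Z φ y
  comp_same : ¬ Z.Terminal → (SameSigma Y Z φ y ∧ Z.mu = Y.mu) →
    Z.comp = Y.comp.transform (φ : Y.O →+* Z.O) (φ y)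
  comp_drop : ¬ Z.Terminal → ¬ (SameSigma Y Z φ y ∧ Z.mu = Y.mu) →
    Z.lgs.IsCompanion Z.R Z.young Z.comp
  bdry_same : ¬ Z.Terminal → (SameSigma Y Z φ y ∧ Z.mu = Y.mu ∧ Z.s = Y.s) →
    Z.bdry = Y.bdry.transform (φ : Y.O →+* Z.O) (φ y)
  bdry_drop : ¬ Z.Terminal → ¬ (SameSigma Y Z φ y ∧ Z.mu = Y.mu ∧ Z.s = Y.s) →
    Z.bdry = boundaryModification Z.comp Z.aged

/-- `Y` is a year of some resolution sequence. -/
inductive InSequence : Year.{u, v} k → Prop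
  | start (Y : Year.{u, v} k) (R₀ : IdealisticFiltration Y.O) : Y.IsStart R₀ → InSequence Y
  | next (Y Z : Year.{u, v} k) (φ : Y.O →ₐ[k] Z.O) (C : Ideal Y.O) (y : Y.O) :
      InSequence Y → IsNext Y Z φ C y → InSequence Z

end Year

end Idealistic

end

set_option linter.unusedSectionVars false

namespace Idealistic

/-! ### Orders, initial forms and completions of local rings -/

section PowerSeries

open MvPowerSeries

variable {k V : Type*} [Field k]

/-! Write `L(·)` for the leading algebra of the differential saturation. At every level `R ≤ Comp(R)
≤ R'`, so `L(R) ⊆ L(R')`. An algebra `k[x_1^{p^{e_1}}, …, x_t^{p^{e_t}}]` is determined by the flag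
of the spaces of linear forms `v` with `v^{p^m}` in it, and the number of `e_i ≤ m` is the dimension
of the `m`-th step. Hence `σ' ≤ σ` termwise, with equality only if the two leading algebras
coincide. If `μ̃` is `0` or `∞`, then `s ≠ 0` because there is a modification, and dropping the aged
components, which are disjoint from the young ones, lowers `#E`. What remains is to show that the
leading algebras differ when `μ̃ ≠ 0, ∞`.

The property carried along the sequence is `Separates`: some pair `(g, n)` of `Comp(R)` has order
smaller than `n` or an initial form of degree `n` outside of `L(R)`. It suffices by
`FormalSystem.exists_leadingPart_ne`. Indeed, if the order is too small, a Hasse derivative of `g`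
is a unit at a positive level, so that `L(R')` contains all linear forms; if `L(R)` did as well, all
constant terms at positive levels would vanish and `μ̃` would be `∞`.

When `Comp(R)` is newly constructed, the separating element comes from
`FormalSystem.exists_new_element`. As `R` is finitely generated, `μ_P = n / a` for the order `n` of
some constant term `c = c_{f,0}` at a level `a`. In the initial form of `c` take a monomial of
highest degree in `x_1, …, x_t`, and let `K` be its part in these variables; then `|K| ≤ μ̃ a`. If
the inequality is strict, the Hasse derivative `D_K`, which is logarithmic along the young
components, gives `D_K c ⊗ M^{-a}` at a positive level, with `x_1, …, x_t` absent from the initial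
form of `D_K c`, and a power of it has integral level and exponents. If there is equality, `c ⊗
M^{-a}` already has integral level and exponents. In both cases one gets an element whose order is
its level `L > 0` and whose initial form has exponents smaller than `p^{e_i}` in `x_i`. No such form
lies in `k[x_1^{p^{e_1}}, …, x_t^{p^{e_t}}]`.

When `Comp(R)` is transformed, `σ` has not changed. In coordinates adapted to the blow up, the
initial form of an element of `C^n` is obtained from that of its transformation, provided this has
order at least `n`, by setting some variables to zero (`IsAdapted.leadPoly_eq`). Applied to the
leading generators, this shows that `L(R)` lies in the image of the new leading algebra. Equal
counts force equality, and so a separating element stays separating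
(`IsAdapted.separates_transform`).

That `σ` is defined for any filtration (`IsCoord.exists_isSigma`) rests on two facts. Differential
operators of the completion are approximated by operators of the local ring, so the leading algebra
is stable under Hasse derivatives. Over an algebraically closed field, a graded algebra with this
stability is generated by `p`-power powers of independent linear forms (`eq_powAlg_of_hasse`). -/

theorem mem_maximalIdeal_iff_constantCoeff (f : MvPowerSeries V k) :
    f ∈ maximalIdeal (MvPowerSeries V k) ↔ constantCoeff f = 0 := by
  rw [mem_maximalIdeal, mem_nonunits_iff, MvPowerSeries.isUnit_iff_constantCoeff, isUnit_iff_ne_zero,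
    not_not]

theorem le_order_of_mem_maximalIdeal_pow (n : ℕ) (f : MvPowerSeries V k)
    (h : f ∈ maximalIdeal (MvPowerSeries V k) ^ n) : (n : ℕ∞) ≤ f.order := by
  induction n generalizing f with
  | zero => simp
  | succ n ih =>
    rw [pow_succ] at h
    refine Submodule.mul_induction_on h (fun a ha b hb => ?_) fun a b ha hb => ?_
    · have h1 := ih a ha
      have h2 : (1 : ℕ∞) ≤ b.order := by
        rw [one_le_order_iff_constCoeff_eq_zero]
        exact (mem_maximalIdeal_iff_constantCoeff b).1 hb
      refine le_trans ?_ le_order_mul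
      push_cast
      exact add_le_add h1 h2
    · exact le_trans (le_min ha hb) min_order_le_add

/-- The power series with given coefficients. -/
def ofCoeff (a : (V →₀ ℕ) → k) : MvPowerSeries V k := a

theorem coeff_ofCoeff (a : (V →₀ ℕ) → k) (α : V →₀ ℕ) : coeff α (ofCoeff a) = a α := rfl

/-- Each exponent `α ≠ 0` is charged to one variable `pick α` that occurs in it; the terms charged
to `X i`, divided by `X i`, make up `g i`, and division lowers the degree by one. -/
theorem exists_eq_sum_X_mul [Fintype V] (f : MvPowerSeries V k) (n : ℕ)
    (hf : ∀ α : V →₀ ℕ, α.degree < n + 1 → coeff α f = 0) :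
    ∃ g : V → MvPowerSeries V k, f = ∑ i, X i * g i ∧
      ∀ i (α : V →₀ ℕ), α.degree < n → coeff α (g i) = 0 := by
  classical
  have hex : ∀ α : V →₀ ℕ, ∃ i : Option V, α ≠ 0 → ∃ j, i = some j ∧ α j ≠ 0 := by
    intro α
    by_cases h : α = 0
    · exact ⟨none, fun h' => absurd h h'⟩
    · obtain ⟨j, hj⟩ := Finsupp.ne_iff.1 h
      exact ⟨some j, fun _ => ⟨j, rfl, hj⟩⟩
  choose pick hpick using hex
  refine ⟨fun i => ofCoeff fun α => if pick (α + Finsupp.single i 1) = some i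
    then coeff (α + Finsupp.single i 1) f else 0, ?_, ?_⟩
  · ext α
    rw [map_sum]
    have key : ∀ i, coeff α (X i * ofCoeff fun α => if pick (α + Finsupp.single i 1) = some i
        then coeff (α + Finsupp.single i 1) f else 0) =
        if α i ≠ 0 ∧ pick α = some i then coeff α f else 0 := by
      intro i
      rw [X, coeff_monomial_mul]
      by_cases h : α i = 0
      · rw [if_neg, if_neg (by simp [h])]
        intro h'
        have := h' i
        simp [h] at this
      · have h1 : Finsupp.single i 1 ≤ α := by
          rw [Finsupp.single_le_iff]; omega
        rw [if_pos h1, one_mul]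
        have h2 : α - Finsupp.single i 1 + Finsupp.single i 1 = α := tsub_add_cancel_of_le h1
        rw [coeff_ofCoeff, h2]
        simp [h]
    simp_rw [key]
    by_cases h0 : α = 0
    · subst h0
      simp only [Finsupp.coe_zero, Pi.zero_apply, ne_eq, not_true_eq_false, false_and, if_false,
        Finset.sum_const_zero]
      exact hf 0 (by simp)
    · obtain ⟨j, hj, hj'⟩ := hpick α h0
      rw [Finset.sum_eq_single j]
      · rw [if_pos ⟨hj', hj⟩]
      · intro b _ hb
        rw [if_neg]
        rintro ⟨_, h⟩
        rw [hj] at h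
        exact hb (Option.some.inj h).symm
      · intro h; exact absurd (Finset.mem_univ j) h
  · intro i α hα
    rw [coeff_ofCoeff]
    split_ifs
    · apply hf
      rw [map_add, Finsupp.degree_single]; omega
    · rfl

/-- Peeling off one variable at a time turns the `m`-adic filtration into a condition on
coefficients, in which form it is used from here on. -/
theorem mem_maximalIdeal_pow_iff [Fintype V] (n : ℕ) (f : MvPowerSeries V k) :
    f ∈ maximalIdeal (MvPowerSeries V k) ^ n ↔
      ∀ α : V →₀ ℕ, α.degree < n → coeff α f = 0 := by
  constructor
  · intro h α hα
    exact coeff_of_lt_order (lt_of_lt_of_le (by exact_mod_cast hα)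
      (le_order_of_mem_maximalIdeal_pow n f h))
  · induction n generalizing f with
    | zero => intro _; simp
    | succ n ih =>
      intro h
      obtain ⟨g, hg, hg'⟩ := exists_eq_sum_X_mul f n h
      rw [hg, pow_succ']
      refine Ideal.sum_mem _ fun i _ => Ideal.mul_mem_mul ?_ (ih _ (hg' i))
      rw [mem_maximalIdeal_iff_constantCoeff]; simp

theorem mem_maximalIdeal_pow_iff_le_order [Fintype V] (n : ℕ) (f : MvPowerSeries V k) :
    f ∈ maximalIdeal (MvPowerSeries V k) ^ n ↔ (n : ℕ∞) ≤ f.order := by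
  refine ⟨le_order_of_mem_maximalIdeal_pow n f, fun h => ?_⟩
  rw [mem_maximalIdeal_pow_iff]
  exact fun α hα => coeff_of_lt_order (lt_of_lt_of_le (by exact_mod_cast hα) h)

theorem eq_zero_of_forall_mem_maximalIdeal_pow [Fintype V] (f : MvPowerSeries V k)
    (h : ∀ n, f ∈ maximalIdeal (MvPowerSeries V k) ^ n) : f = 0 := by
  ext α
  exact (mem_maximalIdeal_pow_iff _ f).1 (h (α.degree + 1)) α (by omega)

theorem X_mem_maximalIdeal (i : V) : (X i : MvPowerSeries V k) ∈ maximalIdeal _ := by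
  rw [mem_maximalIdeal_iff_constantCoeff]; simp

/-- The homogeneous part of degree `n` of a power series, as a polynomial. -/
noncomputable def leadPoly [Fintype V] (n : ℕ) : MvPowerSeries V k →ₗ[k] MvPolynomial V k :=
  truncFinset k (Finsupp.finite_of_degree_eq n).toFinset

variable [Fintype V]

open Classical in
theorem coeff_leadPoly (n : ℕ) (f : MvPowerSeries V k) (α : V →₀ ℕ) :
    (leadPoly n f).coeff α = if α.degree = n then coeff α f else 0 := by
  rw [leadPoly, coeff_truncFinset]
  simp

theorem coeff_leadPoly_of_eq {n : ℕ} (f : MvPowerSeries V k) {α : V →₀ ℕ} (h : α.degree = n) :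
    (leadPoly n f).coeff α = coeff α f := by
  rw [coeff_leadPoly, if_pos h]

theorem coeff_leadPoly_of_ne {n : ℕ} (f : MvPowerSeries V k) {α : V →₀ ℕ} (h : α.degree ≠ n) :
    (leadPoly n f).coeff α = 0 := by
  rw [coeff_leadPoly, if_neg h]

theorem leadPoly_mul {n m : ℕ} {f g : MvPowerSeries V k} (hf : f ∈ maximalIdeal _ ^ n)
    (hg : g ∈ maximalIdeal _ ^ m) : leadPoly (n + m) (f * g) = leadPoly n f * leadPoly m g := by
  classical
  rw [mem_maximalIdeal_pow_iff] at hf hg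
  ext α
  rw [coeff_leadPoly, MvPolynomial.coeff_mul]
  split_ifs with h
  · rw [MvPowerSeries.coeff_mul]
    refine Finset.sum_congr rfl fun p hp => ?_
    have hp' := Finset.HasAntidiagonal.mem_antidiagonal.1 hp
    have hd : p.1.degree + p.2.degree = n + m := by rw [← map_add, hp', h]
    rw [coeff_leadPoly, coeff_leadPoly]
    by_cases h1 : p.1.degree = n
    · rw [if_pos h1, if_pos (by omega)]
    · rw [if_neg h1, zero_mul]
      rcases lt_or_gt_of_ne h1 with h2 | h2
      · rw [hf _ h2, zero_mul]
      · rw [hg _ (by omega), mul_zero]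
  · refine (Finset.sum_eq_zero fun p hp => ?_).symm
    have hp' := Finset.HasAntidiagonal.mem_antidiagonal.1 hp
    rw [coeff_leadPoly, coeff_leadPoly]
    have hd : p.1.degree + p.2.degree ≠ n + m := by rw [← map_add, hp']; exact h
    by_cases h1 : p.1.degree = n
    · rw [if_neg (c := p.2.degree = m) (by omega), mul_zero]
    · rw [if_neg h1, zero_mul]

theorem leadPoly_one : leadPoly 0 (1 : MvPowerSeries V k) = 1 := by
  classical
  ext α
  rw [coeff_leadPoly, MvPolynomial.coeff_one, MvPowerSeries.coeff_one]
  have := Finsupp.degree_eq_zero_iff α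
  split_ifs with h1 h2 h3 <;> first | rfl | simp_all

theorem leadPoly_pow {n : ℕ} {f : MvPowerSeries V k} (hf : f ∈ maximalIdeal _ ^ n) (m : ℕ) :
    leadPoly (n * m) (f ^ m) = leadPoly n f ^ m := by
  induction m with
  | zero => simp [leadPoly_one]
  | succ m ih =>
    rw [pow_succ, pow_succ, Nat.mul_succ, leadPoly_mul _ hf, ih]
    rw [pow_mul]; exact Ideal.pow_mem_pow hf m

theorem leadPoly_prod {ι : Type*} (s : Finset ι) (n : ι → ℕ) (f : ι → MvPowerSeries V k)
    (hf : ∀ i ∈ s, f i ∈ maximalIdeal _ ^ n i) :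
    (∏ i ∈ s, f i) ∈ maximalIdeal (MvPowerSeries V k) ^ (∑ i ∈ s, n i) ∧
    leadPoly (∑ i ∈ s, n i) (∏ i ∈ s, f i) = ∏ i ∈ s, leadPoly (n i) (f i) := by
  classical
  induction s using Finset.induction_on with
  | empty => simp [leadPoly_one]
  | insert a s ha ih =>
    obtain ⟨h1, h2⟩ := ih fun i hi => hf i (Finset.mem_insert_of_mem hi)
    have h3 := hf a (Finset.mem_insert_self a s)
    rw [Finset.sum_insert ha, Finset.prod_insert ha, Finset.prod_insert ha]
    exact ⟨by rw [pow_add]; exact Ideal.mul_mem_mul h3 h1, by rw [leadPoly_mul h3 h1, h2]⟩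

theorem leadPoly_eq_zero_iff {n : ℕ} {f : MvPowerSeries V k} (hf : f ∈ maximalIdeal _ ^ n) :
    leadPoly n f = 0 ↔ f ∈ maximalIdeal (MvPowerSeries V k) ^ (n + 1) := by
  rw [mem_maximalIdeal_pow_iff] at hf ⊢
  constructor
  · intro h α hα
    rcases Nat.lt_succ_iff_lt_or_eq.1 hα with h1 | h1
    · exact hf α h1
    · rw [← coeff_leadPoly_of_eq f h1, h, MvPolynomial.coeff_zero]
  · intro h
    ext α
    rw [MvPolynomial.coeff_zero]
    by_cases h1 : α.degree = n
    · rw [coeff_leadPoly_of_eq f h1]; exact h α (by omega)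
    · rw [coeff_leadPoly_of_ne f h1]

theorem leadPoly_of_mem {n : ℕ} {f : MvPowerSeries V k} (hf : f ∈ maximalIdeal _ ^ (n + 1)) :
    leadPoly n f = 0 :=
  (leadPoly_eq_zero_iff (Ideal.pow_le_pow_right n.le_succ hf)).2 hf

theorem leadPoly_isHomogeneous (n : ℕ) (f : MvPowerSeries V k) :
    (leadPoly n f).IsHomogeneous n := by
  intro α hα
  by_contra h
  rw [show (1 : V → ℕ) = fun _ => 1 from rfl, ← Finsupp.degree_eq_weight_one] at h
  exact hα (coeff_leadPoly_of_ne f h)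

theorem leadPoly_coe {n : ℕ} {p : MvPolynomial V k} (hp : p.IsHomogeneous n) :
    leadPoly n (p : MvPowerSeries V k) = p := by
  ext α
  by_cases h : α.degree = n
  · rw [coeff_leadPoly_of_eq _ h, MvPolynomial.coeff_coe]
  · rw [coeff_leadPoly_of_ne _ h, hp.coeff_eq_zero h]

theorem leadPoly_X (i : V) : leadPoly 1 (X i : MvPowerSeries V k) = MvPolynomial.X i := by
  rw [← MvPolynomial.coe_X]
  exact leadPoly_coe (MvPolynomial.isHomogeneous_X k i)

theorem coe_mem_maximalIdeal_pow {n : ℕ} {p : MvPolynomial V k} (hp : p.IsHomogeneous n) :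
    (p : MvPowerSeries V k) ∈ maximalIdeal (MvPowerSeries V k) ^ n := by
  rw [mem_maximalIdeal_pow_iff]
  intro α hα
  rw [MvPolynomial.coeff_coe, hp.coeff_eq_zero (by omega)]

/-- `c` exhibits the power series ring as the completion of the local ring `O`. -/
structure IsCoord {O : Type*} [CommRing O] [IsLocalRing O] [Algebra k O]
    (c : O →ₐ[k] MvPowerSeries V k) : Prop where
  comap : ∀ n, (maximalIdeal (MvPowerSeries V k) ^ n).comap c = maximalIdeal O ^ n
  approx : ∀ (n : ℕ) (f : MvPowerSeries V k), ∃ g : O, f - c g ∈ maximalIdeal _ ^ n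

theorem isCoord_id : IsCoord (AlgHom.id k (MvPowerSeries V k)) where
  comap _ := rfl
  approx _ f := ⟨f, by simp⟩

namespace IsCoord

variable {O : Type*} [CommRing O] [IsLocalRing O] [Algebra k O] {c : O →ₐ[k] MvPowerSeries V k}

theorem mem_iff (hc : IsCoord c) {n : ℕ} {f : O} :
    c f ∈ maximalIdeal (MvPowerSeries V k) ^ n ↔ f ∈ maximalIdeal O ^ n := by
  rw [← hc.comap n, Ideal.mem_comap]

theorem mem_iff' (hc : IsCoord c) {f : O} :
    c f ∈ maximalIdeal (MvPowerSeries V k) ↔ f ∈ maximalIdeal O := by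
  simpa using hc.mem_iff (n := 1) (f := f)

theorem map_le (hc : IsCoord c) (n : ℕ) :
    (maximalIdeal O ^ n).map c ≤ maximalIdeal (MvPowerSeries V k) ^ n := by
  rw [Ideal.map_le_iff_le_comap, hc.comap n]

/-- An element of the extended ideal is congruent to an element of the ideal. -/
theorem exists_mem_sub_mem (hc : IsCoord c) (I : Ideal O) (n : ℕ) {f : MvPowerSeries V k}
    (hf : f ∈ I.map c) : ∃ g ∈ I, f - c g ∈ maximalIdeal (MvPowerSeries V k) ^ n := by
  refine Submodule.span_induction (p := fun f _ => ∃ g ∈ I, f - c g ∈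
    maximalIdeal (MvPowerSeries V k) ^ n) ?_ ?_ ?_ ?_ hf
  · rintro _ ⟨g, hg, rfl⟩
    exact ⟨g, hg, by simp⟩
  · exact ⟨0, I.zero_mem, by simp⟩
  · rintro f f' _ _ ⟨g, hg, h⟩ ⟨g', hg', h'⟩
    refine ⟨g + g', I.add_mem hg hg', ?_⟩
    rw [map_add, add_sub_add_comm]
    exact Ideal.add_mem _ h h'
  · rintro r f _ ⟨g, hg, h⟩
    obtain ⟨s, hs⟩ := hc.approx n r
    refine ⟨s * g, I.mul_mem_left s hg, ?_⟩
    have : r • f - c (s * g) = r * (f - c g) + (r - c s) * c g := by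
      rw [map_mul, smul_eq_mul]; ring
    rw [this]
    exact Ideal.add_mem _ (Ideal.mul_mem_left _ _ h) (Ideal.mul_mem_right _ _ hs)

theorem mem_sup_of_map_sup (hc : IsCoord c) (I : Ideal O) (n : ℕ) {f : O}
    (hf : c f ∈ I.map c ⊔ maximalIdeal (MvPowerSeries V k) ^ n) :
    f ∈ I ⊔ maximalIdeal O ^ n := by
  obtain ⟨a, ha, b, hb, hab⟩ := Submodule.mem_sup.1 hf
  obtain ⟨g, hg, h⟩ := hc.exists_mem_sub_mem I n ha
  refine Submodule.mem_sup.2 ⟨g, hg, f - g, ?_, by ring⟩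
  rw [← hc.mem_iff, map_sub, ← hab]
  have : a + b - c g = (a - c g) + b := by ring
  rw [this]
  exact Ideal.add_mem _ h hb

/-- Krull's intersection theorem in the quotient by `I`: ideals are closed in the `m`-adic topology.
-/
theorem mem_of_forall_sup [IsNoetherianRing O] (I : Ideal O) {f : O}
    (hf : ∀ n, f ∈ I ⊔ maximalIdeal O ^ n) : f ∈ I := by
  rcases eq_or_ne I ⊤ with rfl | hI
  · trivial
  · have h1 := (maximalIdeal O).iInf_pow_smul_eq_bot_of_isLocalRing (M := O ⧸ I)
      (Ideal.IsPrime.ne_top')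
    have h2 : (Ideal.Quotient.mk I f) ∈ (⨅ i : ℕ, maximalIdeal O ^ i • (⊤ : Submodule O (O ⧸ I))) := by
      refine (Submodule.mem_iInf _).2 fun n => ?_
      obtain ⟨a, ha, b, hb, rfl⟩ := Submodule.mem_sup.1 (hf n)
      rw [map_add, Ideal.Quotient.eq_zero_iff_mem.2 ha, zero_add]
      have h3 : Ideal.Quotient.mk I b = b • (1 : O ⧸ I) := by
        rw [Algebra.smul_def, mul_one]; rfl
      rw [h3]
      exact Submodule.smul_mem_smul hb trivial
    rw [h1] at h2
    exact Ideal.Quotient.eq_zero_iff_mem.1 ((Submodule.mem_bot _).1 h2)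

/-- Closedness of ideals together with approximation modulo every power of the maximal ideal. This
brings inclusions proved in the completion back to the local ring. -/
theorem comap_map [IsNoetherianRing O] (hc : IsCoord c) (I : Ideal O) {f : O}
    (hf : c f ∈ I.map c) : f ∈ I :=
  mem_of_forall_sup I fun n => hc.mem_sup_of_map_sup I n (Ideal.mem_sup_left hf)

theorem algebraMap_residue (hc : IsCoord c) (f : O) :
    f - algebraMap k O (constantCoeff (c f)) ∈ maximalIdeal O := by
  rw [← hc.mem_iff', mem_maximalIdeal_iff_constantCoeff, map_sub, map_sub, AlgHom.commutes]
  simp [MvPowerSeries.algebraMap_apply]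

end IsCoord

end PowerSeries

/-! ### Differential operators along a homomorphism -/

section DiffAlong

variable (k : Type*) {A B : Type*} [CommRing k] [CommRing A] [CommRing B] [Algebra k A]
  [Algebra k B]

/-- Differential operators of order at most `n` from `A` to the `A`-algebra `B`. -/
def IsDiffAlong (φ : A →ₐ[k] B) : ℕ → (A →ₗ[k] B) → Prop
  | 0, δ => ∀ r : A, δ ∘ₗ LinearMap.mulLeft k r = LinearMap.mulLeft k (φ r) ∘ₗ δ
  | n + 1, δ => ∀ r : A,
      IsDiffAlong φ n (δ ∘ₗ LinearMap.mulLeft k r - LinearMap.mulLeft k (φ r) ∘ₗ δ)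

variable {k}

theorem isDiffOp_iff_isDiffAlong {n : ℕ} {δ : A →ₗ[k] A} :
    IsDiffOp k n δ ↔ IsDiffAlong k (AlgHom.id k A) n δ := by
  induction n generalizing δ with
  | zero => rfl
  | succ n ih => exact forall_congr' fun r => ih

namespace IsDiffAlong

variable {φ : A →ₐ[k] B}

theorem comm_eq_zero {δ : A →ₗ[k] B} (h : IsDiffAlong k φ 0 δ) (r : A) :
    δ ∘ₗ LinearMap.mulLeft k r - LinearMap.mulLeft k (φ r) ∘ₗ δ = 0 :=
  sub_eq_zero.2 (h r)

theorem zero (n : ℕ) : IsDiffAlong k φ n 0 := by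
  induction n with
  | zero => intro r; simp
  | succ n ih => intro r; simpa using ih

theorem succ {n : ℕ} {δ : A →ₗ[k] B} (h : IsDiffAlong k φ n δ) : IsDiffAlong k φ (n + 1) δ := by
  induction n generalizing δ with
  | zero => intro r; rw [h.comm_eq_zero]; exact zero 0
  | succ n ih => intro r; exact ih (h r)

theorem mono {n m : ℕ} (hnm : n ≤ m) {δ : A →ₗ[k] B} (h : IsDiffAlong k φ n δ) :
    IsDiffAlong k φ m δ := by
  induction hnm with
  | refl => exact h
  | step _ ih => exact ih.succ

theorem add {n : ℕ} {δ δ' : A →ₗ[k] B} (h : IsDiffAlong k φ n δ) (h' : IsDiffAlong k φ n δ') :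
    IsDiffAlong k φ n (δ + δ') := by
  induction n generalizing δ δ' with
  | zero => intro r; rw [LinearMap.add_comp, LinearMap.comp_add, h r, h' r]
  | succ n ih =>
    intro r
    rw [LinearMap.add_comp, LinearMap.comp_add, add_sub_add_comm]
    exact ih (h r) (h' r)

theorem sum {ι : Type*} (s : Finset ι) {n : ℕ} {δ : ι → A →ₗ[k] B}
    (h : ∀ i ∈ s, IsDiffAlong k φ n (δ i)) : IsDiffAlong k φ n (∑ i ∈ s, δ i) := by
  classical
  induction s using Finset.induction_on with
  | empty => simpa using zero n
  | insert a s ha ih =>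
    rw [Finset.sum_insert ha]
    exact (h a (Finset.mem_insert_self a s)).add (ih fun i hi => h i (Finset.mem_insert_of_mem hi))

theorem mulLeft {n : ℕ} {δ : A →ₗ[k] B} (h : IsDiffAlong k φ n δ) (b : B) :
    IsDiffAlong k φ n (LinearMap.mulLeft k b ∘ₗ δ) := by
  induction n generalizing δ with
  | zero =>
    intro r
    have := h r
    ext f
    have h2 := LinearMap.congr_fun this f
    simp only [LinearMap.comp_apply, LinearMap.mulLeft_apply] at h2 ⊢
    rw [h2]; ring
  | succ n ih =>
    intro r
    convert ih (h r) using 1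
    ext f
    simp only [LinearMap.comp_apply, LinearMap.mulLeft_apply, LinearMap.sub_apply]
    ring

theorem sub {n : ℕ} {δ δ' : A →ₗ[k] B} (h : IsDiffAlong k φ n δ) (h' : IsDiffAlong k φ n δ') :
    IsDiffAlong k φ n (δ - δ') := by
  have : δ - δ' = δ + LinearMap.mulLeft k (-1) ∘ₗ δ' := by
    ext f; simp [sub_eq_add_neg]
  rw [this]
  exact h.add (h'.mulLeft _)

/-- The commutator of `ε ∘ δ` with `r` is `ε ∘ [δ, r] + [ε, φ r] ∘ δ`, so induction on the total
order `n + m` applies. -/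
theorem comp {C : Type*} [CommRing C] [Algebra k C] {ψ : B →ₐ[k] C} {n m : ℕ} {δ : A →ₗ[k] B}
    {ε : B →ₗ[k] C} (hε : IsDiffAlong k ψ n ε) (hδ : IsDiffAlong k φ m δ) :
    IsDiffAlong k (ψ.comp φ) (n + m) (ε ∘ₗ δ) := by
  obtain ⟨s, hs⟩ : ∃ s, n + m = s := ⟨_, rfl⟩
  have key : ∀ (δ : A →ₗ[k] B) (ε : B →ₗ[k] C) (r : A),
      (ε ∘ₗ δ) ∘ₗ LinearMap.mulLeft k r - LinearMap.mulLeft k (ψ.comp φ r) ∘ₗ (ε ∘ₗ δ)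
      = ε ∘ₗ (δ ∘ₗ LinearMap.mulLeft k r - LinearMap.mulLeft k (φ r) ∘ₗ δ) +
        (ε ∘ₗ LinearMap.mulLeft k (φ r) - LinearMap.mulLeft k (ψ (φ r)) ∘ₗ ε) ∘ₗ δ := by
    intro δ ε r
    ext f
    simp
  rw [hs]
  induction s generalizing n m δ ε with
  | zero =>
    obtain ⟨rfl, rfl⟩ : n = 0 ∧ m = 0 := by omega
    intro r
    rw [← sub_eq_zero, key δ ε r, hδ.comm_eq_zero, hε.comm_eq_zero]
    simp
  | succ s ih =>
    intro r
    rw [key δ ε r]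
    refine add ?_ ?_
    · cases m with
      | zero => rw [hδ.comm_eq_zero, LinearMap.comp_zero]; exact zero s
      | succ m =>
        exact ih hε (hδ r) (by omega)
    · cases n with
      | zero => rw [hε.comm_eq_zero, LinearMap.zero_comp]; exact zero s
      | succ n =>
        exact ih (hε (φ r)) hδ (by omega)

theorem algHom (φ : A →ₐ[k] B) : IsDiffAlong k φ 0 φ.toLinearMap := by
  intro r; ext f; simp

/-- An operator lowers the order along an ideal by at most its own order. This follows by a double
induction from `δ (r g) = φ r δ g + [δ, r] g`, where the commutator has smaller order. -/
theorem mem_pow {n : ℕ} {δ : A →ₗ[k] B} (h : IsDiffAlong k φ n δ) (I : Ideal A) (a : ℕ) {f : A}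
    (hf : f ∈ I ^ a) : δ f ∈ (I.map φ) ^ (a - n) := by
  induction n generalizing δ a f with
  | zero =>
    have h1 := LinearMap.congr_fun (h f) 1
    simp only [LinearMap.comp_apply, LinearMap.mulLeft_apply, mul_one] at h1
    rw [h1, Nat.sub_zero, ← Ideal.map_pow]
    exact Ideal.mul_mem_right _ _ (Ideal.mem_map_of_mem φ hf)
  | succ n ih =>
    induction a generalizing f with
    | zero => simp
    | succ a iha =>
      rw [pow_succ'] at hf
      refine Submodule.mul_induction_on hf (fun r hr g hg => ?_) fun x y hx hy => ?_
      · have h1 : δ (r * g) = φ r * δ g +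
            (δ ∘ₗ LinearMap.mulLeft k r - LinearMap.mulLeft k (φ r) ∘ₗ δ) g := by simp
        rw [h1]
        refine Ideal.add_mem _ ?_ ?_
        · have h2 : φ r * δ g ∈ (I.map φ) ^ (1 + (a - (n + 1))) := by
            rw [pow_add, pow_one]
            exact Ideal.mul_mem_mul (Ideal.mem_map_of_mem φ hr) (iha hg)
          exact Ideal.pow_le_pow_right (by omega) h2
        · have := ih (h r) a hg
          rwa [Nat.succ_sub_succ]
      · rw [map_add]; exact Ideal.add_mem _ hx hy

end IsDiffAlong

theorem IsDiffOp.mem_pow {n : ℕ} {δ : A →ₗ[k] A} (h : IsDiffOp k n δ) (I : Ideal A) (a : ℕ) {f : A}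
    (hf : f ∈ I ^ a) : δ f ∈ I ^ (a - n) := by
  have := (isDiffOp_iff_isDiffAlong.1 h).mem_pow I a hf
  rwa [show I.map (AlgHom.id k A) = I from Ideal.map_id I] at this

theorem IsDiffOp.comp {n m : ℕ} {δ ε : A →ₗ[k] A} (h : IsDiffOp k n δ) (h' : IsDiffOp k m ε) :
    IsDiffOp k (n + m) (δ ∘ₗ ε) :=
  isDiffOp_iff_isDiffAlong.2
    ((isDiffOp_iff_isDiffAlong.1 h).comp (isDiffOp_iff_isDiffAlong.1 h'))

theorem IsDiffOp.id : IsDiffOp k 0 (LinearMap.id : A →ₗ[k] A) := fun r => by ext f; simp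

end DiffAlong

/-! ### Hasse derivatives in several variables -/

section Hasse

open MvPowerSeries

variable {k V : Type*} [Field k] [Fintype V]

/-- The product of binomial coefficients of multi-indices. -/
def multiChoose (a K : V →₀ ℕ) : ℕ := ∏ i, (a i).choose (K i)

theorem multiChoose_eq_zero {a K : V →₀ ℕ} (h : ¬ K ≤ a) : multiChoose a K = 0 := by
  rw [Finsupp.le_def] at h
  push Not at h
  obtain ⟨i, hi⟩ := h
  exact Finset.prod_eq_zero (Finset.mem_univ i) (Nat.choose_eq_zero_of_lt hi)

open Classical in
theorem coeff_prod_one_add_X (a K : V →₀ ℕ) :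
    (∏ i, (1 + MvPolynomial.X i : MvPolynomial V ℕ) ^ a i).coeff K = multiChoose a K := by
  have h1 : ∀ i, (1 + MvPolynomial.X i : MvPolynomial V ℕ) ^ a i =
      ∑ m ∈ Finset.range (a i + K i + 1), MvPolynomial.monomial (Finsupp.single i m) ((a i).choose m) := by
    intro i
    rw [add_comm, add_pow]
    have hsub : Finset.range (a i + 1) ⊆ Finset.range (a i + K i + 1) := by
      intro m hm; rw [Finset.mem_range] at *; omega
    rw [← Finset.sum_subset hsub]
    · refine Finset.sum_congr rfl fun m _ => ?_
      rw [one_pow, mul_one, MvPolynomial.X_pow_eq_monomial, ← MvPolynomial.C_eq_coe_nat, mul_comm,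
        MvPolynomial.C_mul_monomial]
      simp
    · intro m _ hm
      rw [Nat.choose_eq_zero_of_lt (by rw [Finset.mem_range] at hm; omega), map_zero]
  simp_rw [h1]
  have h2 : ∀ p : V → ℕ, (∏ i, MvPolynomial.monomial (Finsupp.single i (p i)) ((a i).choose (p i)) :
      MvPolynomial V ℕ) = MvPolynomial.monomial (Finsupp.equivFunOnFinite.symm p)
        (∏ i, (a i).choose (p i)) := by
    intro p
    rw [← MvPolynomial.monomial_sum_prod]
    have h3 : ∑ i, Finsupp.single i (p i) = Finsupp.equivFunOnFinite.symm p := by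
      ext j
      simp [Finsupp.finsetSum_apply, Finsupp.single_apply]
    rw [h3]
  rw [Finset.prod_univ_sum, MvPolynomial.coeff_sum, Finset.sum_eq_single (fun i => K i)]
  · rw [h2, MvPolynomial.coeff_monomial, if_pos (by ext; rfl)]
    rfl
  · intro p _ hp
    rw [h2, MvPolynomial.coeff_monomial, if_neg]
    intro h
    apply hp
    rw [← h]; rfl
  · intro h
    exact absurd (Fintype.mem_piFinset.2 fun i => Finset.mem_range.2 (by omega)) h

open Classical in
-- Vandermonde's identity, read off from the coefficient of `X^K` in the product of the `(1 +
-- X_i)^{a_i + b_i}`.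
theorem sum_multiChoose_mul (a b K : V →₀ ℕ) :
    ∑ p ∈ Finset.HasAntidiagonal.antidiagonal K, multiChoose a p.1 * multiChoose b p.2 =
      multiChoose (a + b) K := by
  rw [← coeff_prod_one_add_X]
  simp_rw [Finsupp.add_apply, pow_add, Finset.prod_mul_distrib]
  rw [MvPolynomial.coeff_mul]
  simp_rw [coeff_prod_one_add_X]

/-- The Hasse derivative with respect to a multi-index. -/
noncomputable def hasse (K : V →₀ ℕ) : MvPowerSeries V k →ₗ[k] MvPowerSeries V k where
  toFun f := ofCoeff fun m => (multiChoose (m + K) K : k) * coeff (m + K) f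
  map_add' f g := by ext m; simp [coeff_ofCoeff, mul_add]
  map_smul' r f := by ext m; simp [coeff_ofCoeff, mul_left_comm]

theorem coeff_hasse (K m : V →₀ ℕ) (f : MvPowerSeries V k) :
    coeff m (hasse K f) = (multiChoose (m + K) K : k) * coeff (m + K) f := rfl

theorem hasse_zero : hasse (0 : V →₀ ℕ) = (LinearMap.id : MvPowerSeries V k →ₗ[k] _) := by
  ext f m
  simp [coeff_hasse, multiChoose]

open Classical in
-- The Leibniz rule. Its coefficients are double sums that agree by Vandermonde's identity, once the
-- exponents of the two factors are shifted by the two parts of `K`.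
theorem hasse_mul (K : V →₀ ℕ) (f g : MvPowerSeries V k) :
    hasse K (f * g) = ∑ p ∈ Finset.HasAntidiagonal.antidiagonal K, hasse p.1 f * hasse p.2 g := by
  ext m
  rw [coeff_hasse, MvPowerSeries.coeff_mul, map_sum]
  have key : ∀ p ∈ Finset.HasAntidiagonal.antidiagonal K, coeff m (hasse p.1 f * hasse p.2 g) =
      ∑ q ∈ Finset.HasAntidiagonal.antidiagonal (m + K),
        ((multiChoose q.1 p.1 * multiChoose q.2 p.2 : ℕ) : k) * (coeff q.1 f * coeff q.2 g) := by
    intro p hp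
    have hp' := Finset.HasAntidiagonal.mem_antidiagonal.1 hp
    rw [MvPowerSeries.coeff_mul]
    -- The pairs that are not such shifts carry a vanishing binomial coefficient.
    refine Finset.sum_of_injOn (fun q => (q.1 + p.1, q.2 + p.2)) ?_ ?_ ?_ ?_
    · intro q _ q' _ h
      simp only [Prod.mk.injEq, add_left_inj] at h
      exact Prod.ext h.1 h.2
    · intro q hq
      have hq' := Finset.HasAntidiagonal.mem_antidiagonal.1 hq
      refine Finset.HasAntidiagonal.mem_antidiagonal.2 ?_
      rw [← hq', ← hp']
      change q.1 + p.1 + (q.2 + p.2) = _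
      abel
    · intro q hq hq'
      have h1 := Finset.HasAntidiagonal.mem_antidiagonal.1 hq
      by_cases h2 : p.1 ≤ q.1
      · by_cases h3 : p.2 ≤ q.2
        · exfalso
          apply hq'
          refine ⟨(q.1 - p.1, q.2 - p.2), ?_, ?_⟩
          · refine Finset.HasAntidiagonal.mem_antidiagonal.2 ?_
            change q.1 - p.1 + (q.2 - p.2) = m
            ext i
            have e1 := DFunLike.congr_fun h1 i
            have e2 := DFunLike.congr_fun hp' i
            have e3 := h2 i
            have e4 := h3 i
            simp only [Finsupp.add_apply, Finsupp.tsub_apply] at *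
            omega
          · exact Prod.ext (tsub_add_cancel_of_le h2) (tsub_add_cancel_of_le h3)
        · rw [multiChoose_eq_zero h3, mul_zero, Nat.cast_zero, zero_mul]
      · rw [multiChoose_eq_zero h2, zero_mul, Nat.cast_zero, zero_mul]
    · intro q _
      rw [coeff_hasse, coeff_hasse]
      push_cast
      ring
  rw [Finset.sum_congr rfl key, Finset.sum_comm, Finset.mul_sum]
  refine Finset.sum_congr rfl fun q hq => ?_
  rw [← Finset.sum_mul, ← Nat.cast_sum, sum_multiChoose_mul,
    Finset.HasAntidiagonal.mem_antidiagonal.1 hq]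

/-- By the Leibniz rule the commutator with `r` is the sum of the `(D_{K'} r) D_{K''}` with `K' +
K'' = K` and `K' ≠ 0`, in which only operators of smaller order occur. -/
theorem isDiffAlong_hasse (K : V →₀ ℕ) :
    IsDiffAlong k (AlgHom.id k (MvPowerSeries V k)) K.degree (hasse K) := by
  classical
  obtain ⟨n, hn⟩ : ∃ n, K.degree = n := ⟨_, rfl⟩
  rw [hn]
  induction n using Nat.strong_induction_on generalizing K with
  | _ n ih =>
    cases n with
    | zero =>
      rw [Finsupp.degree_eq_zero_iff] at hn
      rw [hn, hasse_zero]
      exact IsDiffAlong.algHom (AlgHom.id k (MvPowerSeries V k))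
    | succ n =>
      intro r
      have h1 : hasse K ∘ₗ LinearMap.mulLeft k r -
          LinearMap.mulLeft k ((AlgHom.id k (MvPowerSeries V k)) r) ∘ₗ hasse K =
          ∑ p ∈ (Finset.HasAntidiagonal.antidiagonal K).erase (0, K),
            LinearMap.mulLeft k (hasse p.1 r) ∘ₗ hasse p.2 := by
        ext1 f
        have hm : ((0, K) : (V →₀ ℕ) × (V →₀ ℕ)) ∈ Finset.HasAntidiagonal.antidiagonal K :=
          Finset.HasAntidiagonal.mem_antidiagonal.2 (zero_add K)
        simp only [LinearMap.sub_apply, LinearMap.comp_apply, LinearMap.mulLeft_apply,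
          AlgHom.id_apply, LinearMap.sum_apply]
        rw [hasse_mul, ← Finset.add_sum_erase _ _ hm, hasse_zero, LinearMap.id_apply]
        ring
      rw [h1]
      refine IsDiffAlong.sum _ fun p hp => IsDiffAlong.mulLeft ?_ _
      have hp1 := Finset.HasAntidiagonal.mem_antidiagonal.1 (Finset.mem_of_mem_erase hp)
      have hp2 := Finset.ne_of_mem_erase hp
      have hd : p.1.degree + p.2.degree = n + 1 := by rw [← map_add, hp1, hn]
      have h0 : p.1.degree ≠ 0 := by
        intro h
        rw [Finsupp.degree_eq_zero_iff] at h
        apply hp2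
        rw [h, zero_add] at hp1
        exact Prod.ext h hp1
      exact (ih p.2.degree (by omega) p.2 rfl).mono (by omega)

theorem hasse_mem_pow {K : V →₀ ℕ} {a : ℕ} {f : MvPowerSeries V k}
    (hf : f ∈ maximalIdeal (MvPowerSeries V k) ^ a) :
    hasse K f ∈ maximalIdeal (MvPowerSeries V k) ^ (a - K.degree) :=
  (isDiffOp_iff_isDiffAlong.2 (isDiffAlong_hasse K)).mem_pow _ _ hf

end Hasse

/-! ### Linear parts, regular systems of parameters and changes of coordinates -/

section RegularSystem

open MvPowerSeries

variable {k V ι : Type*} [Field k] [Fintype V] [Fintype ι]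

/-- The linear form with the given coefficients. -/
noncomputable def linPoly (v : V → k) : MvPolynomial V k := ∑ j, MvPolynomial.C (v j) * MvPolynomial.X j

/-- The coefficients of the linear part of a power series. -/
noncomputable def linPart (f : MvPowerSeries V k) : V → k := fun j => coeff (Finsupp.single j 1) f

theorem coeff_linPoly (v : V → k) (j : V) : (linPoly v).coeff (Finsupp.single j 1) = v j := by
  classical
  rw [linPoly, MvPolynomial.coeff_sum, Finset.sum_eq_single j]
  · simp [MvPolynomial.coeff_C_mul]
  · intro b _ hb
    rw [MvPolynomial.coeff_C_mul, MvPolynomial.coeff_X, if_neg, mul_zero]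
    intro h
    exact hb (Finsupp.single_left_injective one_ne_zero h)
  · intro h; exact absurd (Finset.mem_univ j) h

theorem linPoly_isHomogeneous (v : V → k) : (linPoly v).IsHomogeneous 1 := by
  refine MvPolynomial.IsHomogeneous.sum _ _ _ fun j _ => ?_
  rw [show (1 : ℕ) = 0 + 1 from rfl]
  exact (MvPolynomial.isHomogeneous_C _ _).mul (MvPolynomial.isHomogeneous_X _ _)

theorem leadPoly_one_eq (f : MvPowerSeries V k) : leadPoly 1 f = linPoly (linPart f) := by
  ext α
  by_cases h : α.degree = 1
  · obtain ⟨j, rfl⟩ : α ∈ Set.range (fun a : V => Finsupp.single a 1) := by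
      rw [Finsupp.range_single_one]; exact h
    change MvPolynomial.coeff (Finsupp.single j 1) _ = MvPolynomial.coeff (Finsupp.single j 1) _
    rw [coeff_leadPoly_of_eq _ h, coeff_linPoly]; rfl
  · rw [coeff_leadPoly_of_ne _ h, (linPoly_isHomogeneous _).coeff_eq_zero h]

theorem aeval_mem_and_leadPoly {n : ℕ} {p : MvPolynomial ι k} (hp : p.IsHomogeneous n)
    (F : ι → MvPowerSeries V k) (hF : ∀ i, F i ∈ maximalIdeal _) :
    MvPolynomial.aeval F p ∈ maximalIdeal (MvPowerSeries V k) ^ n ∧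
      leadPoly n (MvPolynomial.aeval F p) = MvPolynomial.aeval (fun i => leadPoly 1 (F i)) p := by
  have key : ∀ α ∈ p.support,
      MvPolynomial.aeval F (MvPolynomial.monomial α (p.coeff α)) ∈
        maximalIdeal (MvPowerSeries V k) ^ n ∧
      leadPoly n (MvPolynomial.aeval F (MvPolynomial.monomial α (p.coeff α))) =
        MvPolynomial.aeval (fun i => leadPoly 1 (F i)) (MvPolynomial.monomial α (p.coeff α)) := by
    intro α hα
    have hd : ∑ i, α i = n := by
      rw [← Finsupp.degree_eq_sum]
      by_contra h
      exact MvPolynomial.mem_support_iff.1 hα (hp.coeff_eq_zero h)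
    have h1 := leadPoly_prod Finset.univ (fun i => α i) (fun i => F i ^ α i)
      fun i _ => Ideal.pow_mem_pow (hF i) _
    rw [hd] at h1
    rw [MvPolynomial.aeval_monomial, MvPolynomial.aeval_monomial,
      Finsupp.prod_fintype _ _ (by simp), Finsupp.prod_fintype _ _ (by simp)]
    refine ⟨Ideal.mul_mem_left _ _ h1.1, ?_⟩
    rw [← Algebra.smul_def, ← Algebra.smul_def, map_smul, h1.2]
    congr 1
    refine Finset.prod_congr rfl fun i _ => ?_
    have := leadPoly_pow (n := 1) (f := F i) (by simpa using hF i) (α i)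
    rwa [one_mul] at this
  rw [p.as_sum, map_sum, map_sum, map_sum]
  exact ⟨Ideal.sum_mem _ fun α hα => (key α hα).1, Finset.sum_congr rfl fun α hα => (key α hα).2⟩

variable {O : Type*} [CommRing O] [IsLocalRing O] [Algebra k O]

theorem aeval_mem_pow_of_coeff {n : ℕ} {p : MvPolynomial ι k} {g : ι → O}
    (hg : ∀ i, g i ∈ maximalIdeal O) (hp : ∀ α : ι →₀ ℕ, α.degree < n → p.coeff α = 0) :
    MvPolynomial.aeval g p ∈ maximalIdeal O ^ n := by
  rw [p.as_sum, map_sum]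
  refine Ideal.sum_mem _ fun α hα => ?_
  have hd : n ≤ ∑ i, α i := by
    rw [← Finsupp.degree_eq_sum]
    by_contra h
    exact MvPolynomial.mem_support_iff.1 hα (hp α (by omega))
  rw [MvPolynomial.aeval_monomial, Finsupp.prod_fintype _ _ (by simp)]
  refine Ideal.mul_mem_left _ _ (Ideal.pow_le_pow_right hd ?_)
  rw [← Finset.prod_pow_eq_pow_sum]
  exact Ideal.prod_mem_prod fun i _ => Ideal.pow_mem_pow (hg i) _

variable {c : O →ₐ[k] MvPowerSeries V k}

theorem IsCoord.exists_lift_X (hc : IsCoord c) (n : ℕ) (j : V) :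
    ∃ x ∈ maximalIdeal O, c x - X j ∈ maximalIdeal (MvPowerSeries V k) ^ (n + 1) := by
  obtain ⟨x, hx⟩ := hc.approx (n + 1) (X j)
  refine ⟨x, ?_, by rw [← neg_mem_iff, neg_sub]; exact hx⟩
  rw [← hc.mem_iff']
  have : c x = X j - (X j - c x) := by ring
  rw [this]
  exact Ideal.sub_mem _ (X_mem_maximalIdeal j) (Ideal.pow_le_self n.succ_ne_zero hx)

/-- A lift of `X j` is a combination of the generators `g i`. Modulo the square of the maximal ideal
only the constant terms of its coefficients matter, and they form the row `j` of a left inverse of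
the matrix of linear parts. -/
theorem IsCoord.exists_matrix [DecidableEq V] (hc : IsCoord c) {g : ι → O}
    (hg : Ideal.span (Set.range g) = maximalIdeal O) :
    ∃ A : Matrix V ι k, A * (Matrix.of fun i => linPart (c (g i))) = 1 := by
  have h1 : ∀ j : V, ∃ a : ι → k, ∀ j', ∑ i, a i * linPart (c (g i)) j' = if j = j' then 1 else 0 := by
    intro j
    obtain ⟨x, hx, hx'⟩ := hc.exists_lift_X 1 j
    rw [← hg, Ideal.mem_span_range_iff_exists_fun] at hx
    obtain ⟨b, hb⟩ := hx
    refine ⟨fun i => constantCoeff (c (b i)), fun j' => ?_⟩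
    have h2 : coeff (Finsupp.single j' 1) (c x) = coeff (Finsupp.single j' 1) (X j : MvPowerSeries V k) := by
      rw [← sub_eq_zero, ← map_sub]
      exact (mem_maximalIdeal_pow_iff _ _).1 hx' _ (by simp)
    rw [coeff_X, ← hb, map_sum, map_sum] at h2
    have h3 : (if j = j' then (1 : k) else 0) = if Finsupp.single j' 1 = Finsupp.single j 1 then 1 else 0 := by
      by_cases h : j = j'
      · simp [h]
      · rw [if_neg h, if_neg]
        intro h'
        exact h (Finsupp.single_left_injective one_ne_zero h').symm
    rw [h3]
    convert h2 using 1
    refine Finset.sum_congr rfl fun i _ => ?_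
    have hgi : c (g i) ∈ maximalIdeal (MvPowerSeries V k) := by
      rw [hc.mem_iff', ← hg]; exact Ideal.subset_span ⟨i, rfl⟩
    have h4 : c (b i) * c (g i) = C (constantCoeff (c (b i))) * c (g i) +
        (c (b i) - C (constantCoeff (c (b i)))) * c (g i) := by ring
    have h5 : (c (b i) - C (constantCoeff (c (b i)))) * c (g i) ∈
        maximalIdeal (MvPowerSeries V k) ^ 2 := by
      rw [pow_two]
      refine Ideal.mul_mem_mul ?_ hgi
      rw [mem_maximalIdeal_iff_constantCoeff]; simp
    rw [map_mul, h4, map_add, (mem_maximalIdeal_pow_iff _ _).1 h5 _ (by simp), add_zero, coeff_C_mul]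
    rfl
  choose A hA using h1
  refine ⟨Matrix.of A, ?_⟩
  ext j j'
  rw [Matrix.mul_apply, Matrix.one_apply]
  exact hA j j'

theorem IsCoord.card_le (hc : IsCoord c) {g : ι → O}
    (hg : Ideal.span (Set.range g) = maximalIdeal O) : Fintype.card V ≤ Fintype.card ι := by
  classical
  obtain ⟨A, hA⟩ := hc.exists_matrix hg
  have h1 : (1 : Matrix V V k).rank ≤ A.rank := by rw [← hA]; exact Matrix.rank_mul_le_left _ _
  rw [Matrix.rank_one] at h1
  exact h1.trans (Matrix.rank_le_card_width A)

/-- With as many generators as variables the left inverse matrix is a two-sided inverse, and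
substituting it undoes the linear change of variables. -/
theorem IsCoord.aeval_linPart_injective (hc : IsCoord c) {g : ι → O}
    (hg : Ideal.span (Set.range g) = maximalIdeal O) (hcard : Fintype.card ι = Fintype.card V) :
    Function.Injective (MvPolynomial.aeval (R := k) (fun i => leadPoly 1 (c (g i))) :
      MvPolynomial ι k → MvPolynomial V k) := by
  classical
  obtain ⟨A, hA⟩ := hc.exists_matrix hg
  have hB := (Matrix.mul_eq_one_comm_of_card_eq V ι k hcard.symm).1 hA
  refine Function.LeftInverse.injective (g := MvPolynomial.aeval (R := k) fun j => linPoly (A j)) ?_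
  intro p
  have : ((MvPolynomial.aeval (R := k) fun j => linPoly (A j)).comp
      (MvPolynomial.aeval (R := k) (fun i => leadPoly 1 (c (g i))))) =
      AlgHom.id k (MvPolynomial ι k) := by
    refine MvPolynomial.algHom_ext fun i => ?_
    rw [AlgHom.comp_apply, MvPolynomial.aeval_X, leadPoly_one_eq, linPoly, map_sum, AlgHom.id_apply]
    simp_rw [map_mul, MvPolynomial.aeval_C, MvPolynomial.aeval_X, linPoly, Finset.mul_sum]
    rw [Finset.sum_comm]
    have h1 : ∀ i', (∑ j, (algebraMap k (MvPolynomial ι k)) (linPart (c (g i)) j) *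
        (MvPolynomial.C (A j i') * MvPolynomial.X i')) =
        MvPolynomial.C ((1 : Matrix ι ι k) i i') * MvPolynomial.X i' := by
      intro i'
      rw [← hB, Matrix.mul_apply, map_sum, Finset.sum_mul]
      refine Finset.sum_congr rfl fun j _ => ?_
      rw [map_mul, mul_assoc]; rfl
    simp_rw [h1, Matrix.one_apply]
    rw [Finset.sum_eq_single i]
    · simp
    · intro b _ hb; rw [if_neg hb.symm]; simp
    · intro h; exact absurd (Finset.mem_univ i) h
  exact AlgHom.congr_fun this p

/-- Analytic independence of parameters: once the lower degrees of `p` are known to vanish, the part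
of degree `l` substituted in the linear parts of the `g i` is an initial form that has to vanish,
and this substitution is injective. -/
theorem IsCoord.coeff_eq_zero_of_aeval_mem (hc : IsCoord c) {g : ι → O}
    (hg : Ideal.span (Set.range g) = maximalIdeal O) (hcard : Fintype.card ι = Fintype.card V)
    {n : ℕ} {p : MvPolynomial ι k} (hp : MvPolynomial.aeval g p ∈ maximalIdeal O ^ n)
    (α : ι →₀ ℕ) (hα : α.degree < n) : p.coeff α = 0 := by
  obtain ⟨l, hl⟩ : ∃ l, α.degree = l := ⟨_, rfl⟩
  rw [hl] at hα
  induction l using Nat.strong_induction_on generalizing α with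
  | _ l ih =>
    have hgm : ∀ i, g i ∈ maximalIdeal O := fun i => by rw [← hg]; exact Ideal.subset_span ⟨i, rfl⟩
    have h1 : MvPolynomial.aeval g (p - p.homogeneousComponent l) ∈ maximalIdeal O ^ (l + 1) := by
      refine aeval_mem_pow_of_coeff hgm fun β hβ => ?_
      rw [MvPolynomial.coeff_sub, MvPolynomial.coeff_homogeneousComponent]
      split_ifs with h
      · rw [sub_self]
      · rw [sub_zero]; exact ih β.degree (by omega) β (by omega) rfl
    have h2 : MvPolynomial.aeval g (p.homogeneousComponent l) ∈ maximalIdeal O ^ (l + 1) := by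
      rw [map_sub] at h1
      have := Ideal.sub_mem _ (Ideal.pow_le_pow_right (show l + 1 ≤ n by omega) hp) h1
      rwa [sub_sub_cancel] at this
    rw [← hc.mem_iff] at h2
    have h3 := aeval_mem_and_leadPoly (MvPolynomial.homogeneousComponent_isHomogeneous l p)
      (fun i => c (g i)) fun i => hc.mem_iff'.2 (hgm i)
    have h4 : c (MvPolynomial.aeval g (p.homogeneousComponent l)) =
        MvPolynomial.aeval (fun i => c (g i)) (p.homogeneousComponent l) := by
      exact (MvPolynomial.comp_aeval_apply g c _)
    rw [h4] at h2
    rw [leadPoly_of_mem h2] at h3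
    have h5 := hc.aeval_linPart_injective hg hcard (h3.2.symm.trans (map_zero _).symm)
    have h6 := congrArg (MvPolynomial.coeff α) h5
    rwa [MvPolynomial.coeff_homogeneousComponent, if_pos hl, MvPolynomial.coeff_zero] at h6

theorem exists_aeval_sub_mem_of_mem_pow (hres : ∀ f : O, ∃ a : k, f - algebraMap k O a ∈ maximalIdeal O)
    {g : ι → O} (hg : Ideal.span (Set.range g) = maximalIdeal O) (n : ℕ) {f : O}
    (hf : f ∈ maximalIdeal O ^ n) :
    ∃ p : MvPolynomial ι k, f - MvPolynomial.aeval g p ∈ maximalIdeal O ^ (n + 1) := by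
  induction n generalizing f with
  | zero =>
    obtain ⟨a, ha⟩ := hres f
    exact ⟨MvPolynomial.C a, by simpa using ha⟩
  | succ n ih =>
    rw [pow_succ'] at hf
    refine Submodule.mul_induction_on hf (fun r hr h hh => ?_) fun x y hx hy => ?_
    · rw [← hg, Ideal.mem_span_range_iff_exists_fun] at hr
      obtain ⟨b, rfl⟩ := hr
      choose p hp using fun i => ih (Ideal.mul_mem_left _ (b i) hh)
      refine ⟨∑ i, MvPolynomial.X i * p i, ?_⟩
      rw [map_sum, Finset.sum_mul, ← Finset.sum_sub_distrib]
      refine Ideal.sum_mem _ fun i _ => ?_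
      rw [map_mul, MvPolynomial.aeval_X]
      have : b i * g i * h - g i * MvPolynomial.aeval g (p i) =
        g i * (b i * h - MvPolynomial.aeval g (p i)) := by ring
      rw [this, pow_succ' _ (n + 1)]
      refine Ideal.mul_mem_mul ?_ (hp i)
      rw [← hg]; exact Ideal.subset_span ⟨i, rfl⟩
    · obtain ⟨p, hp⟩ := hx
      obtain ⟨q, hq⟩ := hy
      refine ⟨p + q, ?_⟩
      rw [map_add, add_sub_add_comm]
      exact Ideal.add_mem _ hp hq

theorem exists_aeval_sub_mem (hres : ∀ f : O, ∃ a : k, f - algebraMap k O a ∈ maximalIdeal O)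
    {g : ι → O} (hg : Ideal.span (Set.range g) = maximalIdeal O) (n : ℕ) (f : O) :
    ∃ p : MvPolynomial ι k, f - MvPolynomial.aeval g p ∈ maximalIdeal O ^ n := by
  induction n with
  | zero => exact ⟨0, by simp⟩
  | succ n ih =>
    obtain ⟨p, hp⟩ := ih
    obtain ⟨q, hq⟩ := exists_aeval_sub_mem_of_mem_pow hres hg n hp
    refine ⟨p + q, ?_⟩
    rw [map_add, ← sub_sub]; exact hq

/-- A system of `d` generators of the maximal ideal gives coordinates of the completion. -/
theorem IsCoord.exists_coord_eq_X (hc : IsCoord c) {g : ι → O}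
    (hg : Ideal.span (Set.range g) = maximalIdeal O) (hcard : Fintype.card ι = Fintype.card V) :
    ∃ c' : O →ₐ[k] MvPowerSeries ι k, IsCoord c' ∧ ∀ i, c' (g i) = X i := by
  classical
  choose P hP using fun (f : O) (n : ℕ) =>
    exists_aeval_sub_mem (fun f => ⟨_, hc.algebraMap_residue f⟩) hg n f
  -- The coefficient at `α` is taken from a polynomial in the parameters that approximates `f` to
  -- order `|α| + 1`. By `hF` any other approximation of that order gives the same coefficient,
  -- which is why `F` is a ring homomorphism.
  let F : O → MvPowerSeries ι k := fun f => ofCoeff fun α => (P f (α.degree + 1)).coeff α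
  have hF : ∀ (f : O) (n : ℕ) (p : MvPolynomial ι k), f - MvPolynomial.aeval g p ∈ maximalIdeal O ^ n →
      ∀ α : ι →₀ ℕ, α.degree < n → coeff α (F f) = p.coeff α := by
    intro f n p hp α hα
    change (P f (α.degree + 1)).coeff α = _
    rw [← sub_eq_zero, ← MvPolynomial.coeff_sub]
    refine hc.coeff_eq_zero_of_aeval_mem hg hcard (n := α.degree + 1) ?_ α (by omega)
    rw [map_sub]
    have h1 := Ideal.sub_mem _ (Ideal.pow_le_pow_right (show α.degree + 1 ≤ n by omega) hp)
      (hP f (α.degree + 1))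
    rwa [sub_sub_sub_cancel_left] at h1
  have hFp : ∀ p : MvPolynomial ι k, F (MvPolynomial.aeval g p) = p := by
    intro p
    ext α
    rw [hF _ (α.degree + 1) p (by simp) α (by omega), MvPolynomial.coeff_coe]
  have hgm : ∀ i, g i ∈ maximalIdeal O := fun i => by rw [← hg]; exact Ideal.subset_span ⟨i, rfl⟩
  have hFadd : ∀ f h, F (f + h) = F f + F h := by
    intro f h
    ext α
    rw [map_add, hF f _ _ (hP f (α.degree + 1)) α (by omega),
      hF h _ _ (hP h (α.degree + 1)) α (by omega), ← MvPolynomial.coeff_add]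
    refine hF _ (α.degree + 1) _ ?_ α (by omega)
    rw [map_add, add_sub_add_comm]
    exact Ideal.add_mem _ (hP _ _) (hP _ _)
  have hFmul : ∀ f h, F (f * h) = F f * F h := by
    intro f h
    ext α
    have h1 : f * h - MvPolynomial.aeval g (P f (α.degree + 1) * P h (α.degree + 1)) ∈
        maximalIdeal O ^ (α.degree + 1) := by
      rw [map_mul]
      have : f * h - MvPolynomial.aeval g (P f (α.degree + 1)) * MvPolynomial.aeval g (P h (α.degree + 1))
        = f * (h - MvPolynomial.aeval g (P h (α.degree + 1))) +
          (f - MvPolynomial.aeval g (P f (α.degree + 1))) * MvPolynomial.aeval g (P h (α.degree + 1)) := by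
        ring
      rw [this]
      exact Ideal.add_mem _ (Ideal.mul_mem_left _ _ (hP _ _)) (Ideal.mul_mem_right _ _ (hP _ _))
    rw [hF _ _ _ h1 α (by omega), MvPolynomial.coeff_mul, MvPowerSeries.coeff_mul]
    refine Finset.sum_congr rfl fun p hp => ?_
    have hd : p.1.degree + p.2.degree = α.degree := by
      rw [← map_add, Finset.HasAntidiagonal.mem_antidiagonal.1 hp]
    rw [hF f _ _ (hP f (α.degree + 1)) p.1 (by omega),
      hF h _ _ (hP h (α.degree + 1)) p.2 (by omega)]
  have hFC : ∀ a : k, F (algebraMap k O a) = algebraMap k _ a := by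
    intro a
    have := hFp (MvPolynomial.C a)
    rw [MvPolynomial.aeval_C] at this
    rw [this, MvPolynomial.coe_C]
    rfl
  have hF0 : F 0 = 0 := by have := hFC 0; rwa [map_zero, map_zero] at this
  have hF1 : F 1 = 1 := by have := hFC 1; rwa [map_one, map_one] at this
  let c' : O →ₐ[k] MvPowerSeries ι k :=
    { toFun := F, map_one' := hF1, map_mul' := hFmul, map_zero' := hF0, map_add' := hFadd,
      commutes' := hFC }
  have hc'F : ∀ f, c' f = F f := fun _ => rfl
  refine ⟨c', ⟨fun n => ?_, fun n f => ?_⟩, fun i => ?_⟩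
  · ext f
    rw [Ideal.mem_comap, mem_maximalIdeal_pow_iff, hc'F]
    have h1 : f ∈ maximalIdeal O ^ n ↔ MvPolynomial.aeval g (P f n) ∈ maximalIdeal O ^ n := by
      have h2 := hP f n
      constructor
      · intro h; have := Ideal.sub_mem _ h h2; rwa [sub_sub_cancel] at this
      · intro h; have := Ideal.add_mem _ h2 h; rwa [sub_add_cancel] at this
    rw [h1]
    constructor
    · intro h
      refine aeval_mem_pow_of_coeff hgm fun α hα => ?_
      rw [← hF f n _ (hP f n) α hα]; exact h α hα
    · intro h α hα
      rw [hF f n _ (hP f n) α hα]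
      exact hc.coeff_eq_zero_of_aeval_mem hg hcard h α hα
  · refine ⟨MvPolynomial.aeval g (truncTotal n f), ?_⟩
    rw [mem_maximalIdeal_pow_iff, hc'F, hFp]
    intro α hα
    rw [map_sub, MvPolynomial.coeff_coe, coeff_truncTotal _ hα, sub_self]
  · rw [hc'F]
    have := hFp (MvPolynomial.X i)
    rwa [MvPolynomial.aeval_X, MvPolynomial.coe_X] at this

/-- Nakayama's lemma: to first order every element of the maximal ideal is a combination of the `x
j` with the coefficients of its linear part. -/
theorem IsCoord.span_eq_maximalIdeal [IsNoetherianRing O] (hc : IsCoord c) {x : V → O}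
    (hx : ∀ j, c (x j) - X j ∈ maximalIdeal (MvPowerSeries V k) ^ 2) :
    Ideal.span (Set.range x) = maximalIdeal O := by
  have hxm : ∀ j, x j ∈ maximalIdeal O := by
    intro j
    rw [← hc.mem_iff']
    have := Ideal.add_mem _ (Ideal.pow_le_self two_ne_zero (hx j)) (X_mem_maximalIdeal j)
    rwa [sub_add_cancel] at this
  have hle : Ideal.span (Set.range x) ≤ maximalIdeal O := by
    rw [Ideal.span_le]; rintro _ ⟨j, rfl⟩; exact hxm j
  refine le_antisymm hle ?_
  refine Submodule.le_of_le_smul_of_le_jacobson_bot (I := maximalIdeal O) (IsNoetherian.noetherian _)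
    (IsLocalRing.maximalIdeal_le_jacobson _) ?_
  intro f hf
  refine Submodule.mem_sup.2 ⟨∑ j, algebraMap k O (linPart (c f) j) * x j,
    Ideal.sum_mem _ fun j _ => Ideal.mul_mem_left _ _ (Ideal.subset_span ⟨j, rfl⟩), _, ?_,
    add_sub_cancel _ f⟩
  rw [smul_eq_mul, ← pow_two, ← hc.mem_iff]
  have hcf : c f ∈ maximalIdeal (MvPowerSeries V k) ^ 1 := by rw [pow_one]; exact hc.mem_iff'.2 hf
  have hr : c (∑ j, algebraMap k O (linPart (c f) j) * x j) ∈ maximalIdeal (MvPowerSeries V k) ^ 1 := by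
    rw [pow_one, hc.mem_iff']
    exact Ideal.sum_mem _ fun j _ => Ideal.mul_mem_left _ _ (hxm j)
  rw [map_sub]
  refine (leadPoly_eq_zero_iff (Ideal.sub_mem _ hcf hr)).1 ?_
  rw [map_sub, map_sum, map_sum, leadPoly_one_eq, linPoly, sub_eq_zero]
  refine Finset.sum_congr rfl fun j _ => ?_
  rw [map_mul, AlgHom.commutes, ← Algebra.smul_def, map_smul, ← MvPolynomial.C_mul']
  congr 1
  have h1 : leadPoly 1 (c (x j) - X j) = 0 := leadPoly_of_mem (hx j)
  rw [map_sub, sub_eq_zero, leadPoly_X] at h1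
  exact h1.symm

/-- In a regular local ring the dimension is the least number of generators of the maximal ideal.
Lifts of the variables bound this number from above, and `IsCoord.card_le` bounds it from below. -/
theorem IsCoord.ringKrullDim_eq (hO : IsRegularLocalRing O) (hc : IsCoord c) :
    ringKrullDim O = (Fintype.card V : WithBot ℕ∞) := by
  rw [← IsRegularLocalRing.spanFinrank_maximalIdeal]
  norm_cast
  apply le_antisymm
  · choose x _ hx' using fun j => hc.exists_lift_X 1 j
    rw [← hc.span_eq_maximalIdeal hx']
    refine (Submodule.spanFinrank_span_le_ncard_of_finite (Set.finite_range x)).trans ?_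
    rw [← Set.image_univ, ← Nat.card_eq_fintype_card, ← Set.ncard_univ]
    exact Set.ncard_image_le
  · obtain ⟨s, hs, hs'⟩ := Submodule.FG.exists_span_finset_card_eq_spanFinrank
      (IsNoetherian.noetherian (maximalIdeal O))
    rw [← hs, ← Fintype.card_coe]
    refine hc.card_le (g := fun i : s => (i : O)) ?_
    rw [show Set.range (fun i : s => (i : O)) = (s : Set O) from Subtype.range_coe]
    exact hs'

theorem IsCoord.isRegularSystem_iff (hO : IsRegularLocalRing O) (hc : IsCoord c) (x : ι → O) :
    IsRegularSystem x ↔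
      Ideal.span (Set.range x) = maximalIdeal O ∧ Fintype.card ι = Fintype.card V := by
  rw [IsRegularSystem, hc.ringKrullDim_eq hO]
  norm_cast
  rw [eq_comm (a := Fintype.card V)]

end RegularSystem

/-! ### Principal parts: approximating formal differential operators -/

section DifferentialOperators

open TensorProduct MvPowerSeries

variable {k A B : Type*} [Field k] [CommRing A] [CommRing B] [Algebra k A] [Algebra k B]

/-- The map `a ⊗ f ↦ a δ(f)`. -/
noncomputable def tensorOp (φ : A →ₐ[k] B) (δ : A →ₗ[k] B) : A ⊗[k] A →ₗ[k] B :=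
  LinearMap.mul' k B ∘ₗ TensorProduct.map φ.toLinearMap δ

theorem tensorOp_tmul (φ : A →ₐ[k] B) (δ : A →ₗ[k] B) (a f : A) :
    tensorOp φ δ (a ⊗ₜ f) = φ a * δ f := by
  simp [tensorOp]

theorem tensorOp_left_mul (φ : A →ₐ[k] B) (δ : A →ₗ[k] B) (a : A) (t : A ⊗[k] A) :
    tensorOp φ δ (a • t) = φ a * tensorOp φ δ t := by
  induction t with
  | zero => simp
  | tmul b f => rw [smul_tmul', tensorOp_tmul, tensorOp_tmul, smul_eq_mul, map_mul, mul_assoc]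
  | add x y hx hy => rw [smul_add, map_add, map_add, hx, hy, mul_add]

/-- Multiplication by the generator `1 ⊗ r - r ⊗ 1` of the ideal of the diagonal corresponds to the
commutator with `r`. So an operator has order at most `n` when its linear extension kills the power
`n + 1` of this ideal. -/
theorem tensorOp_comm (φ : A →ₐ[k] B) (δ : A →ₗ[k] B) (r : A) (t : A ⊗[k] A) :
    tensorOp φ δ ((1 ⊗ₜ r - r ⊗ₜ 1) * t) =
      tensorOp φ (δ ∘ₗ LinearMap.mulLeft k r - LinearMap.mulLeft k (φ r) ∘ₗ δ) t := by
  induction t with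
  | zero => simp
  | tmul b f =>
    rw [sub_mul, Algebra.TensorProduct.tmul_mul_tmul, Algebra.TensorProduct.tmul_mul_tmul, map_sub,
      tensorOp_tmul, tensorOp_tmul, tensorOp_tmul]
    simp
    ring
  | add x y hx hy => rw [mul_add, map_add, map_add, hx, hy]

theorem IsDiffAlong.tensorOp_eq_zero {φ : A →ₐ[k] B} {n : ℕ} {δ : A →ₗ[k] B}
    (h : IsDiffAlong k φ n δ) {t : A ⊗[k] A} (ht : t ∈ KaehlerDifferential.ideal k A ^ (n + 1)) :
    tensorOp φ δ t = 0 := by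
  have key : ∀ (m : ℕ) (δ : A →ₗ[k] B), (∀ r, ∀ t ∈ KaehlerDifferential.ideal k A ^ m,
      tensorOp φ (δ ∘ₗ LinearMap.mulLeft k r - LinearMap.mulLeft k (φ r) ∘ₗ δ) t = 0) →
      ∀ t ∈ KaehlerDifferential.ideal k A ^ (m + 1), tensorOp φ δ t = 0 := by
    intro m δ hr t ht
    rw [pow_succ'] at ht
    refine Submodule.mul_induction_on ht (fun i hi j hj => ?_) fun x y hx hy => ?_
    · rw [← KaehlerDifferential.span_range_eq_ideal] at hi
      refine Submodule.span_induction (p := fun i _ => ∀ j ∈ KaehlerDifferential.ideal k A ^ m,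
        tensorOp φ δ (i * j) = 0) ?_ ?_ ?_ ?_ hi j hj
      · rintro _ ⟨r, rfl⟩ j hj
        rw [tensorOp_comm]
        exact hr r j hj
      · simp
      · intro x y _ _ hx hy j hj
        rw [add_mul, map_add, hx j hj, hy j hj, add_zero]
      · intro a x _ hx j hj
        rw [smul_eq_mul, mul_comm a, mul_assoc]
        exact hx _ (Ideal.mul_mem_left _ a hj)
    · rw [map_add, hx, hy, add_zero]
  induction n generalizing δ t with
  | zero =>
    refine key 0 δ (fun r t _ => ?_) t ht
    rw [h.comm_eq_zero]; simp [tensorOp]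
  | succ n ih => exact key (n + 1) δ (fun r t ht => ih (h r) ht) t ht

/-- The converse direction, by which operators are constructed: linear forms on the module of
principal parts are differential operators. -/
theorem isDiffOp_of_linearMap (n : ℕ) (L : A ⊗[k] A →ₗ[A] A)
    (hL : ∀ t ∈ KaehlerDifferential.ideal k A ^ (n + 1), L t = 0) :
    IsDiffOp k n (L.restrictScalars k ∘ₗ (Algebra.TensorProduct.includeRight : A →ₐ[k] A ⊗[k] A).toLinearMap) := by
  have hgen : ∀ r : A, (1 ⊗ₜ r - r ⊗ₜ 1 : A ⊗[k] A) ∈ KaehlerDifferential.ideal k A := by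
    intro r
    rw [← KaehlerDifferential.span_range_eq_ideal]
    exact Ideal.subset_span ⟨r, rfl⟩
  have key : ∀ (L : A ⊗[k] A →ₗ[A] A) (r : A), (L.restrictScalars k ∘ₗ
      (Algebra.TensorProduct.includeRight : A →ₐ[k] A ⊗[k] A).toLinearMap) ∘ₗ LinearMap.mulLeft k r -
      LinearMap.mulLeft k r ∘ₗ (L.restrictScalars k ∘ₗ
        (Algebra.TensorProduct.includeRight : A →ₐ[k] A ⊗[k] A).toLinearMap) =
      (L ∘ₗ LinearMap.mulLeft A (1 ⊗ₜ r - r ⊗ₜ 1 : A ⊗[k] A)).restrictScalars k ∘ₗ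
        (Algebra.TensorProduct.includeRight : A →ₐ[k] A ⊗[k] A).toLinearMap := by
    intro L r
    ext f
    simp only [LinearMap.sub_apply, LinearMap.comp_apply, LinearMap.mulLeft_apply,
      LinearMap.restrictScalars_apply, AlgHom.toLinearMap_apply,
      Algebra.TensorProduct.includeRight_apply, sub_mul, Algebra.TensorProduct.tmul_mul_tmul, one_mul,
      mul_one, map_sub]
    congr 1
    rw [← smul_eq_mul, ← map_smul, smul_tmul', smul_eq_mul, mul_one]
  induction n generalizing L with
  | zero =>
    intro r
    rw [← sub_eq_zero, key]
    ext f
    refine hL _ ?_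
    rw [zero_add, pow_one]
    exact Ideal.mul_mem_right _ _ (hgen r)
  | succ n ih =>
    intro r
    rw [key]
    refine ih _ fun t ht => hL _ ?_
    rw [pow_succ']
    exact Ideal.mul_mem_mul (hgen r) ht

/-- The modules of principal parts of a ring essentially of finite type are finite: the ideal of the
diagonal is finitely generated, hence so is each of its powers, and modulo the next power the ring
acts through `A`. -/
theorem exists_fg_sup_ideal_pow [Algebra.EssFiniteType k A] (n : ℕ) :
    ∃ M : Submodule A (A ⊗[k] A), M.FG ∧
      ∀ t, ∃ x ∈ M, t - x ∈ KaehlerDifferential.ideal k A ^ n := by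
  have h0 : ∀ t : A ⊗[k] A, ∃ a : A, t - a • 1 ∈ KaehlerDifferential.ideal k A := by
    intro t
    refine ⟨Algebra.TensorProduct.lmul' k t, ?_⟩
    change Algebra.TensorProduct.lmul' k _ = 0
    rw [map_sub, sub_eq_zero, Algebra.TensorProduct.one_def, smul_tmul']
    simp
  induction n with
  | zero => exact ⟨⊥, Submodule.fg_bot, fun t => ⟨0, Submodule.zero_mem _, by simp⟩⟩
  | succ n ih =>
    obtain ⟨M, hM, hM'⟩ := ih
    obtain ⟨S, hS⟩ := Ideal.FG.pow (n := n) (KaehlerDifferential.ideal_fg k A)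
    refine ⟨M ⊔ Submodule.span A (S : Set (A ⊗[k] A)), hM.sup ⟨S, rfl⟩, fun t => ?_⟩
    obtain ⟨x, hx, hx'⟩ := hM' t
    have h1 : ∀ y ∈ KaehlerDifferential.ideal k A ^ n, ∃ z ∈ Submodule.span A (S : Set (A ⊗[k] A)),
        y - z ∈ KaehlerDifferential.ideal k A ^ (n + 1) := by
      intro y hy
      rw [← hS] at hy
      refine Submodule.span_induction (p := fun y _ => ∃ z ∈ Submodule.span A (S : Set (A ⊗[k] A)),
        y - z ∈ KaehlerDifferential.ideal k A ^ (n + 1)) ?_ ?_ ?_ ?_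
        hy
      · intro s hs
        exact ⟨s, Submodule.subset_span hs, by simp⟩
      · exact ⟨0, Submodule.zero_mem _, by simp⟩
      · rintro a b _ _ ⟨z, hz, h⟩ ⟨z', hz', h'⟩
        refine ⟨z + z', Submodule.add_mem _ hz hz', ?_⟩
        rw [add_sub_add_comm]; exact Ideal.add_mem _ h h'
      · rintro b a ha ⟨z, hz, h⟩
        obtain ⟨α, hα⟩ := h0 b
        refine ⟨α • z, Submodule.smul_mem _ _ hz, ?_⟩
        have h2 : b • a - α • z = (b - α • 1) * a + α • (a - z) := by
          rw [smul_eq_mul, sub_mul, smul_mul_assoc, one_mul, smul_sub]; abel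
        rw [h2]
        refine Ideal.add_mem _ ?_ ?_
        · rw [pow_succ']
          refine Ideal.mul_mem_mul hα ?_
          rw [← hS]; exact ha
        · rw [← algebraMap_smul (A ⊗[k] A) α, smul_eq_mul]
          exact Ideal.mul_mem_left _ _ h
    obtain ⟨z, hz, hz'⟩ := h1 _ hx'
    refine ⟨x + z, Submodule.add_mem_sup hx hz, ?_⟩
    rw [← sub_sub]; exact hz'

variable {V O : Type*} [Fintype V] [CommRing O] [IsLocalRing O] [Algebra k O]
  {c : O →ₐ[k] MvPowerSeries V k}

/-- Differential operators on the completion are approximated by differential operators on an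
essentially finitely generated local ring. -/
theorem IsCoord.exists_isDiffOp [Algebra.EssFiniteType k O] [IsNoetherianRing O] (hc : IsCoord c)
    {n : ℕ} {D : O →ₗ[k] MvPowerSeries V k} (hD : IsDiffAlong k c n D) (N : ℕ) :
    ∃ δ : O →ₗ[k] O, IsDiffOp k n δ ∧
      ∀ f, c (δ f) - D f ∈ maximalIdeal (MvPowerSeries V k) ^ N := by
  classical
  obtain ⟨M, ⟨S, rfl⟩, hM'⟩ := exists_fg_sup_ideal_pow (k := k) (A := O) (n + 1)
  let J := KaehlerDifferential.ideal k O ^ (n + 1)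
  -- A finite presentation of the module of principal parts of order `n`: the generators are indexed
  -- by `S`, and the relations are generated by the finite set `T` below.
  let π₀ : (S → O) →ₗ[O] O ⊗[k] O := Fintype.linearCombination O (fun i : S => (i : O ⊗[k] O))
  let q : (O ⊗[k] O) →ₗ[O] ((O ⊗[k] O) ⧸ J) := (Ideal.Quotient.mkₐ O J).toLinearMap
  let π := q ∘ₗ π₀
  have hq : ∀ t, q t = 0 ↔ t ∈ J := fun t => Ideal.Quotient.eq_zero_iff_mem
  have hπ₀ : ∀ x : S → O, π₀ x = ∑ i, x i • (i : O ⊗[k] O) := fun x => rfl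
  have hlift : ∀ t, ∃ x : S → O, t - π₀ x ∈ J := by
    intro t
    obtain ⟨z, hz, hz'⟩ := hM' t
    have h1 : Set.range (fun i : S => (i : O ⊗[k] O)) = (S : Set (O ⊗[k] O)) := Subtype.range_coe
    rw [← h1, Submodule.mem_span_range_iff_exists_fun] at hz
    obtain ⟨x, hx⟩ := hz
    exact ⟨x, by rw [hπ₀, hx]; exact hz'⟩
  have hπ : Function.Surjective π := by
    intro w
    obtain ⟨t, rfl⟩ := Ideal.Quotient.mk_surjective w
    obtain ⟨x, hx⟩ := hlift t
    refine ⟨x, ?_⟩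
    have := (hq _).2 hx
    rw [map_sub, sub_eq_zero] at this
    exact this.symm
  obtain ⟨T, hT⟩ := IsNoetherian.noetherian (LinearMap.ker π)
  have hT0 : ∀ r ∈ T, π₀ r ∈ J := by
    intro r hr
    rw [← hq]
    have : r ∈ LinearMap.ker π := by rw [← hT]; exact Submodule.subset_span hr
    exact this
  -- `Θ v = 0` says that the values `v` on the generators respect the relations, that is, that they
  -- define a linear form on principal parts.
  let Θ : (S → O) →ₗ[O] (T → O) := LinearMap.pi fun r => Fintype.linearCombination O (fun i : S => (r : S → O) i)
  have hΘ : ∀ x r, Θ x r = ∑ i, x i * (r : S → O) i := fun x r => rfl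
  -- Artin–Rees: values that solve the relations modulo the power `N + a` differ from an exact
  -- solution by an element of the power `N`. Such values come from approximating those of `D`,
  -- which solve the relations in the completion.
  obtain ⟨a, ha⟩ := Ideal.exists_pow_inf_eq_pow_smul (maximalIdeal O) (LinearMap.range Θ)
  choose v' hv' using fun i : S => hc.approx (N + a) (tensorOp c D (i : O ⊗[k] O))
  have hΘv : Θ v' ∈ (maximalIdeal O ^ (N + a) • ⊤ : Submodule O (T → O)) ⊓ LinearMap.range Θ := by
    refine ⟨?_, ⟨v', rfl⟩⟩
    have h1 : ∀ r, Θ v' r ∈ maximalIdeal O ^ (N + a) := by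
      intro r
      rw [← hc.mem_iff, hΘ, map_sum]
      have h2 : tensorOp c D (π₀ r) = 0 := hD.tensorOp_eq_zero (hT0 r r.2)
      rw [hπ₀, map_sum] at h2
      simp_rw [tensorOp_left_mul] at h2
      rw [← neg_mem_iff, ← zero_sub, ← h2, ← Finset.sum_sub_distrib]
      refine Ideal.sum_mem _ fun i _ => ?_
      rw [map_mul, mul_comm (c (v' i)), ← mul_sub]
      exact Ideal.mul_mem_left _ _ (hv' i)
    have h3 : Θ v' = ∑ r, Θ v' r • Pi.single r (1 : O) := by
      ext r
      simp [Finset.sum_apply, Pi.single_apply]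
    rw [h3]
    exact Submodule.sum_mem _ fun r _ => Submodule.smul_mem_smul (h1 r) trivial
  rw [ha _ (by omega), Nat.add_sub_cancel] at hΘv
  have h4 := Submodule.smul_mono (le_refl (maximalIdeal O ^ N))
    (inf_le_right : (maximalIdeal O ^ a • ⊤ ⊓ LinearMap.range Θ) ≤ LinearMap.range Θ) hΘv
  rw [LinearMap.range_eq_map, ← Submodule.map_smul''] at h4
  obtain ⟨w, hw, hw'⟩ := h4
  have hwi : ∀ i, w i ∈ maximalIdeal O ^ N := by
    intro i
    refine Submodule.smul_induction_on hw (fun r hr x _ => ?_) fun x y hx hy => ?_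
    · exact Ideal.mul_mem_right _ _ hr
    · exact Ideal.add_mem _ hx hy
  let v := v' - w
  have hΘ0 : Θ v = 0 := by rw [map_sub, hw', sub_self]
  have hv : ∀ i : S, c (v i) - tensorOp c D (i : O ⊗[k] O) ∈ maximalIdeal (MvPowerSeries V k) ^ N := by
    intro i
    have h1 := Ideal.pow_le_pow_right (show N ≤ N + a by omega) (hv' i)
    have h2 := hc.mem_iff.2 (hwi i)
    have h3 : c (v i) - tensorOp c D (i : O ⊗[k] O) =
        -(tensorOp c D (i : O ⊗[k] O) - c (v' i)) - c (w i) := by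
      change c (v' i - w i) - _ = _
      rw [map_sub]; ring
    rw [h3]
    exact Ideal.sub_mem _ (neg_mem h1) h2
  let ρ : (S → O) →ₗ[O] O := Fintype.linearCombination O v
  have hρ : ∀ x, ρ x = ∑ i, x i * v i := fun x => rfl
  have hker : LinearMap.ker π ≤ LinearMap.ker ρ := by
    rw [← hT, Submodule.span_le]
    intro r hr
    change ρ r = 0
    have := congrFun hΘ0 ⟨r, hr⟩
    rw [hΘ] at this
    rw [hρ]
    simpa [mul_comm] using this
  let Λ : (O ⊗[k] O) →ₗ[O] O := ((LinearMap.ker π).liftQ ρ hker) ∘ₗ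
    (LinearMap.quotKerEquivOfSurjective π hπ).symm.toLinearMap ∘ₗ q
  have hΛ : ∀ t x, t - π₀ x ∈ J → Λ t = ρ x := by
    intro t x h
    have h1 : q t = π x := by
      have := (hq _).2 h
      rwa [map_sub, sub_eq_zero] at this
    have h2 : (LinearMap.quotKerEquivOfSurjective π hπ).symm (π x) = (LinearMap.ker π).mkQ x := by
      rw [LinearEquiv.symm_apply_eq]; rfl
    change ((LinearMap.ker π).liftQ ρ hker) ((LinearMap.quotKerEquivOfSurjective π hπ).symm (q t)) = _
    rw [h1, h2]
    rfl
  refine ⟨_, isDiffOp_of_linearMap n Λ fun t ht => ?_, fun f => ?_⟩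
  · rw [hΛ t 0 (by rw [map_zero, sub_zero]; exact ht), map_zero]
  · obtain ⟨x, hx⟩ := hlift (1 ⊗ₜ f)
    change c (Λ (1 ⊗ₜ f)) - _ ∈ _
    have h1 : tensorOp c D (1 ⊗ₜ f - π₀ x) = 0 := hD.tensorOp_eq_zero hx
    rw [map_sub, sub_eq_zero, tensorOp_tmul, map_one, one_mul, hπ₀, map_sum] at h1
    rw [hΛ _ x hx, hρ, h1, map_sum, ← Finset.sum_sub_distrib]
    refine Ideal.sum_mem _ fun i _ => ?_
    rw [tensorOp_left_mul, map_mul, ← mul_sub]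
    exact Ideal.mul_mem_left _ _ (hv i)

theorem IsCoord.exists_isDiffOp_hasse [Algebra.EssFiniteType k O] [IsNoetherianRing O]
    (hc : IsCoord c) (K : V →₀ ℕ) (N : ℕ) :
    ∃ δ : O →ₗ[k] O, IsDiffOp k K.degree δ ∧
      ∀ f, c (δ f) - hasse K (c f) ∈ maximalIdeal (MvPowerSeries V k) ^ N := by
  have h := (isDiffAlong_hasse (k := k) K).comp (IsDiffAlong.algHom c)
  exact hc.exists_isDiffOp h N

end DifferentialOperators

/-! ### Differential operators are combinations of Hasse derivatives -/

section Structure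

open MvPowerSeries

variable {k V O : Type*} [Field k] [Fintype V] [CommRing O] [IsLocalRing O] [Algebra k O]
  {c : O →ₐ[k] MvPowerSeries V k}

theorem IsDiffAlong.apply_mem_pow {n : ℕ} {δ : O →ₗ[k] MvPowerSeries V k} (hc : IsCoord c)
    (h : IsDiffAlong k c n δ) {a : ℕ} {f : O} (hf : f ∈ maximalIdeal O ^ (a + n)) :
    δ f ∈ maximalIdeal (MvPowerSeries V k) ^ a := by
  have h1 := h.mem_pow (maximalIdeal O) (a + n) hf
  rw [Nat.add_sub_cancel] at h1
  refine Ideal.pow_right_mono ?_ a h1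
  have := hc.map_le 1
  rwa [pow_one, pow_one] at this

/-- The commutator with `g i` has order one less and still kills the monomials of one degree less.
By induction it kills all polynomials, and then multiplication by `g i` cannot create a nonzero
value of `δ`. -/
theorem IsDiffAlong.aeval_eq_zero {n : ℕ} {δ : O →ₗ[k] MvPowerSeries V k}
    (h : IsDiffAlong k c n δ) (g : V → O)
    (h0 : ∀ α : V →₀ ℕ, α.degree ≤ n → δ (MvPolynomial.aeval g (MvPolynomial.monomial α (1 : k))) = 0)
    (p : MvPolynomial V k) : δ (MvPolynomial.aeval g p) = 0 := by
  induction n generalizing δ p with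
  | zero =>
    induction p using MvPolynomial.induction_on with
    | C a =>
      have h1 := h0 0 (by simp)
      rw [MvPolynomial.monomial_zero', map_one, map_one] at h1
      rw [MvPolynomial.aeval_C, Algebra.algebraMap_eq_smul_one, map_smul, h1, smul_zero]
    | add p q hp hq => rw [map_add, map_add, hp, hq, add_zero]
    | mul_X p i hp =>
      have h1 := LinearMap.congr_fun (h (g i)) (MvPolynomial.aeval g p)
      simp only [LinearMap.comp_apply, LinearMap.mulLeft_apply, hp, mul_zero] at h1
      rw [map_mul, MvPolynomial.aeval_X, mul_comm]
      exact h1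
  | succ n ih =>
    have hcomm : ∀ (i : V) (p : MvPolynomial V k), (δ ∘ₗ LinearMap.mulLeft k (g i) -
        LinearMap.mulLeft k (c (g i)) ∘ₗ δ) (MvPolynomial.aeval g p) = 0 := by
      intro i p
      refine ih (h (g i)) (fun α hα => ?_) p
      simp only [LinearMap.sub_apply, LinearMap.comp_apply, LinearMap.mulLeft_apply]
      rw [h0 α (by omega), mul_zero, sub_zero]
      have h2 := h0 (Finsupp.single i 1 + α) (by rw [map_add, Finsupp.degree_single]; omega)
      have h3 : (MvPolynomial.monomial (Finsupp.single i 1 + α) (1 : k)) =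
          MvPolynomial.X i * MvPolynomial.monomial α 1 := by
        rw [MvPolynomial.X, MvPolynomial.monomial_mul, one_mul]
      rwa [h3, map_mul, MvPolynomial.aeval_X] at h2
    induction p using MvPolynomial.induction_on with
    | C a =>
      have h1 := h0 0 (by simp)
      rw [MvPolynomial.monomial_zero', map_one, map_one] at h1
      rw [MvPolynomial.aeval_C, Algebra.algebraMap_eq_smul_one, map_smul, h1, smul_zero]
    | add p q hp hq => rw [map_add, map_add, hp, hq, add_zero]
    | mul_X p i hp =>
      have h1 := hcomm i p
      simp only [LinearMap.sub_apply, LinearMap.comp_apply, LinearMap.mulLeft_apply, hp, mul_zero,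
        sub_zero] at h1
      rw [map_mul, MvPolynomial.aeval_X, mul_comm]
      exact h1

/-- Operators of finite order are continuous, so vanishing on polynomials in the parameters is
enough. -/
theorem IsDiffAlong.eq_zero_of_monomials (hc : IsCoord c) {n : ℕ} {δ : O →ₗ[k] MvPowerSeries V k}
    (h : IsDiffAlong k c n δ) {g : V → O} (hg : ∀ i, c (g i) = X i)
    (h0 : ∀ α : V →₀ ℕ, α.degree ≤ n → δ (MvPolynomial.aeval g (MvPolynomial.monomial α (1 : k))) = 0) :
    δ = 0 := by
  ext1 f
  refine eq_zero_of_forall_mem_maximalIdeal_pow _ fun N => ?_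
  have hp : f - MvPolynomial.aeval g (truncTotal (N + n) (c f)) ∈ maximalIdeal O ^ (N + n) := by
    rw [← hc.mem_iff, map_sub, mem_maximalIdeal_pow_iff]
    intro α hα
    have h1 : c (MvPolynomial.aeval g (truncTotal (N + n) (c f))) =
        ((truncTotal (N + n) (c f) : MvPolynomial V k) : MvPowerSeries V k) := by
      have h2 : (c.comp (MvPolynomial.aeval g)) = MvPolynomial.coeToMvPowerSeries.algHom k := by
        refine MvPolynomial.algHom_ext fun i => ?_
        simp [hg, MvPolynomial.coeToMvPowerSeries.algHom_apply]
      have h3 := AlgHom.congr_fun h2 (truncTotal (N + n) (c f))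
      simpa [MvPolynomial.coeToMvPowerSeries.algHom_apply] using h3
    rw [h1, map_sub, MvPolynomial.coeff_coe, coeff_truncTotal _ hα, sub_self]
  have h1 := h.apply_mem_pow hc hp
  rwa [map_sub, h.aeval_eq_zero g h0, sub_zero] at h1

theorem hasse_monomial_of_degree_le (K L : V →₀ ℕ) [Decidable (K = L)] (h : L.degree ≤ K.degree) :
    hasse K (monomial L (1 : k)) = if K = L then 1 else 0 := by
  classical
  ext m
  rw [coeff_hasse, coeff_monomial]
  by_cases h1 : m + K = L
  · have h2 : m = 0 := by
      rw [← Finsupp.degree_eq_zero_iff]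
      have := congrArg Finsupp.degree h1
      rw [map_add] at this
      omega
    subst h2
    rw [zero_add] at h1
    subst h1
    simp [multiChoose]
  · rw [if_neg h1, mul_zero]
    split_ifs with h2
    · subst h2
      rw [coeff_one, if_neg]
      rintro rfl
      exact h1 (zero_add K)
    · rw [map_zero]

/-- Differential operators are combinations of the Hasse derivatives. -/
theorem IsDiffAlong.mem_span_hasse (hc : IsCoord c) {n : ℕ} {δ : O →ₗ[k] MvPowerSeries V k}
    (h : IsDiffAlong k c n δ) {g : V → O} (hg : ∀ i, c (g i) = X i) :
    δ ∈ Submodule.span (MvPowerSeries V k)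
      {D : O →ₗ[k] MvPowerSeries V k | ∃ K : V →₀ ℕ, K.degree ≤ n ∧ D = hasse K ∘ₗ c.toLinearMap} := by
  classical
  set W := Submodule.span (MvPowerSeries V k)
      {D : O →ₗ[k] MvPowerSeries V k | ∃ K : V →₀ ℕ, K.degree ≤ n ∧ D = hasse K ∘ₗ c.toLinearMap}
    with hW
  have hmon : ∀ α : V →₀ ℕ, c (MvPolynomial.aeval g (MvPolynomial.monomial α (1 : k))) =
      monomial α (1 : k) := by
    intro α
    rw [MvPolynomial.aeval_monomial, map_one, one_mul, ← MvPolynomial.coe_monomial,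
      Finsupp.prod, map_prod, ← MvPolynomial.prod_X_pow_eq_monomial]
    simp only [map_pow, hg]
    rw [← MvPolynomial.coeToMvPowerSeries.ringHom_apply, map_prod]
    simp
  -- The values on monomials are corrected degree by degree. This works because `D_K (X^L)` is `1`
  -- for `K = L` and `0` for all other `L` of degree at most `|K|`.
  have key : ∀ l ≤ n + 1, ∃ δ' ∈ W, ∀ α : V →₀ ℕ, α.degree < l →
      (δ - δ') (MvPolynomial.aeval g (MvPolynomial.monomial α (1 : k))) = 0 := by
    intro l
    induction l with
    | zero => intro _; exact ⟨0, Submodule.zero_mem _, fun α hα => by omega⟩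
    | succ l ih =>
      intro hl
      obtain ⟨δ', hδ', h0⟩ := ih (by omega)
      let s := (Finsupp.finite_of_degree_eq (σ := V) l).toFinset
      have hs : ∀ K, K ∈ s ↔ K.degree = l := fun K => by simp [s]
      refine ⟨δ' + ∑ K ∈ s, ((δ - δ') (MvPolynomial.aeval g (MvPolynomial.monomial K (1 : k)))) •
        (hasse K ∘ₗ c.toLinearMap), ?_, ?_⟩
      · refine Submodule.add_mem _ hδ' (Submodule.sum_mem _ fun K hK => Submodule.smul_mem _ _ ?_)
        exact Submodule.subset_span ⟨K, by have := (hs K).1 hK; omega, rfl⟩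
      · intro α hα
        rw [← sub_sub, LinearMap.sub_apply, LinearMap.sum_apply]
        simp only [LinearMap.smul_apply, LinearMap.comp_apply, AlgHom.toLinearMap_apply, hmon]
        rcases Nat.lt_succ_iff_lt_or_eq.1 hα with h1 | h1
        · rw [h0 α h1, zero_sub, neg_eq_zero]
          refine Finset.sum_eq_zero fun K hK => ?_
          have h2 := (hs K).1 hK
          rw [hasse_monomial_of_degree_le K α (by omega), if_neg, smul_zero]
          rintro rfl; omega
        · rw [Finset.sum_eq_single α]
          · rw [hasse_monomial_of_degree_le α α le_rfl, if_pos rfl, smul_eq_mul, mul_one, sub_self]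
          · intro K hK hne
            have h2 := (hs K).1 hK
            rw [hasse_monomial_of_degree_le K α (by omega), if_neg hne, smul_zero]
          · intro h2; exact absurd ((hs α).2 h1) h2
  obtain ⟨δ', hδ', h0⟩ := key (n + 1) le_rfl
  have hdiff : IsDiffAlong k c n δ' := by
    refine Submodule.span_induction (p := fun D _ => IsDiffAlong k c n D) ?_ ?_ ?_ ?_ hδ'
    · rintro _ ⟨K, hK, rfl⟩
      exact ((isDiffAlong_hasse (k := k) K).comp (IsDiffAlong.algHom c)).mono (by omega)
    · exact IsDiffAlong.zero n
    · intro x y _ _ hx hy; exact hx.add hy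
    · intro a x _ hx
      exact hx.mulLeft a
  have h1 := (h.sub hdiff).eq_zero_of_monomials hc hg fun α hα => h0 α (by omega)
  rw [sub_eq_zero] at h1
  rw [h1]; exact hδ'

theorem IsDiffAlong.apply_mem_of_hasse (hc : IsCoord c) {n : ℕ} {δ : O →ₗ[k] MvPowerSeries V k}
    (h : IsDiffAlong k c n δ) {g : V → O} (hg : ∀ i, c (g i) = X i) {f : O}
    {I : Ideal (MvPowerSeries V k)} (hf : ∀ K : V →₀ ℕ, K.degree ≤ n → hasse K (c f) ∈ I) :
    δ f ∈ I := by
  refine Submodule.span_induction (p := fun D _ => D f ∈ I) ?_ ?_ ?_ ?_ (h.mem_span_hasse hc hg)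
  · rintro _ ⟨K, hK, rfl⟩; exact hf K hK
  · exact I.zero_mem
  · intro x y _ _ hx hy; exact I.add_mem hx hy
  · intro a x _ hx; exact I.mul_mem_left a hx

end Structure

/-! ### Generation, saturation and transformation of filtrations -/

section Filtrations

variable {A B : Type*} [CommRing A] [CommRing B]

namespace IdealisticFiltration

theorem subset_generate {G : Set (A × ℕ)} {f : A} {a : ℕ} (h : (f, a) ∈ G) :
    f ∈ (generate G).ideal a := Generated.of h

theorem generate_le {G : Set (A × ℕ)} {R : IdealisticFiltration A}
    (h : ∀ f a, (f, a) ∈ G → f ∈ R.ideal a) (a : ℕ) : (generate G).ideal a ≤ R.ideal a := by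
  intro f hf
  have hf' : Generated A G f a := hf
  induction hf' with
  | of h' => exact h _ _ h'
  | one => rw [R.ideal_zero]; trivial
  | zero γ => exact Ideal.zero_mem _
  | add h1 h2 ih1 ih2 => exact Ideal.add_mem _ (ih1 h1) (ih2 h2)
  | smul r h1 ih => exact Ideal.mul_mem_left _ r (ih h1)
  | mul h1 h2 ih1 ih2 => exact R.mul_le _ _ (Ideal.mul_mem_mul (ih1 h1) (ih2 h2))
  | lower hle h1 ih => exact R.anti hle (ih h1)

theorem ext_of_le {R R' : IdealisticFiltration A} (h : ∀ a, R.ideal a ≤ R'.ideal a)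
    (h' : ∀ a, R'.ideal a ≤ R.ideal a) : R = R' := by
  ext1
  funext a
  exact le_antisymm (h a) (h' a)

/-- The filtration by the ideals `I_a + I`. -/
def supIdeal (R : IdealisticFiltration A) (I : Ideal A) : IdealisticFiltration A where
  ideal a := R.ideal a ⊔ I
  ideal_zero := by rw [R.ideal_zero, top_sup_eq]
  anti := fun _ _ h => sup_le_sup_right (R.anti h) I
  mul_le := fun a b => by
    refine Ideal.mul_le.2 fun r hr s hs => ?_
    obtain ⟨r₁, hr₁, r₂, hr₂, rfl⟩ := Submodule.mem_sup.1 hr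
    obtain ⟨s₁, hs₁, s₂, hs₂, rfl⟩ := Submodule.mem_sup.1 hs
    refine Submodule.mem_sup.2 ⟨r₁ * s₁, R.mul_le a b (Ideal.mul_mem_mul hr₁ hs₁),
      r₁ * s₂ + r₂ * (s₁ + s₂), ?_, by ring⟩
    exact I.add_mem (I.mul_mem_left _ hs₂) (I.mul_mem_right _ hr₂)

/-- The filtration is generated by finitely many pairs. -/
def IsFinGen (R : IdealisticFiltration A) : Prop :=
  ∃ G : Set (A × ℕ), G.Finite ∧ R = generate G

theorem IsIFG.isFinGen {R : IdealisticFiltration A} (h : R.IsIFG) : R.IsFinGen := by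
  obtain ⟨S, hS⟩ := h
  refine ⟨⋃ p ∈ S, (fun a => (p.coeff a, a)) '' p.support, ?_, ?_⟩
  · exact Set.Finite.biUnion S.finite_toSet fun p _ => p.support.finite_toSet.image _
  set G : Set (A × ℕ) := ⋃ p ∈ S, (fun a => (p.coeff a, a)) '' p.support with hG
  have hSR : ∀ p ∈ S, p ∈ R.gradedAlgebra := by
    intro p hp
    rw [← hS]; exact Algebra.subset_adjoin hp
  refine ext_of_le (fun a f hf => ?_) (generate_le ?_)
  · have h1 : R.gradedAlgebra ≤ (generate G).gradedAlgebra := by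
      rw [← hS]
      refine Algebra.adjoin_le fun p hp a => ?_
      by_cases hpa : a ∈ p.support
      · refine subset_generate ?_
        rw [hG]
        exact Set.mem_biUnion hp ⟨a, hpa, rfl⟩
      · rw [Polynomial.notMem_support_iff.1 hpa]; exact Ideal.zero_mem _
    have h2 : Polynomial.monomial a f ∈ R.gradedAlgebra := by
      intro b
      rw [Polynomial.coeff_monomial]
      split_ifs with h
      · rw [← h]; exact hf
      · exact Ideal.zero_mem _
    have := h1 h2 a
    rwa [Polynomial.coeff_monomial, if_pos rfl] at this
  · intro f a hfa
    rw [hG, Set.mem_iUnion₂] at hfa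
    obtain ⟨p, hp, b, _, hb⟩ := hfa
    obtain ⟨rfl, rfl⟩ := Prod.mk.inj hb
    exact hSR p hp b

theorem le_diffSat (k : Type*) [CommRing k] [Algebra k A] (R : IdealisticFiltration A) (a : ℕ) :
    R.ideal a ≤ (R.diffSat k).ideal a := fun f hf =>
  subset_generate ⟨f, a, 0, LinearMap.id, hf, IsDiffOp.id, rfl⟩

theorem diffSat_mono (k : Type*) [CommRing k] [Algebra k A] {R R' : IdealisticFiltration A}
    (h : ∀ a, R.ideal a ≤ R'.ideal a) (a : ℕ) : (R.diffSat k).ideal a ≤ (R'.diffSat k).ideal a :=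
  generate_le (fun _ _ hf => by
    obtain ⟨g, b, n, δ, hg, hδ, hp⟩ := hf
    exact subset_generate ⟨g, b, n, δ, h b hg, hδ, hp⟩) a

theorem diffSat_closedPointInSing (k : Type*) [CommRing k] [Algebra k A] [IsLocalRing A]
    {R : IdealisticFiltration A} (h : R.ClosedPointInSing) : (R.diffSat k).ClosedPointInSing := by
  intro a f hf
  have hf' : Generated A _ f a := hf
  induction hf' with
  | of h' =>
    obtain ⟨g, b, n, δ, hg, hδ, hp⟩ := h'
    obtain ⟨rfl, rfl⟩ := Prod.mk.inj hp
    exact hδ.mem_pow _ _ (h b hg)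
  | one => simp
  | zero γ => exact Ideal.zero_mem _
  | add h1 h2 ih1 ih2 => exact Ideal.add_mem _ (ih1 h1) (ih2 h2)
  | smul r h1 ih => exact Ideal.mul_mem_left _ r (ih h1)
  | mul h1 h2 ih1 ih2 => rw [pow_add]; exact Ideal.mul_mem_mul (ih1 h1) (ih2 h2)
  | lower hle h1 ih => exact Ideal.pow_le_pow_right hle (ih h1)

theorem transform_mono (φ : A →+* B) (y : B) {R R' : IdealisticFiltration A}
    (h : ∀ a, R.ideal a ≤ R'.ideal a) (a : ℕ) :
    (R.transform φ y).ideal a ≤ (R'.transform φ y).ideal a :=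
  generate_le (fun _ b hf => subset_generate (Ideal.map_mono (h b) hf)) a

theorem mem_transform (φ : A →+* B) (y : B) {R : IdealisticFiltration A} {a : ℕ} {f : B} {g : A}
    (hg : g ∈ R.ideal a) (h : y ^ a * f = φ g) : f ∈ (R.transform φ y).ideal a :=
  subset_generate (show y ^ a * f ∈ (R.ideal a).map φ by rw [h]; exact Ideal.mem_map_of_mem φ hg)

theorem exists_transform_eq [IsDomain B] (φ : A →+* B) {y : B} {R : IdealisticFiltration A} {C : Ideal A}
    (hC : C.map φ = Ideal.span {y}) (hR : R.CenterInSing C) {a : ℕ} {g : A} (hg : g ∈ R.ideal a) :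
    ∃ f : B, y ^ a * f = φ g := by
  have h1 : φ g ∈ (C ^ a).map φ := Ideal.mem_map_of_mem φ (hR a hg)
  rw [Ideal.map_pow, hC, Ideal.span_singleton_pow, Ideal.mem_span_singleton] at h1
  obtain ⟨f, hf⟩ := h1
  exact ⟨f, hf.symm⟩

/-- Division by `y^a` at the level `a` is compatible with all the rules of generation, so the
transformations of the generators generate the transformation. -/
theorem IsFinGen.transform [IsDomain B] (φ : A →+* B) {y : B} (hy : y ≠ 0) {R : IdealisticFiltration A}
    {C : Ideal A} (hC : C.map φ = Ideal.span {y}) (hR : R.CenterInSing C) (h : R.IsFinGen) :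
    (R.transform φ y).IsFinGen := by
  obtain ⟨G, hG, hRG⟩ := h
  have hGR : ∀ p ∈ G, p.1 ∈ R.ideal p.2 := by
    intro p hp; rw [hRG]; exact subset_generate hp
  have hex : ∀ p : A × ℕ, ∃ f : B, p ∈ G → y ^ p.2 * f = φ p.1 := by
    intro p
    by_cases hp : p ∈ G
    · obtain ⟨f, hf⟩ := exists_transform_eq φ hC hR (hGR p hp)
      exact ⟨f, fun _ => hf⟩
    · exact ⟨0, fun h => absurd h hp⟩
  choose F hF using hex
  refine ⟨(fun p => (F p, p.2)) '' G, hG.image _, ?_⟩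
  set G' : Set (B × ℕ) := (fun p => (F p, p.2)) '' G
  have key : ∀ (f : A) (a : ℕ), Generated A G f a → ∃ g ∈ (generate G').ideal a, y ^ a * g = φ f := by
    intro f a hf
    induction hf with
    | @of b γ h' => exact ⟨F (b, γ), subset_generate ⟨(b, γ), h', rfl⟩, hF _ h'⟩
    | one => exact ⟨1, by rw [(generate G').ideal_zero]; trivial, by simp⟩
    | zero γ => exact ⟨0, Ideal.zero_mem _, by simp⟩
    | add h1 h2 ih1 ih2 =>
      obtain ⟨g, hg, e⟩ := ih1
      obtain ⟨g', hg', e'⟩ := ih2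
      exact ⟨g + g', Ideal.add_mem _ hg hg', by rw [mul_add, e, e', map_add]⟩
    | smul r h1 ih =>
      obtain ⟨g, hg, e⟩ := ih
      exact ⟨φ r * g, Ideal.mul_mem_left _ _ hg, by rw [mul_left_comm, e, smul_eq_mul, map_mul]⟩
    | mul h1 h2 ih1 ih2 =>
      obtain ⟨g, hg, e⟩ := ih1
      obtain ⟨g', hg', e'⟩ := ih2
      refine ⟨g * g', (generate G').mul_le _ _ (Ideal.mul_mem_mul hg hg'), ?_⟩
      rw [map_mul, ← e, ← e', pow_add]; ring
    | @lower b γ δ hle h1 ih =>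
      obtain ⟨g, hg, e⟩ := ih
      -- Seen at a lower level, an element is divided by fewer factors `y`; the remaining ones
      -- multiply the quotient.
      refine ⟨y ^ (γ - δ) * g, Ideal.mul_mem_left _ _ ((generate G').anti hle hg), ?_⟩
      rw [← mul_assoc, ← pow_add, Nat.add_sub_cancel' hle, e]
  refine ext_of_le (generate_le ?_) (generate_le ?_)
  · intro f a (hf : y ^ a * f ∈ (R.ideal a).map φ)
    have h1 : ∀ w ∈ (R.ideal a).map φ, ∃ g ∈ (generate G').ideal a, y ^ a * g = w := by
      intro w hw
      refine Submodule.span_induction (p := fun w _ => ∃ g ∈ (generate G').ideal a, y ^ a * g = w)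
        ?_ ?_ ?_ ?_ hw
      · rintro _ ⟨r, hr, rfl⟩
        rw [SetLike.mem_coe, hRG] at hr
        exact key r a hr
      · exact ⟨0, Ideal.zero_mem _, mul_zero _⟩
      · rintro _ _ _ _ ⟨g, hg, rfl⟩ ⟨g', hg', rfl⟩
        exact ⟨g + g', Ideal.add_mem _ hg hg', mul_add _ _ _⟩
      · rintro r _ _ ⟨g, hg, rfl⟩
        exact ⟨r * g, Ideal.mul_mem_left _ _ hg, by rw [smul_eq_mul, mul_left_comm]⟩
    obtain ⟨g, hg, e⟩ := h1 _ hf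
    rwa [mul_left_cancel₀ (pow_ne_zero a hy) e] at hg
  · rintro f a ⟨p, hp, hpe⟩
    obtain ⟨rfl, rfl⟩ := Prod.mk.inj hpe
    exact mem_transform φ y (hGR p hp) (hF p hp)

end IdealisticFiltration

end Filtrations

/-! ### Stability and finite generation of the differential saturation -/

section DiffSat

open MvPowerSeries IdealisticFiltration

variable {k V O : Type*} [Field k] [Fintype V] [CommRing O] [IsLocalRing O] [Algebra k O]
  {c : O →ₐ[k] MvPowerSeries V k}

/-- The Leibniz rule lets the condition `D_K f ∈ J_{a - |K|}` for all `K` pass from generators to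
everything they generate. The truncation of the level at `0` is harmless since `J_0` is the whole
ring. -/
theorem hasse_mem_of_generators {G : Set (O × ℕ)} {J : IdealisticFiltration (MvPowerSeries V k)}
    (hG : ∀ f a, (f, a) ∈ G → ∀ K : V →₀ ℕ, hasse K (c f) ∈ J.ideal (a - K.degree))
    {f : O} {a : ℕ} (hf : f ∈ (generate G).ideal a) (K : V →₀ ℕ) :
    hasse K (c f) ∈ J.ideal (a - K.degree) := by
  classical
  have hf' : Generated O G f a := hf
  clear hf
  induction hf' generalizing K with
  | of h' => exact hG _ _ h' K
  | one => rw [Nat.zero_sub, J.ideal_zero]; trivial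
  | zero γ => rw [map_zero, map_zero]; exact Ideal.zero_mem _
  | add h1 h2 ih1 ih2 => rw [map_add, map_add]; exact Ideal.add_mem _ (ih1 K) (ih2 K)
  | smul r h1 ih =>
    rw [smul_eq_mul, map_mul, hasse_mul]
    refine Ideal.sum_mem _ fun p hp => Ideal.mul_mem_left _ _ ?_
    have hd : p.1.degree + p.2.degree = K.degree := by
      rw [← map_add, Finset.HasAntidiagonal.mem_antidiagonal.1 hp]
    exact J.anti (by omega) (ih p.2)
  | mul h1 h2 ih1 ih2 =>
    rw [map_mul, hasse_mul]
    refine Ideal.sum_mem _ fun p hp => ?_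
    have hd : p.1.degree + p.2.degree = K.degree := by
      rw [← map_add, Finset.HasAntidiagonal.mem_antidiagonal.1 hp]
    exact J.anti (by omega) (J.mul_le _ _ (Ideal.mul_mem_mul (ih1 p.1) (ih2 p.2)))
  | lower hle h1 ih => exact J.anti (by omega) (ih K)

variable [Algebra.EssFiniteType k O] [IsNoetherianRing O]

/-- The differential saturation is stable under the Hasse derivatives, up to high order. -/
theorem IsCoord.exists_mem_diffSat_hasse (hc : IsCoord c) (R : IdealisticFiltration O) {f : O} {a : ℕ}
    (hf : f ∈ (R.diffSat k).ideal a) (K : V →₀ ℕ) (N : ℕ) :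
    ∃ g ∈ (R.diffSat k).ideal (a - K.degree),
      hasse K (c f) - c g ∈ maximalIdeal (MvPowerSeries V k) ^ N := by
  have h1 : hasse K (c f) ∈ (((R.diffSat k).map (c : O →+* MvPowerSeries V k)).supIdeal
      (maximalIdeal (MvPowerSeries V k) ^ N)).ideal (a - K.degree) := by
    refine hasse_mem_of_generators ?_ hf K
    rintro f' a' ⟨g, b, n, δ, hg, hδ, hp⟩ K
    obtain ⟨rfl, rfl⟩ := Prod.mk.inj hp
    obtain ⟨ε, hε, hε'⟩ := hc.exists_isDiffOp_hasse K N
    have h2 : hasse K (c (δ g)) = c (ε (δ g)) + -(c (ε (δ g)) - hasse K (c (δ g))) := by ring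
    rw [h2]
    refine Submodule.add_mem_sup (Ideal.mem_map_of_mem (c : O →+* MvPowerSeries V k) ?_)
      (neg_mem (hε' _))
    exact subset_generate ⟨g, b, K.degree + n, ε ∘ₗ δ, hg, hε.comp hδ,
      Prod.ext rfl (by change b - n - K.degree = b - (K.degree + n); omega)⟩
  obtain ⟨u, hu, w, hw, huw⟩ := Submodule.mem_sup.1 h1
  obtain ⟨g, hg, hg'⟩ := hc.exists_mem_sub_mem _ N hu
  refine ⟨g, hg, ?_⟩
  rw [← huw, add_sub_right_comm]
  exact Ideal.add_mem _ hg' hw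

/-- Only operators of order smaller than the level matter, and on each of the finitely many
generators their values form finitely generated ideals. The filtration generated by these values is
closed under all operators: modulo each power of the maximal ideal by the Leibniz rule for Hasse
derivatives, hence exactly by Krull's theorem. -/
theorem IsCoord.isFinGen_diffSat (hc : IsCoord c) {R : IdealisticFiltration O} (h : R.IsFinGen) :
    (R.diffSat k).IsFinGen := by
  obtain ⟨G, hG, rfl⟩ := h
  choose x _ hx using fun j => hc.exists_lift_X 1 j
  obtain ⟨c, hc, hcx⟩ := hc.exists_coord_eq_X (hc.span_eq_maximalIdeal hx) rfl
  -- The values at `f` of all the operators of order at most `n` form an ideal, since operators may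
  -- be multiplied by functions.
  let N : O → ℕ → Ideal O := fun f n =>
    { carrier := {g | ∃ δ : O →ₗ[k] O, IsDiffOp k n δ ∧ δ f = g}
      zero_mem' := ⟨0, isDiffOp_iff_isDiffAlong.2 (IsDiffAlong.zero n), rfl⟩
      add_mem' := by
        rintro _ _ ⟨δ, hδ, rfl⟩ ⟨δ', hδ', rfl⟩
        exact ⟨δ + δ', isDiffOp_iff_isDiffAlong.2 ((isDiffOp_iff_isDiffAlong.1 hδ).add
          (isDiffOp_iff_isDiffAlong.1 hδ')), rfl⟩
      smul_mem' := by
        rintro r _ ⟨δ, hδ, rfl⟩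
        exact ⟨LinearMap.mulLeft k r ∘ₗ δ, isDiffOp_iff_isDiffAlong.2
          ((isDiffOp_iff_isDiffAlong.1 hδ).mulLeft r), rfl⟩ }
  have hN : ∀ f n g, g ∈ N f n ↔ ∃ δ : O →ₗ[k] O, IsDiffOp k n δ ∧ δ f = g := fun f n g => Iff.rfl
  choose T hT using fun (f : O) (n : ℕ) => (IsNoetherian.noetherian (N f n))
  refine ⟨⋃ p ∈ G, ⋃ n ∈ Finset.range p.2, (fun g => (g, p.2 - n)) '' (T p.1 n : Set O), ?_, ?_⟩
  · exact hG.biUnion fun p _ => (Finset.range p.2).finite_toSet.biUnion fun n _ =>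
      (T p.1 n).finite_toSet.image _
  set G' : Set (O × ℕ) :=
    ⋃ p ∈ G, ⋃ n ∈ Finset.range p.2, (fun g => (g, p.2 - n)) '' (T p.1 n : Set O) with hG'
  have hNG : ∀ p ∈ G, ∀ n < p.2, N p.1 n ≤ (generate G').ideal (p.2 - n) := by
    intro p hp n hn
    rw [← hT p.1 n]
    refine Submodule.span_le.2 fun g hg => subset_generate ?_
    rw [hG']
    exact Set.mem_biUnion hp (Set.mem_biUnion (Finset.mem_range.2 hn) ⟨g, hg, rfl⟩)
  refine ext_of_le (generate_le ?_) (generate_le ?_)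
  · rintro f a ⟨g, b, n, δ, hg, hδ, hp⟩
    obtain ⟨rfl, rfl⟩ := Prod.mk.inj hp
    refine IsCoord.mem_of_forall_sup _ fun M => hc.mem_sup_of_map_sup _ M ?_
    have hδ' : IsDiffAlong k c n (c.toLinearMap ∘ₗ δ) := by
      have := (IsDiffAlong.algHom c).comp (isDiffOp_iff_isDiffAlong.1 hδ)
      rwa [zero_add] at this
    refine hδ'.apply_mem_of_hasse hc hcx fun K hK => ?_
    have h1 : hasse K (c g) ∈ (((generate G').map (c : O →+* MvPowerSeries V k)).supIdeal
        (maximalIdeal (MvPowerSeries V k) ^ M)).ideal (b - K.degree) := by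
      refine hasse_mem_of_generators ?_ hg K
      intro f a hfa K
      rcases lt_or_ge K.degree a with h2 | h2
      · obtain ⟨ε, hε, hε'⟩ := hc.exists_isDiffOp_hasse K M
        have h3 : hasse K (c f) = c (ε f) + -(c (ε f) - hasse K (c f)) := by ring
        rw [h3]
        refine Submodule.add_mem_sup (Ideal.mem_map_of_mem (c : O →+* MvPowerSeries V k) ?_)
          (neg_mem (hε' _))
        exact hNG (f, a) hfa _ h2 ⟨ε, hε, rfl⟩
      · rw [Nat.sub_eq_zero_of_le h2, IdealisticFiltration.ideal_zero]; trivial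
    exact (((generate G').map (c : O →+* MvPowerSeries V k)).supIdeal
        (maximalIdeal (MvPowerSeries V k) ^ M)).anti (by omega) h1
  · intro f a hfa
    rw [hG', Set.mem_iUnion₂] at hfa
    obtain ⟨p, hp, hfa⟩ := hfa
    rw [Set.mem_iUnion₂] at hfa
    obtain ⟨n, hn, g, hg, hpe⟩ := hfa
    obtain ⟨rfl, rfl⟩ := Prod.mk.inj hpe
    have h1 : g ∈ N p.1 n := by rw [← hT]; exact Submodule.subset_span hg
    obtain ⟨δ, hδ, rfl⟩ := (hN _ _ _).1 h1
    exact subset_generate ⟨p.1, p.2, n, δ, subset_generate hp, hδ, rfl⟩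

end DiffSat

/-! ### Algebras generated by `p`-power powers of linear forms; leading algebras in coordinates -/

section LeadingAlgebra

open MvPowerSeries

variable {k V τ τ' : Type*} [Field k] [Fintype V] [Fintype τ] [Fintype τ']

/-- The part of degree `a` of the algebra generated by the powers `v_i ^ (p ^ e_i)` of linear
forms. -/
noncomputable def powAlg (v : τ → V → k) (e : τ → ℕ) (a : ℕ) : Submodule k (MvPolynomial V k) :=
  Submodule.span k {w | ∃ α : τ → ℕ, ∑ i, α i * ringExpChar k ^ e i = a ∧
    w = ∏ i, (linPoly (v i) ^ ringExpChar k ^ e i) ^ α i}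

theorem one_mem_powAlg (v : τ → V → k) (e : τ → ℕ) : 1 ∈ powAlg v e 0 :=
  Submodule.subset_span ⟨0, by simp, by simp⟩

theorem mul_mem_powAlg {v : τ → V → k} {e : τ → ℕ} {a b : ℕ} {f g : MvPolynomial V k}
    (hf : f ∈ powAlg v e a) (hg : g ∈ powAlg v e b) : f * g ∈ powAlg v e (a + b) := by
  refine Submodule.span_induction₂ (p := fun x y _ _ => x * y ∈ powAlg v e (a + b))
    ?_ ?_ ?_ ?_ ?_ ?_ ?_ hf hg
  · rintro _ _ ⟨α, hα, rfl⟩ ⟨β, hβ, rfl⟩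
    refine Submodule.subset_span ⟨α + β, ?_, ?_⟩
    · simp [add_mul, Finset.sum_add_distrib, hα, hβ]
    · simp [pow_add, Finset.prod_mul_distrib]
  · intro y _; simp
  · intro y _; simp
  · intro x y z _ _ _ h1 h2; rw [add_mul]; exact Submodule.add_mem _ h1 h2
  · intro x y z _ _ _ h1 h2; rw [mul_add]; exact Submodule.add_mem _ h1 h2
  · intro r x y _ _ h; rw [smul_mul_assoc]; exact Submodule.smul_mem _ _ h
  · intro r x y _ _ h; rw [mul_smul_comm]; exact Submodule.smul_mem _ _ h

theorem powAlg_le {v : τ → V → k} {e : τ → ℕ} {L : ℕ → Submodule k (MvPolynomial V k)}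
    (h1 : 1 ∈ L 0) (hmul : ∀ a b f g, f ∈ L a → g ∈ L b → f * g ∈ L (a + b))
    (hv : ∀ i, linPoly (v i) ^ ringExpChar k ^ e i ∈ L (ringExpChar k ^ e i)) (a : ℕ) :
    powAlg v e a ≤ L a := by
  classical
  have hpow : ∀ (i : τ) (n : ℕ), (linPoly (v i) ^ ringExpChar k ^ e i) ^ n ∈
      L (n * ringExpChar k ^ e i) := by
    intro i n
    induction n with
    | zero => simpa using h1
    | succ n ih => rw [pow_succ, add_mul, one_mul]; exact hmul _ _ _ _ ih (hv i)
  rw [powAlg, Submodule.span_le]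
  rintro _ ⟨α, rfl, rfl⟩
  induction (Finset.univ : Finset τ) using Finset.induction_on with
  | empty => simpa using h1
  | insert i s hi ih =>
    rw [Finset.sum_insert hi, Finset.prod_insert hi]
    exact hmul _ _ _ _ (hpow i _) ih

theorem linPoly_add (v w : V → k) : linPoly (v + w) = linPoly v + linPoly w := by
  simp [linPoly, add_mul, Finset.sum_add_distrib]

theorem linPoly_smul (a : k) (v : V → k) : linPoly (a • v) = MvPolynomial.C a * linPoly v := by
  simp [linPoly, Finset.mul_sum, mul_assoc]

theorem linPoly_single [DecidableEq V] (i : V) : linPoly (Pi.single i (1 : k)) = MvPolynomial.X i := by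
  rw [linPoly, Finset.sum_eq_single i] <;> simp +contextual

theorem eval_linPoly (φ : (V → k) →ₗ[k] k) (v : V → k) [DecidableEq V] :
    MvPolynomial.eval (fun j => φ (Pi.single j 1)) (linPoly v) = φ v := by
  rw [linPoly, map_sum]
  conv_rhs => rw [← Finset.univ_sum_single v, map_sum]
  refine Finset.sum_congr rfl fun j _ => ?_
  rw [map_mul, MvPolynomial.eval_C, MvPolynomial.eval_X, ← smul_eq_mul, ← map_smul]
  congr 1
  ext i
  by_cases h : i = j
  · subst h; simp
  · simp [h]

theorem ringExpChar_pos (k : Type*) [Field k] : 0 < ringExpChar k :=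
  expChar_pos k (ringExpChar k)

/-- The linear forms whose `p ^ m`-th power belongs to `L`. -/
def rootSub (L : Submodule k (MvPolynomial V k)) (m : ℕ) : Submodule k (V → k) where
  carrier := {v | linPoly v ^ ringExpChar k ^ m ∈ L}
  add_mem' := by
    intro v w hv hw
    have : ExpChar (MvPolynomial V k) (ringExpChar k) :=
      expChar_of_injective_algebraMap (algebraMap k (MvPolynomial V k)).injective (ringExpChar k)
    simp only [Set.mem_ofPred_eq] at *
    rw [linPoly_add, add_pow_expChar_pow]
    exact L.add_mem hv hw
  zero_mem' := by
    simp only [Set.mem_ofPred_eq, linPoly, Pi.zero_apply, map_zero, zero_mul, Finset.sum_const_zero]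
    rw [zero_pow (pow_pos (ringExpChar_pos k) m).ne']
    exact L.zero_mem
  smul_mem' := by
    intro a v hv
    simp only [Set.mem_ofPred_eq] at *
    rw [linPoly_smul, mul_pow, ← map_pow, ← MvPolynomial.smul_eq_C_mul]
    exact L.smul_mem _ hv

theorem mem_rootSub {L : Submodule k (MvPolynomial V k)} {m : ℕ} {v : V → k} :
    v ∈ rootSub L m ↔ linPoly v ^ ringExpChar k ^ m ∈ L := Iff.rfl

/-- The flag is recovered from the algebra. A functional `φ` that vanishes on the `v i` with `e i ≤
m`, viewed as a point, kills each product of generators of degree `p^m`, because a factor of such a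
product has degree at most `p^m`. So it kills every `w` with `w^{p^m}` in the algebra. The
hypothesis `he` is needed when the exponential characteristic is `1`, where degrees do not determine
exponents. -/
theorem rootSub_powAlg (v : τ → V → k) (e : τ → ℕ) (he : ringExpChar k = 1 → ∀ i, e i = 0) (m : ℕ) :
    rootSub (powAlg v e (ringExpChar k ^ m)) m = Submodule.span k (v '' {i | e i ≤ m}) := by
  classical
  apply le_antisymm
  · intro w hw
    by_contra hn
    obtain ⟨φ, hφ, hφ'⟩ := Submodule.exists_le_ker_of_notMem hn
    rw [mem_rootSub] at hw
    have key : ∀ f ∈ powAlg v e (ringExpChar k ^ m),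
        MvPolynomial.eval (fun j => φ (Pi.single j 1)) f = 0 := by
      intro f hf
      refine Submodule.span_induction
        (p := fun x _ => MvPolynomial.eval (fun j => φ (Pi.single j 1)) x = 0) ?_ (map_zero _) (fun x y _ _ hx hy => by rw [map_add, hx, hy, add_zero])
        (fun a x _ hx => by rw [MvPolynomial.smul_eval, hx, mul_zero]) hf
      rintro _ ⟨α, hα, rfl⟩
      obtain ⟨i, hi⟩ : ∃ i, α i ≠ 0 := by
        by_contra hcon
        push Not at hcon
        have := pow_pos (ringExpChar_pos k) m
        simp [hcon] at hα
        omega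
      have hle : α i * ringExpChar k ^ e i ≤ ringExpChar k ^ m := by
        rw [← hα]
        exact Finset.single_le_sum (f := fun i => α i * ringExpChar k ^ e i) (fun _ _ => Nat.zero_le _)
          (Finset.mem_univ i)
      have hle' : ringExpChar k ^ e i ≤ ringExpChar k ^ m :=
        le_trans (Nat.le_mul_of_pos_left _ (Nat.pos_of_ne_zero hi)) hle
      have hem : e i ≤ m := by
        by_cases h1 : ringExpChar k = 1
        · rw [he h1 i]; exact Nat.zero_le _
        · exact (Nat.pow_le_pow_iff_right (by have := ringExpChar_pos k; omega)).1 hle'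
      rw [map_prod]
      refine Finset.prod_eq_zero (Finset.mem_univ i) ?_
      have h0 : φ (v i) = 0 := hφ' (Submodule.subset_span ⟨i, hem, rfl⟩)
      rw [map_pow, map_pow, eval_linPoly, h0, zero_pow (pow_pos (ringExpChar_pos k) _).ne',
        zero_pow hi]
    have := key _ hw
    rw [map_pow, eval_linPoly] at this
    exact hφ (pow_eq_zero_iff (pow_pos (ringExpChar_pos k) m).ne' |>.1 this)
  · rw [Submodule.span_le]
    rintro _ ⟨i, hi, rfl⟩
    change linPoly (v i) ^ ringExpChar k ^ m ∈ powAlg v e (ringExpChar k ^ m)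
    refine Submodule.subset_span ⟨Pi.single i (ringExpChar k ^ (m - e i)), ?_, ?_⟩
    · rw [Finset.sum_eq_single i]
      · rw [Pi.single_eq_same, ← pow_add, Nat.sub_add_cancel hi]
      · intro b _ hb; rw [Pi.single_eq_of_ne hb, zero_mul]
      · simp
    · rw [Finset.prod_eq_single i]
      · rw [Pi.single_eq_same, ← pow_mul, ← pow_add, Nat.add_sub_cancel' hi]
      · intro b _ hb; rw [Pi.single_eq_of_ne hb, pow_zero]
      · simp

theorem card_filter_le_of_span_le {v : τ → V → k} {e : τ → ℕ} {w : τ' → V → k} {e' : τ' → ℕ}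
    (hv : LinearIndependent k v) {m : ℕ}
    (h : Submodule.span k (v '' {i | e i ≤ m}) ≤ Submodule.span k (w '' {i | e' i ≤ m})) :
    (Finset.univ.filter fun i => e i ≤ m).card ≤ (Finset.univ.filter fun i => e' i ≤ m).card := by
  classical
  have h1 : Module.finrank k (Submodule.span k (v '' {i | e i ≤ m})) =
      (Finset.univ.filter fun i => e i ≤ m).card := by
    have h3 : LinearIndependent k (fun i : {i // e i ≤ m} => v i) :=
      hv.comp _ Subtype.val_injective
    have h2 := finrank_span_eq_card h3
    rw [Set.image_eq_range]
    rw [Fintype.card_subtype] at h2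
    exact h2
  have h4 : Module.finrank k (Submodule.span k (w '' {i | e' i ≤ m})) ≤
      (Finset.univ.filter fun i => e' i ≤ m).card := by
    rw [Set.image_eq_range]
    have h2 := finrank_range_le_card (R := k) (fun i : {i // e' i ≤ m} => w i)
    rw [Fintype.card_subtype] at h2
    exact h2
  rw [← h1]
  exact (Submodule.finrank_mono h).trans h4

theorem span_eq_of_card_eq {v : τ → V → k} {e : τ → ℕ} {w : τ' → V → k} {e' : τ' → ℕ}
    (hv : LinearIndependent k v) {m : ℕ}
    (h : Submodule.span k (v '' {i | e i ≤ m}) ≤ Submodule.span k (w '' {i | e' i ≤ m}))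
    (hcard : (Finset.univ.filter fun i => e i ≤ m).card = (Finset.univ.filter fun i => e' i ≤ m).card) :
    Submodule.span k (v '' {i | e i ≤ m}) = Submodule.span k (w '' {i | e' i ≤ m}) := by
  classical
  refine Submodule.eq_of_le_of_finrank_le h ?_
  have h1 : Module.finrank k (Submodule.span k (v '' {i | e i ≤ m})) =
      (Finset.univ.filter fun i => e i ≤ m).card := by
    have h3 : LinearIndependent k (fun i : {i // e i ≤ m} => v i) :=
      hv.comp _ Subtype.val_injective
    have h2 := finrank_span_eq_card h3
    rw [Set.image_eq_range]
    rw [Fintype.card_subtype] at h2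
    exact h2
  rw [h1, hcard, Set.image_eq_range]
  have h2 := finrank_range_le_card (R := k) (fun i : {i // e' i ≤ m} => w i)
  rw [Fintype.card_subtype] at h2
  exact h2

theorem powAlg_le_powAlg_of_span_le {v : τ → V → k} {e : τ → ℕ} {w : τ' → V → k} {e' : τ' → ℕ}
    (he : ringExpChar k = 1 → ∀ i, e i = 0)
    (h : ∀ i, w i ∈ Submodule.span k (v '' {j | e j ≤ e' i})) (a : ℕ) :
    powAlg w e' a ≤ powAlg v e a := by
  refine powAlg_le (one_mem_powAlg v e) (fun a b f g => mul_mem_powAlg) (fun i => ?_) a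
  rw [← mem_rootSub, rootSub_powAlg v e he]
  exact h i

theorem span_le_span_of_powAlg_le {v : τ → V → k} {e : τ → ℕ} {w : τ' → V → k} {e' : τ' → ℕ}
    (he : ringExpChar k = 1 → ∀ i, e i = 0) (he' : ringExpChar k = 1 → ∀ i, e' i = 0)
    (h : ∀ a, powAlg v e a ≤ powAlg w e' a) (m : ℕ) :
    Submodule.span k (v '' {i | e i ≤ m}) ≤ Submodule.span k (w '' {i | e' i ≤ m}) := by
  rw [← rootSub_powAlg v e he, ← rootSub_powAlg w e' he']
  intro x hx
  exact h _ hx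

/-- An inclusion of algebras gives inclusions of the steps of the flags. With equal counts these are
equalities, by dimension, and the flag determines the algebra. -/
theorem powAlg_eq_of_le_of_card_eq {v : τ → V → k} {e : τ → ℕ} {w : τ' → V → k} {e' : τ' → ℕ}
    (hv : LinearIndependent k v)
    (he : ringExpChar k = 1 → ∀ i, e i = 0) (he' : ringExpChar k = 1 → ∀ i, e' i = 0)
    (h : ∀ a, powAlg v e a ≤ powAlg w e' a)
    (hcard : ∀ m, (Finset.univ.filter fun i => e i ≤ m).card =
      (Finset.univ.filter fun i => e' i ≤ m).card) (a : ℕ) :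
    powAlg v e a = powAlg w e' a := by
  refine le_antisymm (h a) (powAlg_le_powAlg_of_span_le he (fun i => ?_) a)
  rw [span_eq_of_card_eq hv (span_le_span_of_powAlg_le he he' h _) (hcard _)]
  exact Submodule.subset_span ⟨i, le_refl (e' i), rfl⟩

variable {O : Type*} [CommRing O] [IsLocalRing O] [Algebra k O] {c : O →ₐ[k] MvPowerSeries V k}

/-- The part of degree `a` of the leading algebra, in coordinates. -/
noncomputable def leadSub (c : O →ₐ[k] MvPowerSeries V k) (R : IdealisticFiltration O) (a : ℕ) :
    Submodule k (MvPolynomial V k) :=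
  ((R.ideal a ⊓ maximalIdeal O ^ a).restrictScalars k).map (leadPoly a ∘ₗ c.toLinearMap)

theorem mem_leadSub {R : IdealisticFiltration O} {a : ℕ} {p : MvPolynomial V k} :
    p ∈ leadSub c R a ↔ ∃ f ∈ R.ideal a, f ∈ maximalIdeal O ^ a ∧ leadPoly a (c f) = p := by
  simp [leadSub, and_assoc]

theorem leadSub_mono {R R' : IdealisticFiltration O} {a : ℕ} (h : R.ideal a ≤ R'.ideal a) :
    leadSub c R a ≤ leadSub c R' a := by
  intro p hp
  obtain ⟨f, hf, hf', rfl⟩ := mem_leadSub.1 hp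
  exact mem_leadSub.2 ⟨f, h hf, hf', rfl⟩

theorem one_mem_leadSub (R : IdealisticFiltration O) : 1 ∈ leadSub c R 0 :=
  mem_leadSub.2 ⟨1, by rw [R.ideal_zero]; trivial, by simp, by rw [map_one, leadPoly_one]⟩

theorem mul_mem_leadSub (hc : IsCoord c) {R : IdealisticFiltration O} {a b : ℕ}
    {p q : MvPolynomial V k} (hp : p ∈ leadSub c R a) (hq : q ∈ leadSub c R b) :
    p * q ∈ leadSub c R (a + b) := by
  obtain ⟨f, hf, hf', rfl⟩ := mem_leadSub.1 hp
  obtain ⟨g, hg, hg', rfl⟩ := mem_leadSub.1 hq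
  refine mem_leadSub.2 ⟨f * g, R.mul_le a b (Ideal.mul_mem_mul hf hg), ?_, ?_⟩
  · rw [pow_add]; exact Ideal.mul_mem_mul hf' hg'
  · rw [map_mul, leadPoly_mul (hc.mem_iff.2 hf') (hc.mem_iff.2 hg')]

theorem IsCoord.mk_eq_mk_iff (hc : IsCoord c) {a : ℕ} {f g : O} (hf : f ∈ maximalIdeal O ^ a)
    (hg : g ∈ maximalIdeal O ^ a) :
    Ideal.Quotient.mk (maximalIdeal O ^ (a + 1)) f = Ideal.Quotient.mk (maximalIdeal O ^ (a + 1)) g ↔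
      leadPoly a (c f) = leadPoly a (c g) := by
  rw [Ideal.Quotient.eq, ← hc.mem_iff, map_sub,
    ← leadPoly_eq_zero_iff (Ideal.sub_mem _ (hc.mem_iff.2 hf) (hc.mem_iff.2 hg)), map_sub, sub_eq_zero]

theorem IsCoord.image_mk_subset_iff (hc : IsCoord c) {a : ℕ} {S T : Set O}
    (hS : ∀ f ∈ S, f ∈ maximalIdeal O ^ a) (hT : ∀ f ∈ T, f ∈ maximalIdeal O ^ a) :
    Ideal.Quotient.mk (maximalIdeal O ^ (a + 1)) '' S ⊆ Ideal.Quotient.mk (maximalIdeal O ^ (a + 1)) '' T ↔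
      (fun f => leadPoly a (c f)) '' S ⊆ (fun f => leadPoly a (c f)) '' T := by
  rw [Set.image_subset_iff, Set.image_subset_iff]
  refine forall₂_congr fun f hf => ?_
  simp only [Set.mem_preimage, Set.mem_image]
  refine exists_congr fun g => and_congr_right fun hg => ?_
  exact hc.mk_eq_mk_iff (hT _ hg) (hS _ hf)

theorem coe_leadSub (R : IdealisticFiltration O) (a : ℕ) :
    (leadSub c R a : Set (MvPolynomial V k)) =
      (fun f => leadPoly a (c f)) '' {f | f ∈ R.ideal a ∧ f ∈ maximalIdeal O ^ a} := rfl

theorem IsCoord.leadingPart_subset_iff (hc : IsCoord c) (R R' : IdealisticFiltration O) (a : ℕ) :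
    R.leadingPart a ⊆ R'.leadingPart a ↔ leadSub c R a ≤ leadSub c R' a := by
  rw [← SetLike.coe_subset_coe (S := leadSub c R a), coe_leadSub, coe_leadSub]
  exact hc.image_mk_subset_iff (fun f hf => hf.2) fun f hf => hf.2

theorem IsCoord.leadingPart_eq_iff (hc : IsCoord c) (R R' : IdealisticFiltration O) (a : ℕ) :
    R.leadingPart a = R'.leadingPart a ↔ leadSub c R a = leadSub c R' a := by
  rw [Set.Subset.antisymm_iff, hc.leadingPart_subset_iff, hc.leadingPart_subset_iff,
    le_antisymm_iff]

theorem IsCoord.mk_mem_leadingPart_iff (hc : IsCoord c) (R : IdealisticFiltration O) {a : ℕ} {g : O}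
    (hg : g ∈ maximalIdeal O ^ a) :
    Ideal.Quotient.mk (maximalIdeal O ^ (a + 1)) g ∈ R.leadingPart a ↔
      leadPoly a (c g) ∈ leadSub c R a := by
  have h := hc.image_mk_subset_iff (a := a) (S := {g}) (T := {f | f ∈ R.ideal a ∧ f ∈ maximalIdeal O ^ a})
    (by rintro _ rfl; exact hg) fun f hf => hf.2
  rw [Set.image_singleton, Set.image_singleton, Set.singleton_subset_iff,
    Set.singleton_subset_iff] at h
  exact h

/-- For elements of `m^a`, the class modulo `m^{a+1}` and the homogeneous part of degree `a` in
coordinates carry the same information. Since any coordinates may be used, leading algebras can be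
compared in different ones. -/
theorem IsCoord.hasLeadingForm_iff (hc : IsCoord c) (R : IdealisticFiltration O) {t r : ℕ}
    {x : Fin t ⊕ Fin r → O} {e : Fin t → ℕ} (hx : ∀ i, x (Sum.inl i) ∈ maximalIdeal O) :
    HasLeadingForm k R x e ↔ (ringExpChar k = 1 → ∀ i, e i = 0) ∧
      ∀ a, leadSub c R a = powAlg (fun i => linPart (c (x (Sum.inl i)))) e a := by
  refine and_congr_right fun _ => forall_congr' fun a => ?_
  set G : Set O := {f | ∃ α : Fin t → ℕ, ∑ i, α i * ringExpChar k ^ e i = a ∧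
    f = ∏ i, (x (Sum.inl i) ^ ringExpChar k ^ e i) ^ α i} with hG
  have hlead : ∀ α : Fin t → ℕ, ∑ i, α i * ringExpChar k ^ e i = a →
      (∏ i, (x (Sum.inl i) ^ ringExpChar k ^ e i) ^ α i) ∈ maximalIdeal O ^ a ∧
      leadPoly a (c (∏ i, (x (Sum.inl i) ^ ringExpChar k ^ e i) ^ α i)) =
        ∏ i, (linPoly (linPart (c (x (Sum.inl i)))) ^ ringExpChar k ^ e i) ^ α i := by
    intro α hα
    have h1 := leadPoly_prod Finset.univ (fun i => α i * ringExpChar k ^ e i)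
      (fun i => c (x (Sum.inl i)) ^ (α i * ringExpChar k ^ e i))
      fun i _ => Ideal.pow_mem_pow (hc.mem_iff'.2 (hx i)) _
    rw [hα] at h1
    have h2 : c (∏ i, (x (Sum.inl i) ^ ringExpChar k ^ e i) ^ α i) =
        ∏ i, c (x (Sum.inl i)) ^ (α i * ringExpChar k ^ e i) := by
      rw [map_prod]
      refine Finset.prod_congr rfl fun i _ => ?_
      rw [← pow_mul, map_pow, mul_comm]
    refine ⟨?_, ?_⟩
    · rw [← hc.mem_iff, h2]; exact h1.1
    · rw [h2, h1.2]
      refine Finset.prod_congr rfl fun i _ => ?_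
      have h3 := leadPoly_pow (n := 1) (f := c (x (Sum.inl i)))
        (by rw [pow_one]; exact hc.mem_iff'.2 (hx i)) (α i * ringExpChar k ^ e i)
      rw [one_mul] at h3
      rw [h3, leadPoly_one_eq, ← pow_mul, mul_comm]
  have hU : ∀ f ∈ Submodule.span k G, f ∈ maximalIdeal O ^ a := by
    intro f hf
    have : Submodule.span k G ≤ (maximalIdeal O ^ a).restrictScalars k :=
      Submodule.span_le.2 (by rintro _ ⟨α, hα, rfl⟩; exact (hlead α hα).1)
    exact this hf
  have h1 : (Submodule.span k
    {w | ∃ α : Fin t → ℕ, ∑ i, α i * ringExpChar k ^ e i = a ∧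
      w = Ideal.Quotient.mk (maximalIdeal O ^ (a + 1))
        (∏ i, (x (Sum.inl i) ^ ringExpChar k ^ e i) ^ α i)} :
    Set (O ⧸ maximalIdeal O ^ (a + 1))) =
      Ideal.Quotient.mk (maximalIdeal O ^ (a + 1)) '' (Submodule.span k G : Set O) := by
    have h2 := Submodule.map_span (Ideal.Quotient.mkₐ k (maximalIdeal O ^ (a + 1))).toLinearMap G
    have h3 : {w | ∃ α : Fin t → ℕ, ∑ i, α i * ringExpChar k ^ e i = a ∧
      w = Ideal.Quotient.mk (maximalIdeal O ^ (a + 1))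
        (∏ i, (x (Sum.inl i) ^ ringExpChar k ^ e i) ^ α i)} =
        (Ideal.Quotient.mkₐ k (maximalIdeal O ^ (a + 1))).toLinearMap '' G := by
      ext w
      constructor
      · rintro ⟨α, hα, rfl⟩
        exact ⟨_, ⟨α, hα, rfl⟩, rfl⟩
      · rintro ⟨_, ⟨α, hα, rfl⟩, rfl⟩
        exact ⟨α, hα, rfl⟩
    rw [h3, ← h2]
    rfl
  have h4 : (powAlg (fun i => linPart (c (x (Sum.inl i)))) e a : Set (MvPolynomial V k)) =
      (fun f => leadPoly a (c f)) '' (Submodule.span k G : Set O) := by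
    have h2 := Submodule.map_span (leadPoly a ∘ₗ c.toLinearMap) G
    have h3 : {w | ∃ α : Fin t → ℕ, ∑ i, α i * ringExpChar k ^ e i = a ∧
        w = ∏ i, (linPoly (linPart (c (x (Sum.inl i)))) ^ ringExpChar k ^ e i) ^ α i} =
        (leadPoly a ∘ₗ c.toLinearMap) '' G := by
      ext w
      constructor
      · rintro ⟨α, hα, rfl⟩
        exact ⟨_, ⟨α, hα, rfl⟩, (hlead α hα).2⟩
      · rintro ⟨_, ⟨α, hα, rfl⟩, rfl⟩
        exact ⟨α, hα, (hlead α hα).2⟩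
    rw [powAlg, h3, ← h2]
    rfl
  rw [h1, ← SetLike.coe_set_eq (p := leadSub c R a), coe_leadSub, h4, IdealisticFiltration.leadingPart,
    Set.Subset.antisymm_iff, Set.Subset.antisymm_iff,
    hc.image_mk_subset_iff (fun f hf => hf.2) hU, hc.image_mk_subset_iff hU fun f hf => hf.2]

/-- An element of the extended ideal differs from an element of the local ring by a term of higher
order, which does not affect the initial form. -/
theorem IsCoord.leadSub_map (hc : IsCoord c) (K : IdealisticFiltration O) (a : ℕ) :
    leadSub (AlgHom.id k (MvPowerSeries V k)) (K.map (c : O →+* MvPowerSeries V k)) a =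
      leadSub c K a := by
  ext p
  rw [mem_leadSub, mem_leadSub]
  constructor
  · rintro ⟨f, hf, hf', rfl⟩
    obtain ⟨g, hg, hfg⟩ := hc.exists_mem_sub_mem (K.ideal a) (a + 1) hf
    have hlp : leadPoly a (c g) = leadPoly a f := by
      have := leadPoly_of_mem hfg
      rw [map_sub, sub_eq_zero] at this
      exact this.symm
    refine ⟨g, hg, ?_, hlp⟩
    rw [← hc.mem_iff]
    have := Ideal.sub_mem _ hf' (Ideal.pow_le_pow_right (Nat.le_succ a) hfg)
    rwa [sub_sub_cancel] at this
  · rintro ⟨f, hf, hf', rfl⟩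
    exact ⟨c f, Ideal.mem_map_of_mem _ hf, hc.mem_iff.2 hf', rfl⟩

end LeadingAlgebra

/-! ### The structure of graded algebras stable under Hasse derivatives -/

section LeadingFormExistence

open MvPowerSeries

/-- A basis is extended along the flag, which becomes stationary; `e` records the step at which a
vector is added. -/
theorem exists_flag_basis {k W : Type*} [Field k] [AddCommGroup W] [Module k W] [FiniteDimensional k W]
    (U : ℕ → Submodule k W) (hU : Monotone U) :
    ∃ (t : ℕ) (b : Fin t → W) (e : Fin t → ℕ), LinearIndependent k b ∧
      ∀ m, U m = Submodule.span k (b '' {i | e i ≤ m}) := by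
  classical
  have step : ∀ M, ∃ (s : Set W) (e : W → ℕ), LinearIndepOn k id s ∧ (∀ x ∈ s, e x ≤ M) ∧
      ∀ m ≤ M, U m = Submodule.span k {x | x ∈ s ∧ e x ≤ m} := by
    intro M
    induction M with
    | zero =>
      obtain ⟨b, hb, -, hb2, hb3⟩ := exists_linearIndepOn_id_extension (K := k) (s := (∅ : Set W))
        (t := (U 0 : Set W)) (linearIndependent_empty k W) (Set.empty_subset _)
      refine ⟨b, fun _ => 0, hb3, by simp, fun m hm => ?_⟩
      obtain rfl : m = 0 := by omega
      simp only [le_refl, and_true]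
      exact le_antisymm hb2 (Submodule.span_le.2 hb)
    | succ M ih =>
      obtain ⟨s, e, hs, he, hse⟩ := ih
      have hsub : s ⊆ (U (M + 1) : Set W) := by
        intro x hx
        refine hU (Nat.le_succ M) ?_
        rw [hse M le_rfl]
        exact Submodule.subset_span ⟨hx, he x hx⟩
      obtain ⟨b, hb, hb1, hb2, hb3⟩ := exists_linearIndepOn_id_extension hs hsub
      refine ⟨b, fun x => if x ∈ s then e x else M + 1, hb3, ?_, ?_⟩
      · intro x _
        dsimp only
        split_ifs with h
        · exact (he x h).trans (Nat.le_succ M)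
        · exact le_rfl
      · intro m hm
        rcases Nat.lt_or_ge m (M + 1) with h | h
        · rw [hse m (by omega)]
          congr 1
          ext x
          constructor
          · rintro ⟨h1, h2⟩
            refine ⟨hb1 h1, ?_⟩
            dsimp only
            rw [if_pos h1]; exact h2
          · rintro ⟨h1, h2⟩
            dsimp only at h2
            by_cases h3 : x ∈ s
            · rw [if_pos h3] at h2; exact ⟨h3, h2⟩
            · rw [if_neg h3] at h2; omega
        · obtain rfl : m = M + 1 := by omega
          have h1 : {x | x ∈ b ∧ (if x ∈ s then e x else M + 1) ≤ M + 1} = b := by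
            ext x
            refine ⟨fun h => h.1, fun h => ⟨h, ?_⟩⟩
            split_ifs with h3
            · exact (he x h3).trans (Nat.le_succ M)
            · exact le_rfl
          rw [h1]
          exact le_antisymm hb2 (Submodule.span_le.2 hb)
  obtain ⟨M, hM⟩ := monotone_stabilizes_iff_noetherian.2 (inferInstance : IsNoetherian k W) ⟨U, hU⟩
  obtain ⟨s, e, hs, he, hse⟩ := step M
  have hfin : s.Finite := hs.setFinite
  have := hfin.fintype
  let E := (Fintype.equivFin s).symm
  refine ⟨Fintype.card s, fun i => (E i : W), fun i => e (E i), ?_, fun m => ?_⟩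
  · exact (hs.linearIndependent).comp E E.injective
  · have h1 : (fun i => (E i : W)) '' {i | e (E i) ≤ m} = {x | x ∈ s ∧ e x ≤ m} := by
      ext x
      constructor
      · rintro ⟨i, hi, rfl⟩; exact ⟨(E i).2, hi⟩
      · rintro ⟨h1, h2⟩
        exact ⟨E.symm ⟨x, h1⟩, by simpa using h2, by simp⟩
    rw [h1]
    rcases le_total m M with h | h
    · exact hse m h
    · have h2 : U M = U m := hM m h
      rw [← h2, hse M le_rfl]
      congr 1
      ext x
      exact ⟨fun h' => ⟨h'.1, h'.2.trans h⟩, fun h' => ⟨h'.1, he x h'.1⟩⟩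

/-- With `q` the exponential characteristic, `(1 + X)^{q^j m} = (1 + X^{q^j})^m`, in which `X^{q^j}`
has the coefficient `m`. -/
theorem cast_choose_pow_ne_zero {k : Type*} [Field k] {j m : ℕ} (hm : (m : k) ≠ 0) :
    (((ringExpChar k ^ j * m).choose (ringExpChar k ^ j) : ℕ) : k) ≠ 0 := by
  have h1 : ((1 + Polynomial.X : Polynomial k) ^ (ringExpChar k ^ j * m)).coeff (ringExpChar k ^ j) =
      (((ringExpChar k ^ j * m).choose (ringExpChar k ^ j) : ℕ) : k) := by
    rw [Polynomial.coeff_one_add_X_pow]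
  have : ExpChar (Polynomial k) (ringExpChar k) :=
    expChar_of_injective_algebraMap (algebraMap k (Polynomial k)).injective (ringExpChar k)
  have h2 : (1 + Polynomial.X : Polynomial k) ^ (ringExpChar k ^ j * m) =
      Polynomial.expand k (ringExpChar k ^ j) ((1 + Polynomial.X) ^ m) := by
    rw [pow_mul, add_pow_expChar_pow, one_pow, map_pow, map_add, map_one, Polynomial.expand_X]
  rw [← h1, h2]
  have h3 := Polynomial.coeff_expand_mul (R := k) (pow_pos (ringExpChar_pos k) j)
    ((1 + Polynomial.X) ^ m) 1
  rw [one_mul] at h3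
  rw [h3, Polynomial.coeff_one_add_X_pow, Nat.choose_one_right]
  exact hm

/-- The lowest nonzero digit in the expansion to the base of the exponential characteristic. -/
theorem exists_eq_pow_mul (k : Type*) [Field k] {n : ℕ} (hn : n ≠ 0) :
    ∃ j m : ℕ, n = ringExpChar k ^ j * m ∧ (m : k) ≠ 0 ∧ (ringExpChar k = 1 → j = 0) := by
  have : ExpChar k (ringExpChar k) := ringExpChar.expChar k
  generalize ringExpChar k = q at this
  cases this with
  | zero => exact ⟨0, n, by simp, by exact_mod_cast hn, fun _ => rfl⟩
  | prime hp =>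
    obtain ⟨j, m, hm, rfl⟩ := Nat.exists_eq_pow_mul_and_not_dvd hn q hp.ne_one
    refine ⟨j, m, rfl, ?_, fun h => absurd h hp.ne_one⟩
    rwa [Ne, CharP.cast_eq_zero_iff k q]

variable {k τ ρ : Type*} [Field k] [Fintype τ] [Fintype ρ]

/-- The exponents of the monomials in `k[x_1 ^ (p ^ e_1), …, x_t ^ (p ^ e_t)]`. -/
def IsPowExponent (k : Type*) [Field k] (e : τ → ℕ) (α : τ ⊕ ρ →₀ ℕ) : Prop :=
  (∀ i, ringExpChar k ^ e i ∣ α (Sum.inl i)) ∧ ∀ r, α (Sum.inr r) = 0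

theorem monomial_mem_powAlg [DecidableEq (τ ⊕ ρ)] {e : τ → ℕ} {α : τ ⊕ ρ →₀ ℕ} (h : IsPowExponent k e α) (x : k) :
    MvPolynomial.monomial α x ∈ powAlg (fun i => Pi.single (Sum.inl i) (1 : k)) e α.degree := by
  rw [show MvPolynomial.monomial α x = x • MvPolynomial.monomial α (1 : k) by
    rw [MvPolynomial.smul_monomial, smul_eq_mul, mul_one]]
  refine Submodule.smul_mem _ _ (Submodule.subset_span ?_)
  choose β hβ using h.1
  refine ⟨β, ?_, ?_⟩
  · rw [Finsupp.degree_eq_sum, Fintype.sum_sum_type, Finset.sum_eq_zero (s := (Finset.univ : Finset ρ))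
      fun r _ => h.2 r, add_zero]
    exact Finset.sum_congr rfl fun i _ => by rw [hβ, mul_comm]
  · rw [MvPolynomial.monomial_eq, map_one, one_mul, Finsupp.prod_fintype _ _ (by simp),
      Fintype.prod_sum_type, Finset.prod_eq_one (s := (Finset.univ : Finset ρ))
      fun r _ => by rw [h.2 r, pow_zero], mul_one]
    exact Finset.prod_congr rfl fun i _ => by rw [hβ, linPoly_single, pow_mul]

theorem isPowExponent_of_coeff_ne_zero [DecidableEq (τ ⊕ ρ)] {e : τ → ℕ} {a : ℕ} {p : MvPolynomial (τ ⊕ ρ) k}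
    (hp : p ∈ powAlg (fun i => Pi.single (Sum.inl i) (1 : k)) e a) {α : τ ⊕ ρ →₀ ℕ}
    (hα : p.coeff α ≠ 0) : IsPowExponent k e α := by
  by_contra hn
  refine hα ?_
  refine Submodule.span_induction (p := fun x _ => MvPolynomial.coeff α x = 0) ?_ (by simp)
    (fun x y _ _ hx hy => by rw [MvPolynomial.coeff_add, hx, hy, add_zero])
    (fun r x _ hx => by rw [MvPolynomial.coeff_smul, hx, smul_zero]) hp
  rintro _ ⟨β, -, rfl⟩
  set γ : τ ⊕ ρ →₀ ℕ := Finsupp.equivFunOnFinite.symm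
    (Sum.elim (fun i => ringExpChar k ^ e i * β i) fun _ => 0) with hγ
  have h1 : ∏ i, (linPoly (Pi.single (Sum.inl i : τ ⊕ ρ) (1 : k)) ^ ringExpChar k ^ e i) ^ β i =
      MvPolynomial.monomial γ 1 := by
    rw [MvPolynomial.monomial_eq, map_one, one_mul, Finsupp.prod_fintype _ _ (by simp),
      Fintype.prod_sum_type, Finset.prod_eq_one (s := (Finset.univ : Finset ρ))
      fun r _ => by simp [hγ], mul_one]
    exact Finset.prod_congr rfl fun i _ => by simp [hγ, linPoly_single, pow_mul]
  rw [h1, MvPolynomial.coeff_monomial, if_neg]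
  rintro rfl
  exact hn ⟨fun i => ⟨β i, by simp [hγ]⟩, fun r => by simp [hγ]⟩

theorem mem_powAlg_of_support [DecidableEq (τ ⊕ ρ)] {e : τ → ℕ} {a : ℕ} {p : MvPolynomial (τ ⊕ ρ) k}
    (hp : p.IsHomogeneous a) (h : ∀ α, p.coeff α ≠ 0 → IsPowExponent k e α) :
    p ∈ powAlg (fun i => Pi.single (Sum.inl i) (1 : k)) e a := by
  rw [← MvPolynomial.support_sum_monomial_coeff p]
  refine Submodule.sum_mem _ fun α hα => ?_
  rw [MvPolynomial.mem_support_iff] at hα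
  have hd : α.degree = a := by
    by_contra hne
    exact hα (hp.coeff_eq_zero hne)
  rw [← hd]
  exact monomial_mem_powAlg (h α hα) _

theorem multiChoose_sub_single {V : Type*} [Fintype V] (α : V →₀ ℕ) (i : V) (b : ℕ)
    (hb : b ≤ α i) : multiChoose α (α - Finsupp.single i b) = (α i).choose b := by
  classical
  rw [multiChoose, Finset.prod_eq_single i]
  · rw [Finsupp.tsub_apply, Finsupp.single_eq_same, Nat.choose_symm hb]
  · intro j _ hj
    rw [Finsupp.tsub_apply, Finsupp.single_eq_of_ne hj, Nat.sub_zero, Nat.choose_self]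
  · intro h; exact absurd (Finset.mem_univ i) h

theorem coeff_linPoly_pow {V : Type*} [Fintype V] (d : V → k) (j : ℕ) (β : V →₀ ℕ) [DecidableEq V] :
    MvPolynomial.coeff β (linPoly d ^ ringExpChar k ^ j) =
      ∑ i, if Finsupp.single i (ringExpChar k ^ j) = β then d i ^ ringExpChar k ^ j else 0 := by
  have : ExpChar (MvPolynomial V k) (ringExpChar k) :=
    expChar_of_injective_algebraMap (algebraMap k (MvPolynomial V k)).injective (ringExpChar k)
  rw [linPoly, sum_pow_char_pow, MvPolynomial.coeff_sum]
  refine Finset.sum_congr rfl fun i _ => ?_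
  rw [mul_pow, ← map_pow, MvPolynomial.coeff_C_mul, MvPolynomial.coeff_X_pow]
  split_ifs <;> simp

/-- Induction on the degree. If a forbidden monomial of `p ∈ L a` is not a pure power `X_i^{q^j}`,
with `q` the exponential characteristic, a suitable Hasse derivative of `p` contains a forbidden
pure power in smaller degree, a contradiction. The forbidden part of `p` is therefore a combination
of `q^j`-th powers of variables, which over a perfect field is the `q^j`-th power of one linear
form. The hypothesis on the flag excludes this. -/
theorem eq_powAlg_of_hasse [DecidableEq (τ ⊕ ρ)] [IsAlgClosed k]
    {L : ℕ → Submodule k (MvPolynomial (τ ⊕ ρ) k)}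
    (hhom : ∀ a p, p ∈ L a → p.IsHomogeneous a) (hone : 1 ∈ L 0)
    (hmul : ∀ a b f g, f ∈ L a → g ∈ L b → f * g ∈ L (a + b))
    (hhasse : ∀ a p, p ∈ L a → ∀ K : τ ⊕ ρ →₀ ℕ, K.degree ≤ a → ∃ q ∈ L (a - K.degree),
      ∀ m, q.coeff m = (multiChoose (m + K) K : k) * p.coeff (m + K))
    (e : τ → ℕ) (hroot : ∀ (m : ℕ) (v : τ ⊕ ρ → k), v ∈ rootSub (L (ringExpChar k ^ m)) m ↔
      ∀ j, v j ≠ 0 → ∃ i, j = Sum.inl i ∧ e i ≤ m) (a : ℕ) :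
    L a = powAlg (fun i => Pi.single (Sum.inl i) (1 : k)) e a := by
  classical
  have hle : ∀ a, powAlg (fun i => Pi.single (Sum.inl i) (1 : k)) e a ≤ L a := by
    refine powAlg_le hone hmul fun i => ?_
    rw [← mem_rootSub, hroot]
    intro j hj
    by_contra hcon
    refine hj (Pi.single_eq_of_ne ?_ _)
    rintro rfl
    exact hcon ⟨i, rfl, le_rfl⟩
  have hq := ringExpChar_pos k
  refine le_antisymm ?_ (hle a)
  induction a using Nat.strong_induction_on with
  | _ a ih =>
    intro p hp
    refine mem_powAlg_of_support (hhom a p hp) ?_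
    -- a monomial outside is a pure power
    have hpure : ∀ α, p.coeff α ≠ 0 → ¬ IsPowExponent k e α →
        ∃ i j, α = Finsupp.single i (ringExpChar k ^ j) ∧ (ringExpChar k = 1 → j = 0) := by
      intro α hα hbad
      have hd : α.degree = a := by
        by_contra hne
        exact hα ((hhom a p hp).coeff_eq_zero hne)
      obtain ⟨i0, hi0, hi0'⟩ : ∃ i0, α i0 ≠ 0 ∧ ∀ i, i0 = Sum.inl i → ¬ ringExpChar k ^ e i ∣ α i0 := by
        by_contra hcon
        push Not at hcon
        refine hbad ⟨fun i => ?_, fun r => ?_⟩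
        · by_cases h0 : α (Sum.inl i) = 0
          · rw [h0]; exact dvd_zero _
          · obtain ⟨i', h1, h2⟩ := hcon _ h0
            obtain rfl := Sum.inl_injective h1
            exact h2
        · by_contra h0
          obtain ⟨i', h1, h2⟩ := hcon _ h0
          cases h1
      -- `q^j` is the lowest nonzero digit of the offending exponent. Differentiating by all of `α`
      -- except `X_{i0}^{q^j}` leaves this power with the coefficient `binom(α i0, q^j) ≠ 0`.
      obtain ⟨j, m, hjm, hm, hj⟩ := exists_eq_pow_mul k hi0
      refine ⟨i0, j, ?_, hj⟩
      have hm0 : m ≠ 0 := by rintro rfl; simp at hm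
      have hb : ringExpChar k ^ j ≤ α i0 := by
        rw [hjm]; exact Nat.le_mul_of_pos_right _ (Nat.pos_of_ne_zero hm0)
      have hle0 : Finsupp.single i0 (ringExpChar k ^ j) ≤ α := by
        rwa [Finsupp.single_le_iff]
      by_contra hne
      set K := α - Finsupp.single i0 (ringExpChar k ^ j) with hK
      have hKα : Finsupp.single i0 (ringExpChar k ^ j) + K = α := add_tsub_cancel_of_le hle0
      have hKd : ringExpChar k ^ j + K.degree = a := by
        rw [← hd, ← hKα, map_add, Finsupp.degree_single]
      have hK0 : K ≠ 0 := by
        intro h0; rw [h0, add_zero] at hKα; exact hne hKα.symm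
      have hKpos : K.degree ≠ 0 := by rwa [Ne, Finsupp.degree_eq_zero_iff]
      obtain ⟨q, hqL, hqc⟩ := hhasse a p hp K (by omega)
      have hq' := ih (a - K.degree) (by omega) hqL
      have hc0 : q.coeff (Finsupp.single i0 (ringExpChar k ^ j)) ≠ 0 := by
        rw [hqc, hKα]
        refine mul_ne_zero ?_ hα
        rw [hK, multiChoose_sub_single _ _ _ hb, hjm]
        exact cast_choose_pow_ne_zero hm
      have hgood := isPowExponent_of_coeff_ne_zero hq' hc0
      rcases i0 with i | r
      · have h1 := hgood.1 i
        rw [Finsupp.single_eq_same] at h1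
        exact hi0' i rfl (hjm ▸ h1.mul_right m)
      · have h1 := hgood.2 r
        rw [Finsupp.single_eq_same] at h1
        exact (pow_pos hq j).ne' h1
    intro α hα
    by_contra hbad
    obtain ⟨i0, j, rfl, hj⟩ := hpure α hα hbad
    have haj : a = ringExpChar k ^ j := by
      have hd : (Finsupp.single i0 (ringExpChar k ^ j)).degree = a := by
        by_contra hne
        exact hα ((hhom a p hp).coeff_eq_zero hne)
      rw [← hd, Finsupp.degree_single]
    subst haj
    have hpure' : ∀ β, p.coeff β ≠ 0 → ¬ IsPowExponent k e β →
        ∃ i, β = Finsupp.single i (ringExpChar k ^ j) := by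
      intro β hβ hβ'
      obtain ⟨i, j', rfl, -⟩ := hpure β hβ hβ'
      refine ⟨i, ?_⟩
      have hd : (Finsupp.single i (ringExpChar k ^ j')).degree = ringExpChar k ^ j := by
        by_contra hne
        exact hβ ((hhom _ p hp).coeff_eq_zero hne)
      rw [← hd, Finsupp.degree_single]
    set p1 := ∑ β ∈ p.support.filter (IsPowExponent k e), MvPolynomial.monomial β (p.coeff β) with hp1
    set p2 := ∑ β ∈ p.support.filter (fun β => ¬ IsPowExponent k e β),
      MvPolynomial.monomial β (p.coeff β) with hp2
    have hsum : p1 + p2 = p := by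
      rw [hp1, hp2, Finset.sum_filter_add_sum_filter_not, MvPolynomial.support_sum_monomial_coeff]
    have hp1L : p1 ∈ L (ringExpChar k ^ j) := by
      refine hle _ (Submodule.sum_mem _ fun β hβ => ?_)
      rw [Finset.mem_filter, MvPolynomial.mem_support_iff] at hβ
      have hd : β.degree = ringExpChar k ^ j := by
        by_contra hne
        exact hβ.1 ((hhom _ p hp).coeff_eq_zero hne)
      rw [← hd]
      exact monomial_mem_powAlg hβ.2 _
    have hp2L : p2 ∈ L (ringExpChar k ^ j) := by
      rw [eq_sub_of_add_eq' hsum]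
      exact Submodule.sub_mem _ hp hp1L
    -- The coefficients have `q^j`-th roots, so the forbidden part is a power of a linear form.
    choose rt hrt using fun x : k => IsAlgClosed.exists_pow_nat_eq x (pow_pos hq j)
    let d : τ ⊕ ρ → k := fun i =>
      if IsPowExponent k e (Finsupp.single i (ringExpChar k ^ j)) then 0
      else rt (p.coeff (Finsupp.single i (ringExpChar k ^ j)))
    have hpow0 : (0 : k) ^ ringExpChar k ^ j = 0 := zero_pow (pow_pos hq j).ne'
    have hd : p2 = linPoly d ^ ringExpChar k ^ j := by
      ext β
      have hl : MvPolynomial.coeff β p2 = if IsPowExponent k e β then 0 else p.coeff β := by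
        rw [hp2, MvPolynomial.coeff_sum]
        simp only [MvPolynomial.coeff_monomial, Finset.sum_ite_eq', Finset.mem_filter,
          MvPolynomial.mem_support_iff]
        by_cases h1 : IsPowExponent k e β <;> by_cases h2 : p.coeff β = 0 <;> simp [h1, h2]
      change MvPolynomial.coeff β p2 = MvPolynomial.coeff β _
      rw [hl, coeff_linPoly_pow]
      by_cases hβ : ∃ i, β = Finsupp.single i (ringExpChar k ^ j)
      · obtain ⟨i, rfl⟩ := hβ
        rw [Finset.sum_eq_single i]
        · rw [if_pos rfl]
          simp only [d]
          split_ifs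
          · rw [hpow0]
          · rw [hrt]
        · intro b _ hb
          rw [if_neg]
          intro h
          exact hb (Finsupp.single_left_injective (pow_pos hq j).ne' h)
        · intro h; exact absurd (Finset.mem_univ i) h
      · rw [Finset.sum_eq_zero fun i _ => if_neg fun h => hβ ⟨i, h.symm⟩]
        split_ifs with h1
        · rfl
        · by_contra h2
          exact hβ (hpure' β h2 h1)
    rw [hd, ← mem_rootSub, hroot] at hp2L
    have hdi : d i0 ≠ 0 := by
      intro h0
      simp only [d, if_neg hbad] at h0
      have := hrt (p.coeff (Finsupp.single i0 (ringExpChar k ^ j)))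
      rw [h0, hpow0] at this
      exact hα this.symm
    obtain ⟨i, rfl, hi⟩ := hp2L i0 hdi
    refine hbad ⟨fun i' => ?_, fun r => ?_⟩
    · by_cases h : i' = i
      · subst h; rw [Finsupp.single_eq_same]; exact pow_dvd_pow _ hi
      · rw [Finsupp.single_eq_of_ne (by simpa using h)]; exact dvd_zero _
    · rw [Finsupp.single_eq_of_ne (by simp)]

end LeadingFormExistence

/-! ### Existence, uniqueness and monotonicity of `σ` -/

section Sigma

open MvPowerSeries

variable {k V ι O : Type*} [Field k] [Fintype V] [Fintype ι] [CommRing O] [IsLocalRing O] [Algebra k O]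
  {c : O →ₐ[k] MvPowerSeries V k}

theorem IsCoord.linearIndependent_linPart (hc : IsCoord c) {x : ι → O}
    (hx : Ideal.span (Set.range x) = maximalIdeal O) (hcard : Fintype.card ι = Fintype.card V) :
    LinearIndependent k fun i => linPart (c (x i)) := by
  classical
  obtain ⟨A, hA⟩ := hc.exists_matrix hx
  have hB : (Matrix.of fun i => linPart (c (x i))) * A = 1 :=
    (Matrix.mul_eq_one_comm_of_card_eq V ι k hcard.symm).1 hA
  rw [Fintype.linearIndependent_iff]
  intro g hg
  have h1 : Matrix.vecMul g (Matrix.of fun i => linPart (c (x i))) = 0 := by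
    rw [← hg]
    ext j
    simp [Matrix.vecMul, dotProduct]
  have h2 := congrArg (fun w => Matrix.vecMul w A) h1
  simp only [Matrix.vecMul_vecMul, hB, Matrix.vecMul_one, Matrix.zero_vecMul] at h2
  exact congrFun h2

theorem linPart_add (f g : MvPowerSeries V k) : linPart (f + g) = linPart f + linPart g := by
  ext j; simp [linPart]

theorem linPart_smul (a : k) (f : MvPowerSeries V k) : linPart (a • f) = a • linPart f := by
  ext j; simp [linPart]

theorem linPart_sum {κ : Type*} (s : Finset κ) (f : κ → MvPowerSeries V k) :
    linPart (∑ i ∈ s, f i) = ∑ i ∈ s, linPart (f i) := by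
  ext j; simp [linPart]

theorem linPart_X [DecidableEq V] (j : V) : linPart (X j : MvPowerSeries V k) = Pi.single j 1 := by
  ext i
  rw [linPart, coeff_X, Pi.single_apply]
  simp [Finsupp.single_left_inj]

theorem linPart_eq_zero {f : MvPowerSeries V k} (hf : f ∈ maximalIdeal _ ^ 2) : linPart f = 0 := by
  ext j
  exact (mem_maximalIdeal_pow_iff _ _).1 hf _ (by simp)

theorem IsCoord.exists_regularSystem [IsNoetherianRing O] (hc : IsCoord c) {b : ι → V → k}
    (hb : LinearIndependent k b) (hcard : Fintype.card ι = Fintype.card V) :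
    ∃ x : ι → O, Ideal.span (Set.range x) = maximalIdeal O ∧ ∀ i, linPart (c (x i)) = b i := by
  classical
  choose ξ hξ hξ' using fun j => hc.exists_lift_X 1 j
  have hspan := hc.span_eq_maximalIdeal hξ'
  have hlin : ∀ j, linPart (c (ξ j)) = Pi.single j 1 := by
    intro j
    have h1 := linPart_eq_zero (hξ' j)
    rw [← linPart_X, ← sub_add_cancel (c (ξ j)) (X j), linPart_add, h1, zero_add]
  refine ⟨fun i => ∑ j, b i j • ξ j, ?_, fun i => ?_⟩
  · obtain ⟨A, hA⟩ : ∃ A : V → ι → k, ∀ j, ∑ i, A j i • b i = Pi.single j 1 := by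
      have htop : Submodule.span k (Set.range b) = ⊤ := by
        refine hb.span_eq_top_of_card_eq_finrank' ?_
        rw [hcard, Module.finrank_fintype_fun_eq_card]
      have : ∀ j : V, ∃ A : ι → k, ∑ i, A i • b i = Pi.single j 1 := by
        intro j
        rw [← Submodule.mem_span_range_iff_exists_fun, htop]; trivial
      choose A hA using this
      exact ⟨A, hA⟩
    apply le_antisymm
    · rw [Ideal.span_le]
      rintro _ ⟨i, rfl⟩
      refine Ideal.sum_mem _ fun j _ => ?_
      rw [Algebra.smul_def]
      exact Ideal.mul_mem_left _ _ (hξ j)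
    · rw [← hspan, Ideal.span_le]
      rintro _ ⟨j, rfl⟩
      have h1 : ξ j = ∑ i, A j i • ∑ l, b i l • ξ l := by
        simp_rw [Finset.smul_sum, smul_smul]
        rw [Finset.sum_comm]
        simp_rw [← Finset.sum_smul]
        have h2 : ∀ l, ∑ i, A j i * b i l = Pi.single (M := fun _ => k) j 1 l := by
          intro l; rw [← hA j]; simp
        simp_rw [h2]
        rw [Finset.sum_eq_single j] <;> simp +contextual
      rw [h1]
      refine Ideal.sum_mem _ fun i _ => ?_
      rw [Algebra.smul_def]
      exact Ideal.mul_mem_left _ _ (Ideal.subset_span ⟨i, rfl⟩)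
  · simp_rw [map_sum, map_smul, linPart_sum, linPart_smul, hlin]
    ext l
    simp [Pi.single_apply]

/-- The graded algebra `L` is generated by `p`-power powers of independent linear forms. -/
structure IsLeadForm (L : ℕ → Submodule k (MvPolynomial V k)) {t : ℕ} (v : Fin t → V → k)
    (e : Fin t → ℕ) : Prop where
  indep : LinearIndependent k v
  expChar : ringExpChar k = 1 → ∀ i, e i = 0
  eq : ∀ a, L a = powAlg v e a

theorem IsCoord.isLeadForm_of_hasLeadingForm (hO : IsRegularLocalRing O) (hc : IsCoord c)
    {R : IdealisticFiltration O} {t r : ℕ} {x : Fin t ⊕ Fin r → O} {e : Fin t → ℕ}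
    (hx : IsRegularSystem x) (h : HasLeadingForm k R x e) :
    t + r = Fintype.card V ∧ IsLeadForm (leadSub c R) (fun i => linPart (c (x (Sum.inl i)))) e := by
  rw [hc.isRegularSystem_iff hO] at hx
  have hm : ∀ i, x (Sum.inl i) ∈ maximalIdeal O := fun i => by
    rw [← hx.1]; exact Ideal.subset_span ⟨_, rfl⟩
  refine ⟨by simpa using hx.2, ?_, ((hc.hasLeadingForm_iff R hm).1 h).1, ((hc.hasLeadingForm_iff R hm).1 h).2⟩
  exact (hc.linearIndependent_linPart hx.1 hx.2).comp _ Sum.inl_injective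

theorem exists_sum_extension {t : ℕ} {v : Fin t → V → k} (hv : LinearIndependent k v) :
    ∃ (r : ℕ) (b : Fin t ⊕ Fin r → V → k), LinearIndependent k b ∧ (∀ i, b (Sum.inl i) = v i) ∧
      t + r = Fintype.card V := by
  classical
  let B := Module.Basis.sumExtend hv
  have : Finite (Fin t ⊕ Module.Basis.sumExtendIndex hv) := Module.Finite.finite_basis B
  have : Finite (Module.Basis.sumExtendIndex hv) := Finite.of_injective _ (Sum.inr_injective (α := Fin t))
  have := Fintype.ofFinite (Module.Basis.sumExtendIndex hv)
  let E := Fintype.equivFin (Module.Basis.sumExtendIndex hv)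
  refine ⟨Fintype.card (Module.Basis.sumExtendIndex hv),
    fun i => B (Equiv.sumCongr (Equiv.refl _) E.symm i), ?_, fun i => ?_, ?_⟩
  · exact B.linearIndependent.comp _ (Equiv.injective _)
  · simp only [B, Module.Basis.sumExtend, Equiv.sumCongr_apply, Sum.map_inl, Equiv.refl_apply,
      Module.Basis.reindex_apply, Module.Basis.extend_apply_self]
    exact congrArg Subtype.val (Equiv.Set.sumDiffSubset_apply_inl
      (hv.linearIndepOn_id.subset_extend (Set.subset_univ _)) ⟨v i, i, rfl⟩)
  · have h1 := Module.finrank_eq_card_basis B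
    rw [Module.finrank_fintype_fun_eq_card, Fintype.card_sum, Fintype.card_fin] at h1
    exact h1.symm

theorem IsCoord.exists_hasLeadingForm [IsNoetherianRing O] (hO : IsRegularLocalRing O) (hc : IsCoord c)
    {R : IdealisticFiltration O} {t : ℕ} {v : Fin t → V → k} {e : Fin t → ℕ}
    (h : IsLeadForm (leadSub c R) v e) :
    ∃ (r : ℕ) (x : Fin t ⊕ Fin r → O), IsRegularSystem x ∧ HasLeadingForm k R x e ∧
      t + r = Fintype.card V := by
  obtain ⟨r, b, hb, hbv, htr⟩ := exists_sum_extension h.indep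
  have hcard : Fintype.card (Fin t ⊕ Fin r) = Fintype.card V := by simpa using htr
  obtain ⟨x, hx, hxb⟩ := hc.exists_regularSystem hb hcard
  have hm : ∀ i, x (Sum.inl i) ∈ maximalIdeal O := fun i => by
    rw [← hx]; exact Ideal.subset_span ⟨_, rfl⟩
  refine ⟨r, x, (hc.isRegularSystem_iff hO x).2 ⟨hx, hcard⟩,
    (hc.hasLeadingForm_iff R hm).2 ⟨h.expChar, fun a => ?_⟩, htr⟩
  simp_rw [hxb, hbv]
  exact h.eq a

/-- Independent linear forms can be completed to a basis and lifted to a regular system of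
parameters, so `σ` only depends on the leading algebra in coordinates. -/
theorem IsCoord.isSigma_iff [IsNoetherianRing O] (hO : IsRegularLocalRing O) (hc : IsCoord c)
    (R : IdealisticFiltration O) (s : ℕ → ℕ) :
    IsSigma k R s ↔ ∃ (t : ℕ) (v : Fin t → V → k) (e : Fin t → ℕ),
      IsLeadForm (leadSub c (R.diffSat k)) v e ∧
      s = fun n => Fintype.card V - (Finset.univ.filter fun i => e i ≤ n).card := by
  constructor
  · rintro ⟨t, r, x, e, hx, hxe, rfl⟩
    obtain ⟨htr, h⟩ := hc.isLeadForm_of_hasLeadingForm hO hx hxe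
    exact ⟨t, _, e, h, by rw [htr]⟩
  · rintro ⟨t, v, e, h, rfl⟩
    obtain ⟨r, x, hx, hxe, htr⟩ := hc.exists_hasLeadingForm hO h
    exact ⟨t, r, x, e, hx, hxe, by rw [htr]⟩

theorem IsLeadForm.card_le {L L' : ℕ → Submodule k (MvPolynomial V k)} {t t' : ℕ} {v : Fin t → V → k}
    {e : Fin t → ℕ} {v' : Fin t' → V → k} {e' : Fin t' → ℕ} (h : IsLeadForm L v e)
    (h' : IsLeadForm L' v' e') (hle : ∀ a, L a ≤ L' a) (m : ℕ) :
    (Finset.univ.filter fun i => e i ≤ m).card ≤ (Finset.univ.filter fun i => e' i ≤ m).card :=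
  card_filter_le_of_span_le h.indep (span_le_span_of_powAlg_le h.expChar h'.expChar
    (fun a => by rw [← h.eq, ← h'.eq]; exact hle a) m)

theorem IsLeadForm.card_le_card {L : ℕ → Submodule k (MvPolynomial V k)} {t : ℕ} {v : Fin t → V → k}
    {e : Fin t → ℕ} (h : IsLeadForm L v e) : t ≤ Fintype.card V := by
  have := h.indep.fintype_card_le_finrank
  rwa [Fintype.card_fin, Module.finrank_fintype_fun_eq_card] at this

theorem IsLeadForm.filter_card_le {L : ℕ → Submodule k (MvPolynomial V k)} {t : ℕ} {v : Fin t → V → k}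
    {e : Fin t → ℕ} (h : IsLeadForm L v e) (m : ℕ) :
    (Finset.univ.filter fun i => e i ≤ m).card ≤ Fintype.card V :=
  (Finset.card_le_univ _).trans (by simpa using h.card_le_card)

theorem IsLeadForm.eq_of_card_eq {L L' : ℕ → Submodule k (MvPolynomial V k)} {t t' : ℕ} {v : Fin t → V → k}
    {e : Fin t → ℕ} {v' : Fin t' → V → k} {e' : Fin t' → ℕ} (h : IsLeadForm L v e)
    (h' : IsLeadForm L' v' e') (hle : ∀ a, L a ≤ L' a)
    (hcard : ∀ m, (Finset.univ.filter fun i => e i ≤ m).card =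
      (Finset.univ.filter fun i => e' i ≤ m).card) (a : ℕ) : L a = L' a := by
  rw [h.eq, h'.eq]
  exact powAlg_eq_of_le_of_card_eq h.indep h.expChar h'.expChar
    (fun a => by rw [← h.eq, ← h'.eq]; exact hle a) hcard a

/-- Two presentations of the same leading algebra have the same counts, each bounding the other, so
the choice in `sigma` is immaterial. -/
theorem IsCoord.isSigma_unique [IsNoetherianRing O] (hO : IsRegularLocalRing O) (hc : IsCoord c)
    {R : IdealisticFiltration O} {s s' : ℕ → ℕ} (h : IsSigma k R s) (h' : IsSigma k R s') : s = s' := by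
  obtain ⟨t, v, e, hv, rfl⟩ := (hc.isSigma_iff hO R s).1 h
  obtain ⟨t', v', e', hv', rfl⟩ := (hc.isSigma_iff hO R s').1 h'
  funext n
  rw [le_antisymm (hv.card_le hv' (fun _ => le_rfl) n) (hv'.card_le hv (fun _ => le_rfl) n)]

theorem isSigma_sigma {R : IdealisticFiltration O} (h : ∃ s, IsSigma k R s) :
    IsSigma k R (sigma k R) := by
  rw [sigma, dif_pos h]
  exact h.choose_spec

theorem IsCoord.sigma_eq [IsNoetherianRing O] (hO : IsRegularLocalRing O) (hc : IsCoord c)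
    {R : IdealisticFiltration O} {s : ℕ → ℕ} (h : IsSigma k R s) : sigma k R = s :=
  hc.isSigma_unique hO (isSigma_sigma ⟨s, h⟩) h

theorem IsCoord.sigma_le_of_le [IsNoetherianRing O] (hO : IsRegularLocalRing O) (hc : IsCoord c)
    {R R' : IdealisticFiltration O} {s s' : ℕ → ℕ} (h : IsSigma k R s) (h' : IsSigma k R' s')
    (hle : ∀ a, leadSub c (R.diffSat k) a ≤ leadSub c (R'.diffSat k) a) (n : ℕ) : s' n ≤ s n := by
  obtain ⟨t, v, e, hv, rfl⟩ := (hc.isSigma_iff hO R s).1 h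
  obtain ⟨t', v', e', hv', rfl⟩ := (hc.isSigma_iff hO R' s').1 h'
  exact Nat.sub_le_sub_left (hv.card_le hv' hle n) _

/-- The counts do not exceed the dimension, so no truncation occurs in `σ` and its value determines
them. -/
theorem IsCoord.leadSub_eq_of_sigma_eq [IsNoetherianRing O] (hO : IsRegularLocalRing O) (hc : IsCoord c)
    {R R' : IdealisticFiltration O} {s : ℕ → ℕ} (h : IsSigma k R s) (h' : IsSigma k R' s)
    (hle : ∀ a, leadSub c (R.diffSat k) a ≤ leadSub c (R'.diffSat k) a) (a : ℕ) :
    leadSub c (R.diffSat k) a = leadSub c (R'.diffSat k) a := by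
  obtain ⟨t, v, e, hv, rfl⟩ := (hc.isSigma_iff hO R s).1 h
  obtain ⟨t', v', e', hv', hs⟩ := (hc.isSigma_iff hO R' _).1 h'
  refine hv.eq_of_card_eq hv' hle (fun m => ?_) a
  have h1 := congrFun hs m
  have h2 := hv.filter_card_le m
  have h3 := hv'.filter_card_le m
  omega

/-- The linear forms whose `p^m`-th power lies in the leading algebra form a flag. Parameters
adapted to the flag, and the stability of the differential saturation under Hasse derivatives up to
higher order, bring the leading algebra under `eq_powAlg_of_hasse`. -/
theorem IsCoord.exists_isSigma [IsAlgClosed k] [Algebra.EssFiniteType k O] [IsNoetherianRing O]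
    (hO : IsRegularLocalRing O) (hc : IsCoord c) (R : IdealisticFiltration O) :
    ∃ s, IsSigma k R s := by
  classical
  set D := R.diffSat k with hD
  have hq := ringExpChar_pos k
  let U : ℕ → Submodule k (V → k) := fun m => rootSub (leadSub c D (ringExpChar k ^ m)) m
  -- Raising to the power `p` leads from one step of the flag to the next.
  have hU : Monotone U := by
    refine monotone_nat_of_le_succ fun m v hv => ?_
    have h1 : linPoly v ^ ringExpChar k ^ m ∈ leadSub c D (ringExpChar k ^ m) := hv
    have h2 : ∀ n, (linPoly v ^ ringExpChar k ^ m) ^ n ∈ leadSub c D (ringExpChar k ^ m * n) := by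
      intro n
      induction n with
      | zero => simpa using one_mem_leadSub D
      | succ n ih => rw [pow_succ, Nat.mul_succ]; exact mul_mem_leadSub hc ih h1
    have h3 := h2 (ringExpChar k)
    rw [← pow_mul, ← pow_succ] at h3
    exact h3
  obtain ⟨t, v, e, hv, hUv⟩ := exists_flag_basis U hU
  obtain ⟨r, b, hb, hbv, htr⟩ := exists_sum_extension hv
  have hcard : Fintype.card (Fin t ⊕ Fin r) = Fintype.card V := by simpa using htr
  obtain ⟨x, hx, hxb⟩ := hc.exists_regularSystem hb hcard
  obtain ⟨c', hc', hc'x⟩ := hc.exists_coord_eq_X hx hcard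
  have hm : ∀ i, x i ∈ maximalIdeal O := fun i => by
    rw [← hx]; exact Ideal.subset_span ⟨_, rfl⟩
  have hroot : ∀ (m : ℕ) (w : Fin t ⊕ Fin r → k),
      w ∈ rootSub (leadSub c' D (ringExpChar k ^ m)) m ↔
      ∀ j, w j ≠ 0 → ∃ i, j = Sum.inl i ∧ e i ≤ m := by
    intro m w
    set f : O := ∑ j, w j • x j with hf
    have hfm : f ∈ maximalIdeal O := Ideal.sum_mem _ fun j _ => by
      rw [Algebra.smul_def]; exact Ideal.mul_mem_left _ _ (hm j)
    have hfw : linPart (c' f) = w := by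
      simp_rw [hf, map_sum, map_smul, hc'x, linPart_sum, linPart_smul, linPart_X]
      ext l; simp [Pi.single_apply]
    have hfb : linPart (c f) = ∑ j, w j • b j := by
      simp_rw [hf, map_sum, map_smul, linPart_sum, linPart_smul, hxb]
    have hlp := leadPoly_pow (n := 1) (f := c f) (by rw [pow_one]; exact hc.mem_iff'.2 hfm)
      (ringExpChar k ^ m)
    have hlp' := leadPoly_pow (n := 1) (f := c' f) (by rw [pow_one]; exact hc'.mem_iff'.2 hfm)
      (ringExpChar k ^ m)
    rw [one_mul, leadPoly_one_eq, ← map_pow] at hlp hlp'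
    have h1 : w ∈ rootSub (leadSub c' D (ringExpChar k ^ m)) m ↔ ∑ j, w j • b j ∈ U m := by
      change _ ↔ linPoly _ ^ ringExpChar k ^ m ∈ leadSub c D _
      rw [← hfb, ← hlp, ← hc.mk_mem_leadingPart_iff D (Ideal.pow_mem_pow hfm _),
        hc'.mk_mem_leadingPart_iff D (Ideal.pow_mem_pow hfm _), hlp', hfw, mem_rootSub]
    rw [h1, hUv]
    have h2 : v '' {i | e i ≤ m} = b '' (Sum.inl '' {i | e i ≤ m}) := by
      rw [Set.image_image]; simp_rw [hbv]
    rw [h2]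
    constructor
    · intro h j hj
      have h3 : j ∈ Sum.inl '' {i | e i ≤ m} := by
        by_contra hcon
        rw [Finsupp.mem_span_image_iff_linearCombination] at h
        obtain ⟨l, hl, hl'⟩ := h
        have h4 : Finsupp.linearCombination k b (Finsupp.equivFunOnFinite.symm w) = ∑ j, w j • b j := by
          rw [Finsupp.linearCombination_apply, Finsupp.sum_fintype _ _ (by simp)]
          rfl
        have h5 : l = Finsupp.equivFunOnFinite.symm w := hb (by rw [hl', h4])
        refine hcon (hl ?_)
        rw [h5]
        simpa using hj
      obtain ⟨i, hi, rfl⟩ := h3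
      exact ⟨i, rfl, hi⟩
    · intro h
      refine Submodule.sum_mem _ fun j _ => ?_
      by_cases hj : w j = 0
      · rw [hj, zero_smul]; exact Submodule.zero_mem _
      · obtain ⟨i, rfl, hi⟩ := h j hj
        exact Submodule.smul_mem _ _ (Submodule.subset_span ⟨_, ⟨i, hi, rfl⟩, rfl⟩)
  have hL := eq_powAlg_of_hasse (L := leadSub c' D) (e := e)
    (fun a p hp => by
      obtain ⟨f, -, -, rfl⟩ := mem_leadSub.1 hp
      exact leadPoly_isHomogeneous _ _)
    (one_mem_leadSub D) (fun a b f g => mul_mem_leadSub hc')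
    (fun a p hp K hK => by
      obtain ⟨f, hf, hf', rfl⟩ := mem_leadSub.1 hp
      obtain ⟨g, hg, hfg⟩ := hc'.exists_mem_diffSat_hasse R hf K (a - K.degree + 1)
      have h1 := hasse_mem_pow (K := K) (hc'.mem_iff.2 hf')
      have hgm : g ∈ maximalIdeal O ^ (a - K.degree) := by
        rw [← hc'.mem_iff]
        have := Ideal.sub_mem _ h1 (Ideal.pow_le_pow_right (Nat.le_succ _) hfg)
        rwa [sub_sub_cancel] at this
      refine ⟨leadPoly (a - K.degree) (c' g), mem_leadSub.2 ⟨g, hg, hgm, rfl⟩, fun m => ?_⟩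
      have h2 : leadPoly (a - K.degree) (c' g) = leadPoly (a - K.degree) (hasse K (c' f)) := by
        have := leadPoly_of_mem hfg
        rw [map_sub, sub_eq_zero] at this
        exact this.symm
      rw [h2, coeff_leadPoly, coeff_leadPoly, coeff_hasse, map_add]
      by_cases hm : m.degree = a - K.degree
      · rw [if_pos hm, if_pos (by omega)]
      · rw [if_neg hm, if_neg (by omega), mul_zero])
    hroot
  -- When the exponential characteristic is `1`, all steps of the flag coincide, so every basis
  -- vector already belongs to the step `0`.
  have hchar : ringExpChar k = 1 → ∀ i, e i = 0 := by
    intro h1 i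
    have h2 := (hroot (e i) (Pi.single (Sum.inl i) 1)).2 (by
      intro j hj
      refine ⟨i, ?_, le_rfl⟩
      by_contra hne
      exact hj (Pi.single_eq_of_ne hne _))
    have h3 : Pi.single (Sum.inl i) (1 : k) ∈ rootSub (leadSub c' D (ringExpChar k ^ 0)) 0 := by
      rw [mem_rootSub] at h2 ⊢
      rw [h1, one_pow] at h2 ⊢
      exact h2
    obtain ⟨i', hi, hi'⟩ := (hroot 0 _).1 h3 (Sum.inl i) (by simp)
    obtain rfl := Sum.inl_injective hi
    omega
  refine ⟨_, (hc'.isSigma_iff hO R _).2 ⟨t, fun i => Pi.single (Sum.inl i) 1, e, ⟨?_, hchar, hL⟩, rfl⟩⟩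
  exact (Pi.linearIndependent_single_one (Fin t ⊕ Fin r) k).comp _ Sum.inl_injective

end Sigma

/-! ### Topological bases of the power series ring with prescribed initial monomials -/

section Adapted

open MvPowerSeries

variable {k V : Type*} [Field k] [Fintype V]

theorem sub_sum_leadPoly_mem (f : MvPowerSeries V k) (N : ℕ) :
    f - ∑ n ∈ Finset.range N, (leadPoly n f : MvPowerSeries V k) ∈ maximalIdeal _ ^ N := by
  rw [mem_maximalIdeal_pow_iff]
  intro α hα
  rw [map_sub, map_sum, Finset.sum_eq_single α.degree]
  · rw [MvPolynomial.coeff_coe, coeff_leadPoly_of_eq _ rfl, sub_self]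
  · intro b _ hb
    rw [MvPolynomial.coeff_coe, coeff_leadPoly_of_ne _ hb.symm]
  · intro h; exact absurd (Finset.mem_range.2 hα) h

/-- Both maps are continuous for the `m`-adic topology, and polynomials are dense. Identities for
the constant term are checked on monomials in this way. -/
theorem linearMap_ext_of_monomial {φ ψ : MvPowerSeries V k →ₗ[k] MvPowerSeries V k}
    (hφ : ∀ N, ∀ f ∈ maximalIdeal (MvPowerSeries V k) ^ N, φ f ∈ maximalIdeal (MvPowerSeries V k) ^ N)
    (hψ : ∀ N, ∀ f ∈ maximalIdeal (MvPowerSeries V k) ^ N, ψ f ∈ maximalIdeal (MvPowerSeries V k) ^ N)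
    (h : ∀ α, φ (monomial α 1) = ψ (monomial α 1)) : φ = ψ := by
  have hpoly : ∀ p : MvPolynomial V k, φ p = ψ p := by
    intro p
    induction p using MvPolynomial.induction_on' with
    | monomial α a =>
      rw [MvPolynomial.coe_monomial, show monomial α a = a • monomial α (1 : k) by
        rw [← map_smul, smul_eq_mul, mul_one], map_smul, map_smul, h]
    | add p q hp hq => rw [MvPolynomial.coe_add, map_add, map_add, hp, hq]
  ext1 f
  rw [← sub_eq_zero]
  refine eq_zero_of_forall_mem_maximalIdeal_pow _ fun N => ?_
  have h1 := sub_sum_leadPoly_mem f N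
  have h2 := Ideal.sub_mem _ (hφ N _ h1) (hψ N _ h1)
  simp only [map_sub, map_sum, hpoly] at h2
  rwa [sub_sub_sub_cancel_right] at h2

/-- The continuous linear map which sends the monomial `X ^ α` to `E α`. -/
noncomputable def basisMap (E : (V →₀ ℕ) → MvPowerSeries V k) : MvPowerSeries V k →ₗ[k] MvPowerSeries V k where
  -- Under the later hypothesis `hE` the order of `E α` is `|α|`, so only the finitely many `α` with
  -- `|α| ≤ |β|` contribute at `β`.
  toFun a := ofCoeff fun β => ∑ α ∈ (Finsupp.finite_of_degree_le (σ := V) β.degree).toFinset,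
    coeff α a * coeff β (E α)
  map_add' a b := by
    ext β; simp [coeff_ofCoeff, add_mul, Finset.sum_add_distrib]
  map_smul' r a := by
    ext β; simp [coeff_ofCoeff, Finset.mul_sum, mul_assoc]

theorem coeff_basisMap (E : (V →₀ ℕ) → MvPowerSeries V k) (a : MvPowerSeries V k) (β : V →₀ ℕ) :
    coeff β (basisMap E a) = ∑ α ∈ (Finsupp.finite_of_degree_le (σ := V) β.degree).toFinset,
      coeff α a * coeff β (E α) := rfl

variable {E : (V →₀ ℕ) → MvPowerSeries V k}

theorem basisMap_mem {N : ℕ} {a : MvPowerSeries V k} (ha : a ∈ maximalIdeal (MvPowerSeries V k) ^ N) :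
    basisMap E a ∈ maximalIdeal (MvPowerSeries V k) ^ N := by
  rw [mem_maximalIdeal_pow_iff] at ha ⊢
  intro β hβ
  rw [coeff_basisMap]
  refine Finset.sum_eq_zero fun α hα => ?_
  rw [Set.Finite.mem_toFinset] at hα
  rw [ha α (lt_of_le_of_lt hα hβ), zero_mul]

variable (hE : ∀ α, E α - monomial α 1 ∈ maximalIdeal (MvPowerSeries V k) ^ (α.degree + 1))

include hE

theorem coeff_of_degree_le [DecidableEq V] {α β : V →₀ ℕ} (h : β.degree ≤ α.degree) :
    coeff β (E α) = if β = α then 1 else 0 := by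
  have h1 := (mem_maximalIdeal_pow_iff _ _).1 (hE α) β (by omega)
  rw [map_sub, sub_eq_zero, coeff_monomial] at h1
  rw [h1]

theorem basisMap_monomial (α : V →₀ ℕ) : basisMap E (monomial α 1) = E α := by
  classical
  ext β
  rw [coeff_basisMap]
  simp only [coeff_monomial, ite_mul, one_mul, zero_mul, Finset.sum_ite_eq', Set.Finite.mem_toFinset]
  split_ifs with h
  · rfl
  · have h' : ¬ α.degree ≤ β.degree := h
    rw [coeff_of_degree_le hE (by omega), if_neg]
    rintro rfl
    exact h' le_rfl

theorem leadPoly_basisMap {n : ℕ} {a : MvPowerSeries V k} (ha : a ∈ maximalIdeal (MvPowerSeries V k) ^ n) :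
    leadPoly n (basisMap E a) = leadPoly n a := by
  classical
  ext β
  rw [coeff_leadPoly, coeff_leadPoly]
  split_ifs with h
  · rw [coeff_basisMap, Finset.sum_eq_single β]
    · rw [coeff_of_degree_le hE le_rfl, if_pos rfl, mul_one]
    · intro α hα hαβ
      rw [Set.Finite.mem_toFinset] at hα
      have h1 : α.degree ≤ β.degree := hα
      rcases h1.lt_or_eq with h2 | h2
      · rw [(mem_maximalIdeal_pow_iff _ _).1 ha α (by omega), zero_mul]
      · rw [coeff_of_degree_le hE h2.ge, if_neg hαβ.symm, mul_zero]
    · intro h1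
      rw [Set.Finite.mem_toFinset] at h1
      exact absurd (le_refl β.degree) h1
  · rfl

theorem mem_of_basisMap_mem {N : ℕ} {a : MvPowerSeries V k}
    (ha : basisMap E a ∈ maximalIdeal (MvPowerSeries V k) ^ N) :
    a ∈ maximalIdeal (MvPowerSeries V k) ^ N := by
  induction N with
  | zero => simp
  | succ N ih =>
    have h1 := ih (Ideal.pow_le_pow_right (Nat.le_succ N) ha)
    rw [← leadPoly_eq_zero_iff h1, ← leadPoly_basisMap hE h1]
    exact leadPoly_of_mem ha

theorem basisMap_injective : Function.Injective (basisMap E) := by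
  rw [← LinearMap.ker_eq_bot, LinearMap.ker_eq_bot']
  intro a ha
  refine eq_zero_of_forall_mem_maximalIdeal_pow _ fun N => mem_of_basisMap_mem hE ?_
  rw [ha]; exact Ideal.zero_mem _

/-- Successive approximation: since `basisMap E` preserves initial forms, subtracting the image of
the initial form raises the order of the remainder. -/
theorem basisMap_surjective : Function.Surjective (basisMap E) := by
  intro f
  let rem : ℕ → MvPowerSeries V k := fun n => Nat.rec f
    (fun n g => g - basisMap E (leadPoly n g : MvPowerSeries V k)) n
  have hrem : ∀ n, rem (n + 1) = rem n - basisMap E (leadPoly n (rem n) : MvPowerSeries V k) :=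
    fun n => rfl
  have hmem : ∀ n, rem n ∈ maximalIdeal (MvPowerSeries V k) ^ n := by
    intro n
    induction n with
    | zero => simp
    | succ n ih =>
      have h1 := coe_mem_maximalIdeal_pow (leadPoly_isHomogeneous n (rem n))
      rw [hrem, ← leadPoly_eq_zero_iff (Ideal.sub_mem _ ih (basisMap_mem h1)), map_sub,
        leadPoly_basisMap hE h1, leadPoly_coe (leadPoly_isHomogeneous n (rem n)), sub_self]
  have hsum : ∀ N, f - basisMap E (∑ n ∈ Finset.range N, (leadPoly n (rem n) : MvPowerSeries V k)) = rem N := by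
    intro N
    induction N with
    | zero => simp [rem]
    | succ N ih => rw [Finset.sum_range_succ, map_add, hrem, ← ih]; abel
  -- The preimage is glued from the forms subtracted: its part of degree `n` is that of the `n`-th
  -- remainder.
  refine ⟨ofCoeff fun α => coeff α (rem α.degree), ?_⟩
  rw [← sub_eq_zero, ← neg_eq_zero, neg_sub]
  refine eq_zero_of_forall_mem_maximalIdeal_pow _ fun N => ?_
  set a : MvPowerSeries V k := ofCoeff fun α => coeff α (rem α.degree) with ha
  have h1 : a - ∑ n ∈ Finset.range N, (leadPoly n (rem n) : MvPowerSeries V k) ∈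
      maximalIdeal (MvPowerSeries V k) ^ N := by
    have h2 : ∀ n, leadPoly n (rem n) = leadPoly n a := by
      intro n
      classical
      ext β
      rw [coeff_leadPoly, coeff_leadPoly]
      split_ifs with h
      · rw [ha, coeff_ofCoeff, h]
      · rfl
    simp_rw [h2]
    exact sub_sum_leadPoly_mem a N
  have h3 := Ideal.sub_mem _ (hmem N) (basisMap_mem (E := E) h1)
  rw [← hsum N, map_sub] at h3
  rwa [sub_sub_sub_cancel_right] at h3

/-- The coefficients of the expansions in the `E α`. -/
noncomputable def basisEquiv : MvPowerSeries V k ≃ₗ[k] MvPowerSeries V k :=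
  LinearEquiv.ofBijective (basisMap E) ⟨basisMap_injective hE, basisMap_surjective hE⟩

theorem basisMap_symm (f : MvPowerSeries V k) : basisMap E ((basisEquiv hE).symm f) = f :=
  (basisEquiv hE).apply_symm_apply f

theorem symm_basisMap (f : MvPowerSeries V k) : (basisEquiv hE).symm (basisMap E f) = f :=
  (basisEquiv hE).symm_apply_apply f

theorem basisEquiv_symm_mem {N : ℕ} {f : MvPowerSeries V k}
    (hf : f ∈ maximalIdeal (MvPowerSeries V k) ^ N) :
    (basisEquiv hE).symm f ∈ maximalIdeal (MvPowerSeries V k) ^ N :=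
  mem_of_basisMap_mem hE (by rwa [basisMap_symm])

/-- If multiplication by `H` permutes the basis by a shift of exponents, then on coordinates it is
multiplication by a monomial. -/
theorem basisMap_mul_of_shift {δ : V →₀ ℕ} {H : MvPowerSeries V k} (hH : ∀ α, E (α + δ) = H * E α)
    (a : MvPowerSeries V k) : basisMap E (monomial δ 1 * a) = H * basisMap E a := by
  have := linearMap_ext_of_monomial (φ := basisMap E ∘ₗ LinearMap.mulLeft k (monomial δ 1))
    (ψ := LinearMap.mulLeft k H ∘ₗ basisMap E)
    (fun N f hf => basisMap_mem (Ideal.mul_mem_left _ _ hf))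
    (fun N f hf => Ideal.mul_mem_left _ _ (basisMap_mem hf))
    (fun α => by
      simp only [LinearMap.comp_apply, LinearMap.mulLeft_apply]
      rw [monomial_mul_monomial, one_mul, basisMap_monomial hE, basisMap_monomial hE, add_comm, hH])
  exact LinearMap.congr_fun this a

theorem symm_mul_of_shift {δ : V →₀ ℕ} {H : MvPowerSeries V k} (hH : ∀ α, E (α + δ) = H * E α)
    (f : MvPowerSeries V k) :
    (basisEquiv hE).symm (H * f) = monomial δ 1 * (basisEquiv hE).symm f := by
  apply basisMap_injective hE
  rw [basisMap_symm, basisMap_mul_of_shift hE hH, basisMap_symm]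

end Adapted

/-! ### Expansions with respect to a leading generator system -/

section Expansion

open MvPowerSeries

variable {k τ ρ : Type*} [Field k] [Fintype τ] [Fintype ρ]

/-- The digits of the exponents, to the moduli `q_i`. -/
noncomputable def digits (q : τ → ℕ) (α : τ ⊕ ρ →₀ ℕ) : τ ⊕ ρ →₀ ℕ :=
  Finsupp.equivFunOnFinite.symm
    (Sum.elim (fun i => α (Sum.inl i) % q i) fun j => α (Sum.inr j))

/-- The exponents of the `h_i`. -/
noncomputable def carries (q : τ → ℕ) (α : τ ⊕ ρ →₀ ℕ) : τ → ℕ := fun i => α (Sum.inl i) / q i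

/-- The exponents `q_i B_i`. -/
noncomputable def scaled (ρ : Type*) [Fintype ρ] (q B : τ → ℕ) : τ ⊕ ρ →₀ ℕ :=
  Finsupp.equivFunOnFinite.symm (Sum.elim (fun i => q i * B i) fun _ => 0)

@[simp] theorem digits_inl (q : τ → ℕ) (α : τ ⊕ ρ →₀ ℕ) (i : τ) :
    digits q α (Sum.inl i) = α (Sum.inl i) % q i := rfl
@[simp] theorem digits_inr (q : τ → ℕ) (α : τ ⊕ ρ →₀ ℕ) (j : ρ) :
    digits q α (Sum.inr j) = α (Sum.inr j) := rfl
@[simp] theorem scaled_inl (q B : τ → ℕ) (i : τ) : scaled ρ q B (Sum.inl i) = q i * B i := rfl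
@[simp] theorem scaled_inr (q B : τ → ℕ) (j : ρ) : scaled ρ q B (Sum.inr j) = 0 := rfl

/-- The exponents of `X_1, …, X_t` are small. -/
def IsSmall (q : τ → ℕ) (α : τ ⊕ ρ →₀ ℕ) : Prop := ∀ i, α (Sum.inl i) < q i

theorem digits_add_scaled (q : τ → ℕ) (α : τ ⊕ ρ →₀ ℕ) : digits q α + scaled ρ q (carries q α) = α := by
  ext i
  rcases i with i | j
  · simp [carries, Nat.mod_add_div]
  · simp

theorem isSmall_digits {q : τ → ℕ} (hq : ∀ i, 0 < q i) (α : τ ⊕ ρ →₀ ℕ) : IsSmall q (digits q α) :=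
  fun i => Nat.mod_lt _ (hq i)

theorem IsSmall.digits_add {q : τ → ℕ} {κ : τ ⊕ ρ →₀ ℕ} (h : IsSmall q κ) (B : τ → ℕ) :
    digits q (κ + scaled ρ q B) = κ := by
  ext i
  rcases i with i | j
  · simp [Nat.mod_eq_of_lt (h i)]
  · simp

theorem IsSmall.carries_add {q : τ → ℕ} {κ : τ ⊕ ρ →₀ ℕ} (h : IsSmall q κ) (B : τ → ℕ) :
    carries q (κ + scaled ρ q B) = B := by
  ext i
  have := h i
  simp [carries, Nat.add_mul_div_left _ _ (lt_of_le_of_lt (Nat.zero_le _) this),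
    Nat.div_eq_of_lt this]

@[simp] theorem scaled_zero (q : τ → ℕ) : scaled ρ q 0 = 0 := by
  ext i; rcases i with i | j <;> simp

open Classical in
/-- The projection to the power series with small exponents. -/
noncomputable def smallPart (q : τ → ℕ) : MvPowerSeries (τ ⊕ ρ) k →ₗ[k] MvPowerSeries (τ ⊕ ρ) k where
  toFun a := ofCoeff fun α => if IsSmall q α then coeff α a else 0
  map_add' a b := by ext β; simp only [coeff_ofCoeff, map_add]; split_ifs <;> simp
  map_smul' r a := by ext β; simp only [coeff_ofCoeff, RingHom.id_apply, map_smul]; split_ifs <;> simp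

open Classical in
theorem coeff_smallPart (q : τ → ℕ) (a : MvPowerSeries (τ ⊕ ρ) k) (α : τ ⊕ ρ →₀ ℕ) :
    coeff α (smallPart q a) = if IsSmall q α then coeff α a else 0 := rfl

theorem smallPart_mem (q : τ → ℕ) {N : ℕ} {a : MvPowerSeries (τ ⊕ ρ) k}
    (ha : a ∈ maximalIdeal (MvPowerSeries (τ ⊕ ρ) k) ^ N) :
    smallPart q a ∈ maximalIdeal (MvPowerSeries (τ ⊕ ρ) k) ^ N := by
  classical
  rw [mem_maximalIdeal_pow_iff] at ha ⊢
  intro α hα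
  rw [coeff_smallPart, ha α hα, ite_self]

/-- The products of powers of the `X_i` with small exponents and powers of the `h_i`. -/
noncomputable def lgsBasis (q : τ → ℕ) (h : τ → MvPowerSeries (τ ⊕ ρ) k) (α : τ ⊕ ρ →₀ ℕ) :
    MvPowerSeries (τ ⊕ ρ) k :=
  monomial (digits q α) 1 * ∏ i, h i ^ carries q α i

variable {q : τ → ℕ} {h : τ → MvPowerSeries (τ ⊕ ρ) k}

theorem IsSmall.lgsBasis_eq {α : τ ⊕ ρ →₀ ℕ} (hα : IsSmall q α) : lgsBasis q h α = monomial α 1 := by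
  have h1 := hα.digits_add (0 : τ → ℕ)
  have h2 := hα.carries_add (0 : τ → ℕ)
  rw [scaled_zero, add_zero] at h1 h2
  rw [lgsBasis, h1, h2]
  simp

theorem lgsBasis_add_scaled (α : τ ⊕ ρ →₀ ℕ) (hq : ∀ i, 0 < q i) (B : τ → ℕ) :
    lgsBasis q h (α + scaled ρ q B) = (∏ i, h i ^ B i) * lgsBasis q h α := by
  have h1 : digits q (α + scaled ρ q B) = digits q α := by
    ext i; rcases i with i | j <;> simp
  have h2 : carries q (α + scaled ρ q B) = carries q α + B := by
    ext i; simp [carries, Nat.add_mul_div_left _ _ (hq i)]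
  rw [lgsBasis, lgsBasis, h1, h2]
  simp only [Pi.add_apply, pow_add, Finset.prod_mul_distrib]
  ring

theorem lgsBasis_add_inr (α : τ ⊕ ρ →₀ ℕ) (j : ρ) :
    lgsBasis q h (α + Finsupp.single (Sum.inr j) 1) = X (Sum.inr j) * lgsBasis q h α := by
  classical
  have h1 : digits q (α + Finsupp.single (Sum.inr j) 1) = digits q α + Finsupp.single (Sum.inr j) 1 := by
    ext i; rcases i with i | j' <;> simp [Finsupp.single_apply]
  have h2 : carries q (α + Finsupp.single (Sum.inr j) 1) = carries q α := by
    ext i; simp [carries]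
  rw [lgsBasis, lgsBasis, h1, h2, X, ← mul_assoc, monomial_mul_monomial, one_mul, add_comm]

/-- Division with remainder by the `q i` splits `α`, and `h i` has the initial form `X_i^{q i}`; so
the basis element belonging to `α` has the initial monomial `X^α`. Existence and uniqueness of
expansions follow from this. -/
theorem prod_sub_monomial_mem (hh : ∀ i, h i - X (Sum.inl i) ^ q i ∈
      maximalIdeal (MvPowerSeries (τ ⊕ ρ) k) ^ (q i + 1)) (α : τ ⊕ ρ →₀ ℕ) :
    lgsBasis q h α - monomial α 1 ∈ maximalIdeal (MvPowerSeries (τ ⊕ ρ) k) ^ (α.degree + 1) := by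
  classical
  have hX : ∀ (i : τ ⊕ ρ) (n : ℕ), (X i : MvPowerSeries (τ ⊕ ρ) k) ^ n ∈ maximalIdeal _ ^ n :=
    fun i n => Ideal.pow_mem_pow (X_mem_maximalIdeal i) n
  have hmem : ∀ i, h i ∈ maximalIdeal (MvPowerSeries (τ ⊕ ρ) k) ^ q i := by
    intro i
    have := Ideal.add_mem _ (Ideal.pow_le_pow_right (Nat.le_succ _) (hh i)) (hX (Sum.inl i) (q i))
    rwa [sub_add_cancel] at this
  have hlead : ∀ i, leadPoly (q i) (h i) = MvPolynomial.X (Sum.inl i) ^ q i := by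
    intro i
    have h1 := leadPoly_of_mem (hh i)
    have h2 := leadPoly_pow (n := 1) (f := (X (Sum.inl i) : MvPowerSeries (τ ⊕ ρ) k))
      (by rw [pow_one]; exact X_mem_maximalIdeal _) (q i)
    rw [one_mul, leadPoly_X] at h2
    rw [map_sub, sub_eq_zero] at h1
    rw [h1, h2]
  have hp := leadPoly_prod (k := k) Finset.univ (fun i => q i * carries q α i) (fun i => h i ^ carries q α i)
    fun i _ => by rw [pow_mul]; exact Ideal.pow_mem_pow (hmem i) _
  have hhom := MvPolynomial.isHomogeneous_monomial (R := k) (d := digits q α) (1 : k) (rfl)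
  have hm := coe_mem_maximalIdeal_pow hhom
  have hl := leadPoly_coe hhom
  rw [MvPolynomial.coe_monomial] at hm hl
  have hdeg : (digits q α).degree + ∑ i, q i * carries q α i = α.degree := by
    conv_rhs => rw [← digits_add_scaled q α, map_add]
    congr 1
    rw [Finsupp.degree_eq_sum, Fintype.sum_sum_type]
    simp
  have h1 := leadPoly_mul hm hp.1
  rw [hdeg, hl, hp.2] at h1
  have h0 : lgsBasis q h α ∈ maximalIdeal (MvPowerSeries (τ ⊕ ρ) k) ^ α.degree := by
    rw [← hdeg, pow_add]; exact Ideal.mul_mem_mul hm hp.1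
  have hhom' := MvPolynomial.isHomogeneous_monomial (R := k) (d := α) (1 : k) rfl
  have hm' := coe_mem_maximalIdeal_pow hhom'
  have hl' := leadPoly_coe hhom'
  rw [MvPolynomial.coe_monomial] at hm' hl'
  rw [← leadPoly_eq_zero_iff (Ideal.sub_mem _ h0 hm'), map_sub, hl', sub_eq_zero]
  change leadPoly α.degree (monomial (digits q α) 1 * ∏ i, h i ^ carries q α i) = _
  rw [h1]
  have h2 : ∀ i, leadPoly (q i * carries q α i) (h i ^ carries q α i) =
      MvPolynomial.X (Sum.inl i) ^ (q i * carries q α i) := by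
    intro i
    rw [leadPoly_pow (hmem i), hlead, pow_mul]
  simp_rw [h2]
  conv_rhs => rw [← digits_add_scaled q α]
  rw [← one_mul (1 : k), ← MvPolynomial.monomial_mul, one_mul]
  congr 1
  rw [MvPolynomial.monomial_eq, map_one, one_mul, Finsupp.prod_fintype _ _ (by simp),
    Fintype.prod_sum_type]
  simp

/-- The hypotheses on a leading generator system which are needed for the expansions. -/
structure IsLGS (q : τ → ℕ) (h : τ → MvPowerSeries (τ ⊕ ρ) k) : Prop where
  pos : ∀ i, 0 < q i
  congr : ∀ i, h i - X (Sum.inl i) ^ q i ∈ maximalIdeal (MvPowerSeries (τ ⊕ ρ) k) ^ (q i + 1)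

/-- The constant term of the expansion with respect to a leading generator system. -/
noncomputable def constTerm (H : IsLGS q h) : MvPowerSeries (τ ⊕ ρ) k →ₗ[k] MvPowerSeries (τ ⊕ ρ) k :=
  smallPart q ∘ₗ (basisEquiv (prod_sub_monomial_mem H.congr)).symm.toLinearMap

namespace IsLGS

variable (H : IsLGS q h)

include H

theorem constTerm_apply (f : MvPowerSeries (τ ⊕ ρ) k) :
    constTerm H f = smallPart q ((basisEquiv (prod_sub_monomial_mem H.congr)).symm f) := rfl

theorem constTerm_mem {N : ℕ} {f : MvPowerSeries (τ ⊕ ρ) k}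
    (hf : f ∈ maximalIdeal (MvPowerSeries (τ ⊕ ρ) k) ^ N) :
    constTerm H f ∈ maximalIdeal (MvPowerSeries (τ ⊕ ρ) k) ^ N :=
  smallPart_mem q (basisEquiv_symm_mem _ hf)

theorem coeff_constTerm {f : MvPowerSeries (τ ⊕ ρ) k} {α : τ ⊕ ρ →₀ ℕ}
    (hα : coeff α (constTerm H f) ≠ 0) : IsSmall q α := by
  classical
  by_contra hn
  exact hα (by rw [constTerm_apply, coeff_smallPart, if_neg hn])

theorem basisMap_smallPart (a : MvPowerSeries (τ ⊕ ρ) k) :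
    basisMap (lgsBasis q h) (smallPart q a) = smallPart q a := by
  classical
  refine LinearMap.congr_fun (linearMap_ext_of_monomial (φ := basisMap (lgsBasis q h) ∘ₗ smallPart q)
    (ψ := smallPart q) (fun N f hf => basisMap_mem (smallPart_mem q hf))
    (fun N f hf => smallPart_mem q hf) fun α => ?_) a
  have h1 : smallPart q (monomial α (1 : k)) = if IsSmall q α then monomial α 1 else 0 := by
    ext β
    rw [coeff_smallPart]
    by_cases h2 : β = α
    · subst h2; split_ifs <;> simp
    · have : coeff β (monomial α (1 : k)) = 0 := by rw [coeff_monomial, if_neg h2]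
      split_ifs <;> simp [this]
  rw [LinearMap.comp_apply, h1]
  split_ifs with h2
  · rw [basisMap_monomial (prod_sub_monomial_mem H.congr), h2.lgsBasis_eq]
  · rw [map_zero]

theorem constTerm_eq_of_small {f : MvPowerSeries (τ ⊕ ρ) k} (hf : smallPart q f = f) :
    constTerm H f = f := by
  have h1 := H.basisMap_smallPart f
  rw [hf] at h1
  have h2 := symm_basisMap (prod_sub_monomial_mem H.congr) f
  rw [h1] at h2
  rw [constTerm_apply, h2, hf]

/-- Multiplication by `h i` shifts the exponents by `q i` in the direction `i`, so no small exponent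
survives. -/
theorem constTerm_h_mul (i : τ) (f : MvPowerSeries (τ ⊕ ρ) k) : constTerm H (h i * f) = 0 := by
  classical
  have hshift : ∀ α, lgsBasis q h (α + scaled ρ q (Pi.single i 1)) = h i * lgsBasis q h α := by
    intro α
    rw [lgsBasis_add_scaled α H.pos, Finset.prod_eq_single i] <;> simp +contextual
  rw [constTerm_apply, symm_mul_of_shift _ hshift]
  ext β
  rw [coeff_smallPart, map_zero]
  split_ifs with h1
  · rw [coeff_monomial_mul, if_neg]
    intro h2
    have h3 := h2 (Sum.inl i)
    have h4 := h1 i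
    simp at h3
    omega
  · rfl

theorem constTerm_X_mul (j : ρ) (f : MvPowerSeries (τ ⊕ ρ) k) :
    constTerm H (X (Sum.inr j) * f) = X (Sum.inr j) * constTerm H f := by
  classical
  have hshift : ∀ α, lgsBasis q h (α + Finsupp.single (Sum.inr j) 1) = X (Sum.inr j) * lgsBasis q h α :=
    fun α => lgsBasis_add_inr α j
  rw [constTerm_apply, constTerm_apply, symm_mul_of_shift _ hshift, X]
  ext β
  rw [coeff_smallPart, coeff_monomial_mul, coeff_monomial_mul, coeff_smallPart]
  have h1 : IsSmall q (β - Finsupp.single (Sum.inr j) 1) ↔ IsSmall q β := by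
    simp [IsSmall]
  simp only [h1]
  split_ifs <;> simp

theorem constTerm_X_pow_mul (j : ρ) (n : ℕ) (f : MvPowerSeries (τ ⊕ ρ) k) :
    constTerm H (X (Sum.inr j) ^ n * f) = X (Sum.inr j) ^ n * constTerm H f := by
  induction n with
  | zero => simp
  | succ n ih => rw [pow_succ', mul_assoc, constTerm_X_mul, ih, mul_assoc]

/-- Taking the constant term is reduction modulo the `h i`: a basis element with a large exponent is
a multiple of some `h i`, and it remains one after multiplication by `g`. -/
theorem constTerm_mul_left (f g : MvPowerSeries (τ ⊕ ρ) k) :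
    constTerm H (f * g) = constTerm H (constTerm H f * g) := by
  have hE := prod_sub_monomial_mem H.congr
  obtain ⟨a, rfl⟩ := basisMap_surjective hE f
  refine LinearMap.congr_fun (linearMap_ext_of_monomial
    (φ := constTerm H ∘ₗ LinearMap.mulRight k g ∘ₗ basisMap (lgsBasis q h))
    (ψ := constTerm H ∘ₗ LinearMap.mulRight k g ∘ₗ constTerm H ∘ₗ basisMap (lgsBasis q h))
    (fun N f hf => H.constTerm_mem (Ideal.mul_mem_right _ _ (basisMap_mem hf)))
    (fun N f hf => H.constTerm_mem (Ideal.mul_mem_right _ _ (H.constTerm_mem (basisMap_mem hf))))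
    fun α => ?_) a
  simp only [LinearMap.comp_apply, LinearMap.mulRight_apply]
  rw [basisMap_monomial hE]
  by_cases hα : IsSmall q α
  · classical
    rw [hα.lgsBasis_eq, H.constTerm_eq_of_small (f := monomial α 1)]
    ext β
    rw [coeff_smallPart]
    by_cases h2 : β = α
    · subst h2; rw [if_pos hα]
    · have : coeff β (monomial α (1 : k)) = 0 := by rw [coeff_monomial, if_neg h2]
      rw [this, ite_self]
  · obtain ⟨i, hi⟩ : ∃ i, q i ≤ α (Sum.inl i) := by
      simpa [IsSmall] using hα
    classical
    have h1 : scaled ρ q (Pi.single i 1) ≤ α := by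
      intro l
      rcases l with l | l
      · by_cases hl : l = i
        · subst hl; simpa using hi
        · simp [Pi.single_eq_of_ne hl]
      · simp
    have h2 : lgsBasis q h α = h i * lgsBasis q h (α - scaled ρ q (Pi.single i 1)) := by
      conv_lhs => rw [← tsub_add_cancel_of_le h1]
      rw [lgsBasis_add_scaled _ H.pos, Finset.prod_eq_single i] <;> simp +contextual
    rw [h2, mul_assoc, constTerm_h_mul, constTerm_h_mul, zero_mul, map_zero]

theorem constTerm_mul (f g : MvPowerSeries (τ ⊕ ρ) k) :
    constTerm H (f * g) = constTerm H (constTerm H f * constTerm H g) := by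
  rw [H.constTerm_mul_left f g, mul_comm, H.constTerm_mul_left g, mul_comm]

theorem constTerm_mul_mem {a b : ℕ} {f g : MvPowerSeries (τ ⊕ ρ) k}
    (hf : constTerm H f ∈ maximalIdeal (MvPowerSeries (τ ⊕ ρ) k) ^ a)
    (hg : constTerm H g ∈ maximalIdeal (MvPowerSeries (τ ⊕ ρ) k) ^ b) :
    constTerm H (f * g) ∈ maximalIdeal (MvPowerSeries (τ ⊕ ρ) k) ^ (a + b) := by
  rw [constTerm_mul]
  refine H.constTerm_mem ?_
  rw [pow_add]
  exact (Ideal.mul_mem_mul hf hg)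

theorem X_pow_dvd_constTerm_mul {a b : ℕ} {j : ρ} {f g : MvPowerSeries (τ ⊕ ρ) k}
    (hf : X (Sum.inr j) ^ a ∣ constTerm H f) (hg : X (Sum.inr j) ^ b ∣ constTerm H g) :
    X (Sum.inr j) ^ (a + b) ∣ constTerm H (f * g) := by
  rw [constTerm_mul]
  obtain ⟨u, hu⟩ := hf
  obtain ⟨v, hv⟩ := hg
  refine ⟨constTerm H (u * v), ?_⟩
  rw [← constTerm_X_pow_mul, hu, hv]
  congr 1
  ring

/-- A family of coefficients `c B` with small exponents is the same as a single power series in the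
coordinates of the basis, through the bijection `α ↔ (digits, carries)`. -/
theorem expansion_sub_mem [DecidableEq τ] (c : (τ → ℕ) → MvPowerSeries (τ ⊕ ρ) k)
    (hc : ∀ B α, coeff α (c B) ≠ 0 → IsSmall q α) (N : ℕ) :
    basisMap (lgsBasis q h) (ofCoeff fun α => coeff (digits q α) (c (carries q α))) -
      ∑ B ∈ Fintype.piFinset (fun _ : τ => Finset.range N), c B * ∏ i, h i ^ B i ∈
        maximalIdeal (MvPowerSeries (τ ⊕ ρ) k) ^ N := by
  classical
  have hE := prod_sub_monomial_mem H.congr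
  have h1 : ∀ B, c B * ∏ i, h i ^ B i =
      basisMap (lgsBasis q h) (monomial (scaled ρ q B) 1 * c B) := by
    intro B
    have h2 : smallPart q (c B) = c B := by
      ext α
      rw [coeff_smallPart]
      split_ifs with h3
      · rfl
      · by_contra h4
        exact h3 (hc B α fun h5 => h4 h5.symm)
    rw [basisMap_mul_of_shift hE (fun α => lgsBasis_add_scaled α H.pos B)]
    conv_rhs => rw [← h2, H.basisMap_smallPart, h2]
    rw [mul_comm]
  simp_rw [h1]
  rw [← map_sum, ← map_sub]
  refine basisMap_mem ?_
  rw [mem_maximalIdeal_pow_iff]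
  intro α hα
  -- An exponent of degree smaller than `N` has carries smaller than `N`, so its term occurs in the
  -- partial sum.
  have hmem : carries q α ∈ Fintype.piFinset (fun _ : τ => Finset.range N) := by
    rw [Fintype.mem_piFinset]
    intro i
    rw [Finset.mem_range]
    refine lt_of_le_of_lt (Nat.div_le_self _ _) (lt_of_le_of_lt ?_ hα)
    exact Finsupp.le_degree _ _
  rw [map_sub, map_sum, Finset.sum_eq_single (carries q α) _ (fun h' => absurd hmem h')]
  · have h3 := digits_add_scaled q α
    have h2 : scaled ρ q (carries q α) ≤ α := le_of_le_of_eq le_add_self h3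
    rw [coeff_monomial_mul, if_pos h2, one_mul, coeff_ofCoeff]
    conv_rhs at h3 => rw [← tsub_add_cancel_of_le h2]
    rw [add_right_cancel h3, sub_self]
  · intro B _ hB
    rw [coeff_monomial_mul]
    split_ifs with h2
    · rw [one_mul]
      by_contra h3
      have h4 := (hc B _ h3).carries_add B
      rw [tsub_add_cancel_of_le h2] at h4
      exact hB h4.symm
    · rfl

end IsLGS

namespace FormalSystem

variable {k : Type u} {O : Type v} [Field k] [CommRing O] [IsLocalRing O] [Algebra k O]

/-- By existence and uniqueness of expansions the relation in the definition is the graph of a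
linear map, which removes the quantification over expansions from `muP` and `muD`. -/
theorem isConstTerm_iff (S : FormalSystem k O) (H : IsLGS S.q S.h) (f c₀ : S.Ring) :
    S.IsConstTerm f c₀ ↔ c₀ = constTerm H f := by
  classical
  have hE := prod_sub_monomial_mem H.congr
  constructor
  · rintro ⟨c, ⟨hc, hc'⟩, rfl⟩
    have h1 : basisMap (lgsBasis S.q S.h) (ofCoeff fun α => coeff (digits S.q α) (c (carries S.q α))) = f := by
      rw [← sub_eq_zero]
      refine eq_zero_of_forall_mem_maximalIdeal_pow _ fun N => ?_
      have := Ideal.sub_mem _ (H.expansion_sub_mem c hc N) (hc' N)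
      rwa [sub_sub_sub_cancel_right] at this
    rw [H.constTerm_apply, ← h1, symm_basisMap]
    ext α
    rw [coeff_smallPart, coeff_ofCoeff]
    split_ifs with h2
    · have h3 := h2.digits_add (0 : Fin S.t → ℕ)
      have h4 := h2.carries_add (0 : Fin S.t → ℕ)
      rw [scaled_zero, add_zero] at h3 h4
      rw [h3, h4]
    · by_contra h3
      exact h2 (hc 0 α h3)
  · rintro rfl
    set a := (basisEquiv hE).symm f with ha
    let c : (Fin S.t → ℕ) → S.Ring := fun B => ofCoeff fun κ =>
      if IsSmall S.q κ then coeff (κ + scaled (Fin S.r) S.q B) a else 0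
    have hc : ∀ B α, coeff α (c B) ≠ 0 → IsSmall S.q α := by
      intro B α h1
      by_contra h2
      exact h1 (if_neg h2)
    refine ⟨c, ⟨hc, fun N => ?_⟩, ?_⟩
    · have h1 := H.expansion_sub_mem c hc N
      have h2 : (ofCoeff fun α => coeff (digits S.q α) (c (carries S.q α)) : S.Ring) = a := by
        ext α
        rw [coeff_ofCoeff]
        change (if IsSmall S.q (digits S.q α) then _ else _) = _
        rw [if_pos (isSmall_digits H.pos α), digits_add_scaled]
      rwa [h2, ha, basisMap_symm] at h1
    · rw [H.constTerm_apply]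
      ext α
      rw [coeff_smallPart]
      change (if IsSmall S.q α then coeff (α + scaled (Fin S.r) S.q 0) a else 0) = _
      rw [scaled_zero, add_zero]

theorem Heart.isLGS {S : FormalSystem k O} {R : IdealisticFiltration O} {young : Set (Ideal O)}
    (hS : S.Heart R young) : IsLGS S.q S.h :=
  ⟨fun _ => pow_pos (ringExpChar_pos k) _, hS.congr⟩

theorem Heart.isCoord {S : FormalSystem k O} {R : IdealisticFiltration O} {young : Set (Ideal O)}
    (hS : S.Heart R young) : IsCoord S.coord :=
  ⟨hS.completion.1, hS.completion.2⟩

end FormalSystem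

end Expansion

/-! ### The infima `μ_P` and `μ_{P,D}` are attained -/

section Valuations

open MvPowerSeries

theorem ENat.add_le_of_forall {a b c : ℕ∞} (h : ∀ m n : ℕ, (m : ℕ∞) ≤ a → (n : ℕ∞) ≤ b → ((m + n : ℕ) : ℕ∞) ≤ c) :
    a + b ≤ c := by
  refine ENat.forall_natCast_le_iff_le.1 fun n hn => ?_
  induction a using ENat.recTopCoe with
  | top => simpa using h n 0 le_top (by simp)
  | coe a =>
    induction b using ENat.recTopCoe with
    | top => simpa using h 0 n (by simp) le_top
    | coe b => exact hn.trans (by simpa using h a b le_rfl le_rfl)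

/-- A superadditive, valuation-like function that is at least `μ` times the level on generators is
so on everything they generate. -/
theorem IdealisticFiltration.mul_le_of_generators {A : Type*} [CommRing A] {G : Set (A × ℕ)} {u : A → ℝ≥0∞} (u0 : u 0 = ⊤)
    (uadd : ∀ f g, min (u f) (u g) ≤ u (f + g)) (umul : ∀ f g, u f + u g ≤ u (f * g)) {μ : ℝ≥0∞}
    (hG : ∀ f a, (f, a) ∈ G → μ * (a : ℕ) ≤ u f) {f : A} {a : ℕ} (hf : f ∈ (generate G).ideal a) :
    μ * (a : ℕ) ≤ u f := by
  induction (hf : Generated A G f a) with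
  | of h => exact hG _ _ h
  | one => simp
  | zero γ => rw [u0]; exact le_top
  | add h1 h2 ih1 ih2 => exact (le_min ih1 ih2).trans (uadd _ _)
  | smul r h1 ih1 => exact ih1.trans (le_add_self.trans (umul _ _))
  | mul h1 h2 ih1 ih2 =>
    refine le_trans ?_ (umul _ _)
    push_cast
    rw [mul_add]
    exact add_le_add ih1 ih2
  | lower hle h1 ih1 =>
    refine le_trans ?_ ih1
    gcongr

/-- The smallest of the finitely many ratios on generators of positive level bounds all ratios from
below, so the infimum is attained; the other alternative is that all values are infinite. -/
theorem IdealisticFiltration.IsFinGen.exists_min {A : Type*} [CommRing A] {R : IdealisticFiltration A} (hR : R.IsFinGen)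
    {u : A → ℝ≥0∞} (u0 : u 0 = ⊤) (uadd : ∀ f g, min (u f) (u g) ≤ u (f + g))
    (umul : ∀ f g, u f + u g ≤ u (f * g)) :
    (∀ a : ℕ, 0 < a → ∀ f ∈ R.ideal a, u f = ⊤) ∨ ∃ a : ℕ, 0 < a ∧ ∃ f ∈ R.ideal a, u f ≠ ⊤ ∧
      ∀ b : ℕ, 0 < b → ∀ g ∈ R.ideal b, u f / a ≤ u g / b := by
  obtain ⟨G, hG, rfl⟩ := hR
  by_cases h : ∀ g b, (g, b) ∈ G → 0 < b → u g = ⊤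
  · left
    intro a ha f hf
    have := mul_le_of_generators u0 uadd umul (μ := ⊤) (fun g b hg => by
      rcases Nat.eq_zero_or_pos b with rfl | hb
      · simp
      · rw [h g b hg hb]; exact le_top) hf
    rw [ENNReal.top_mul (by exact_mod_cast ha.ne'), top_le_iff] at this
    exact this
  · push Not at h
    obtain ⟨g, b, hg, hb, hu⟩ := h
    obtain ⟨⟨f, a⟩, ⟨hf, ha⟩, hmin⟩ := Set.exists_min_image {p ∈ G | 0 < p.2}
      (fun p => u p.1 / (p.2 : ℝ≥0∞)) (hG.subset fun p hp => hp.1) ⟨(g, b), hg, hb⟩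
    right
    have hne : ∀ {b : ℕ}, 0 < b → (b : ℝ≥0∞) ≠ 0 := fun hb => by exact_mod_cast hb.ne'
    refine ⟨a, ha, f, subset_generate hf, ?_, ?_⟩
    · intro htop
      have h1 := hmin (g, b) ⟨hg, hb⟩
      simp only [htop] at h1
      rw [ENNReal.top_div_of_ne_top (ENNReal.natCast_ne_top a), top_le_iff] at h1
      exact ENNReal.div_ne_top hu (hne hb) h1
    · intro b hb g hg
      rw [ENNReal.le_div_iff_mul_le (Or.inl (hne hb)) (Or.inl (ENNReal.natCast_ne_top b))]
      refine mul_le_of_generators u0 uadd umul (fun g' b' hg' => ?_) hg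
      rcases Nat.eq_zero_or_pos b' with rfl | hb'
      · simp
      · rw [← ENNReal.le_div_iff_mul_le (Or.inl (hne hb')) (Or.inl (ENNReal.natCast_ne_top b'))]
        exact hmin (g', b') ⟨hg', hb'⟩

namespace FormalSystem

variable {k : Type u} {O : Type v} [Field k] [CommRing O] [IsLocalRing O] [Algebra k O]
  (S : FormalSystem k O) (H : IsLGS S.q S.h)

theorem muP_eq (R : IdealisticFiltration O) : S.muP R =
    ⨅ (a : ℕ) (_ : 0 < a) (f : O) (_ : f ∈ R.ideal a),
      ((constTerm H (S.coord f)).order : ℝ≥0∞) / (a : ℝ≥0∞) := by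
  simp only [muP, S.isConstTerm_iff H, iInf_iInf_eq_left]

theorem muD_eq (R : IdealisticFiltration O) (j : Fin S.r) : S.muD R j =
    ⨅ (a : ℕ) (_ : 0 < a) (f : O) (_ : f ∈ R.ideal a),
      ((emultiplicity (S.x (Sum.inr j)) (constTerm H (S.coord f)) : ℕ∞) : ℝ≥0∞) / (a : ℝ≥0∞) := by
  simp only [muD, S.isConstTerm_iff H, iInf_iInf_eq_left]

theorem muP_le {R : IdealisticFiltration O} {a : ℕ} (ha : 0 < a) {f : O} (hf : f ∈ R.ideal a) :
    S.muP R ≤ ((constTerm H (S.coord f)).order : ℝ≥0∞) / (a : ℝ≥0∞) := by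
  rw [S.muP_eq H]
  exact iInf₂_le_of_le a ha (iInf₂_le f hf)

theorem muD_le {R : IdealisticFiltration O} {a : ℕ} (ha : 0 < a) {f : O} (hf : f ∈ R.ideal a)
    (j : Fin S.r) : S.muD R j ≤
      ((emultiplicity (S.x (Sum.inr j)) (constTerm H (S.coord f)) : ℕ∞) : ℝ≥0∞) / (a : ℝ≥0∞) := by
  rw [S.muD_eq H]
  exact iInf₂_le_of_le a ha (iInf₂_le f hf)

theorem order_constTerm_mul (f g : S.Ring) :
    (constTerm H f).order + (constTerm H g).order ≤ (constTerm H (f * g)).order := by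
  refine ENat.add_le_of_forall fun m n hm hn => ?_
  rw [← mem_maximalIdeal_pow_iff_le_order] at hm hn ⊢
  exact H.constTerm_mul_mem hm hn

theorem emultiplicity_constTerm_mul (j : Fin S.r) (f g : S.Ring) :
    emultiplicity (S.x (Sum.inr j)) (constTerm H f) + emultiplicity (S.x (Sum.inr j)) (constTerm H g) ≤
      emultiplicity (S.x (Sum.inr j)) (constTerm H (f * g)) := by
  refine ENat.add_le_of_forall fun m n hm hn => ?_
  rw [← pow_dvd_iff_le_emultiplicity] at hm hn ⊢
  exact H.X_pow_dvd_constTerm_mul hm hn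

theorem exists_muP {R : IdealisticFiltration O} (hR : R.IsFinGen) (htop : S.muP R ≠ ⊤) :
    ∃ a : ℕ, 0 < a ∧ ∃ f ∈ R.ideal a, (constTerm H (S.coord f)).order ≠ ⊤ ∧
      S.muP R = ((constTerm H (S.coord f)).order : ℝ≥0∞) / (a : ℝ≥0∞) := by
  rcases hR.exists_min (u := fun f => ((constTerm H (S.coord f)).order : ℝ≥0∞)) (by simp)
    (fun f g => by
      rw [map_add, map_add, ← ENat.toENNReal_min, ENat.toENNReal_le]; exact min_order_le_add)
    (fun f g => by
      rw [map_mul, ← ENat.toENNReal_add, ENat.toENNReal_le]; exact S.order_constTerm_mul H _ _) with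
    h | ⟨a, ha, f, hf, hne, hmin⟩
  · refine absurd ?_ htop
    rw [S.muP_eq H]
    simp only [iInf_eq_top]
    intro a ha f hf
    rw [h a ha f hf]
    exact ENNReal.top_div_of_ne_top (ENNReal.natCast_ne_top a)
  · refine ⟨a, ha, f, hf, by simpa using hne, le_antisymm (S.muP_le H ha hf) ?_⟩
    rw [S.muP_eq H]
    exact le_iInf₂ fun b hb => le_iInf₂ fun g hg => hmin b hb g hg

include H in
-- Rationality is what matters here: a power of the monomial `M` then has integral exponents.
theorem exists_muD {R : IdealisticFiltration O} (hR : R.IsFinGen) (j : Fin S.r) (htop : S.muD R j ≠ ⊤) :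
    ∃ a : ℕ, 0 < a ∧ ∃ m : ℕ, S.muD R j = (m : ℝ≥0∞) / (a : ℝ≥0∞) := by
  rcases hR.exists_min
    (u := fun f => ((emultiplicity (S.x (Sum.inr j)) (constTerm H (S.coord f)) : ℕ∞) : ℝ≥0∞)) (by simp)
    (fun f g => by
      rw [map_add, map_add, ← ENat.toENNReal_min, ENat.toENNReal_le]; exact min_le_emultiplicity_add)
    (fun f g => by
      rw [map_mul, ← ENat.toENNReal_add, ENat.toENNReal_le]
      exact S.emultiplicity_constTerm_mul H _ _ _) with
    h | ⟨a, ha, f, hf, hne, hmin⟩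
  · refine absurd ?_ htop
    rw [S.muD_eq H]
    simp only [iInf_eq_top]
    intro a ha f hf
    rw [h a ha f hf]
    exact ENNReal.top_div_of_ne_top (ENNReal.natCast_ne_top a)
  · obtain ⟨m, hm⟩ := ENat.ne_top_iff_exists.1
      (show emultiplicity (S.x (Sum.inr j)) (constTerm H (S.coord f)) ≠ ⊤ by simpa using hne)
    refine ⟨a, ha, m, ?_⟩
    have h1 : S.muD R j = ((emultiplicity (S.x (Sum.inr j)) (constTerm H (S.coord f)) : ℕ∞) : ℝ≥0∞) / a := by
      refine le_antisymm (S.muD_le H ha hf j) ?_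
      rw [S.muD_eq H]
      exact le_iInf₂ fun b hb => le_iInf₂ fun g hg => hmin b hb g hg
    rw [h1, ← hm, ENat.toENNReal_coe]

end FormalSystem

end Valuations

/-! ### The new element of the companion modification -/

section NewElement

open MvPowerSeries

theorem coe_le_pow_X_dvd_iff {k V : Type*} [Field k] {δ : V →₀ ℕ} {F : MvPowerSeries V k}
    (h : ∀ j, X j ^ δ j ∣ F) (β : V →₀ ℕ) (hβ : coeff β F ≠ 0) : δ ≤ β := by
  intro j
  by_contra hn
  exact hβ (X_pow_dvd_iff.1 (h j) β (by omega))

theorem exists_eq_monomial_mul {k V : Type*} [Field k] {δ : V →₀ ℕ} {F : MvPowerSeries V k}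
    (h : ∀ j, X j ^ δ j ∣ F) :
    ∃ G : MvPowerSeries V k, F = monomial δ 1 * G ∧ ∀ α, coeff α G = coeff (α + δ) F := by
  classical
  refine ⟨ofCoeff fun α => coeff (α + δ) F, ?_, fun α => rfl⟩
  ext β
  rw [coeff_monomial_mul]
  split_ifs with h1
  · rw [one_mul, coeff_ofCoeff, tsub_add_cancel_of_le h1]
  · by_contra h2
    exact h1 (coe_le_pow_X_dvd_iff h β h2)

namespace FormalSystem

variable {k : Type u} {O : Type v} [Field k] [CommRing O] [IsLocalRing O] [Algebra k O]
  {S : FormalSystem k O} {R : IdealisticFiltration O} {young : Set (Ideal O)}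

theorem mem_companionQ₂_of_op {w w' : S.GenRing} {l : ℝ≥0} {n : ℕ} {δ : S.Ring →ₗ[k] S.Ring}
    (hw : (w, l) ∈ S.companionQ₁ R young) (hδ : S.IsLogDiffOp young n δ)
    (hw' : ∀ γ, w'.coeff γ = δ (w.coeff γ)) : (w', l - n) ∈ S.companionQ₂ R young :=
  Generated.of ⟨w, l, n, δ, hw, hδ, hw', rfl⟩

theorem companionQ₂_pow {w : S.GenRing} {l : ℝ≥0} (h : (w, l) ∈ S.companionQ₂ R young) (n : ℕ) :
    (w ^ n, n • l) ∈ S.companionQ₂ R young := by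
  induction n with
  | zero => rw [pow_zero, zero_smul]; exact Generated.one
  | succ n ih =>
    have h1 : Generated S.Ring _ (w ^ n) (n • l) := ih
    have h2 : Generated S.Ring _ w l := h
    rw [pow_succ, succ_nsmul]
    exact h1.mul h2

theorem isLogDiffOp_id : S.IsLogDiffOp young 0 LinearMap.id :=
  ⟨IsDiffOp.id, fun _ _ _ _ h => h⟩

theorem isLogDiffOp_hasse {K : Fin S.t ⊕ Fin S.r →₀ ℕ} (hK : ∀ j, K (Sum.inr j) = 0) :
    S.IsLogDiffOp young K.degree (hasse K) := by
  refine ⟨isDiffOp_iff_isDiffAlong.2 (isDiffAlong_hasse K), fun j _ m f hf => ?_⟩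
  rw [x, X_pow_dvd_iff] at hf ⊢
  intro α hα
  rw [coeff_hasse, hf (α + K) (by rw [Finsupp.add_apply, hK]; omega), mul_zero]

theorem coord_mem_formalCompanion {f : O} {a : ℕ} (hf : f ∈ R.ideal a) :
    S.coord f ∈ (S.formalCompanion R young).ideal a := by
  refine IdealisticFiltration.subset_generate ⟨AddMonoidAlgebra.single 0 (S.coord f), ?_, ?_⟩
  · have h1 : (AddMonoidAlgebra.single 0 (S.coord f), (a : ℝ≥0)) ∈ S.companionQ₁ R young :=
      Generated.of (Or.inl ⟨a, f, hf, rfl⟩)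
    have := mem_companionQ₂_of_op
      (w' := AddMonoidAlgebra.single (0 : Fin S.t ⊕ Fin S.r → ℝ) (S.coord f)) h1 isLogDiffOp_id
      (fun γ => rfl)
    simpa using this
  · rw [ruc, AddMonoidAlgebra.coeff_single, Finsupp.sum_single_index] <;> simp

theorem le_of_isCompanion [IsNoetherianRing O] (hc : IsCoord S.coord) {K : IdealisticFiltration O}
    (hK : S.IsCompanion R young K) (a : ℕ) : R.ideal a ≤ K.ideal a := by
  intro f hf
  refine hc.comap_map (K.ideal a) ?_
  have h1 : (S.complete K).ideal a = (K.ideal a).map S.coord := rfl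
  have h2 := coord_mem_formalCompanion (S := S) (young := young) hf
  rw [← hK, h1] at h2
  exact h2

open Classical in
/-- The exponent with value `M j` at the young components. -/
noncomputable def youngExponent (S : FormalSystem k O) (young : Set (Ideal O)) (M : Fin S.r → ℕ) :
    Fin S.t ⊕ Fin S.r →₀ ℕ :=
  Finsupp.equivFunOnFinite.symm (Sum.elim (fun _ => 0) fun j => if j ∈ S.youngIndex young then M j else 0)

theorem youngExponent_inl (M : Fin S.r → ℕ) (i : Fin S.t) :
    S.youngExponent young M (Sum.inl i) = 0 := rfl

open Classical in
theorem youngExponent_inr (M : Fin S.r → ℕ) (j : Fin S.r) :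
    S.youngExponent young M (Sum.inr j) = if j ∈ S.youngIndex young then M j else 0 := rfl

theorem degree_youngExponent (M : Fin S.r → ℕ) :
    (S.youngExponent young M).degree = ∑ j ∈ S.youngIndex young, M j := by
  classical
  rw [Finsupp.degree_eq_sum, Fintype.sum_sum_type]
  simp only [youngExponent_inl, youngExponent_inr, Finset.sum_const_zero, zero_add]
  rw [Finset.sum_ite_mem, Finset.univ_inter]

/-- An element at an integral level of the companion algebra, obtained by dividing `F` by a monomial
in the young components. -/
theorem exists_mem_formalCompanion {F : S.Ring} {L : ℕ} (M : Fin S.r → ℕ)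
    {γ : Fin S.t ⊕ Fin S.r → ℝ} (hγ : ∀ i, γ i = -(S.youngExponent young M i : ℝ))
    (hF : (AddMonoidAlgebra.single γ F, (L : ℝ≥0)) ∈ S.companionQ₂ R young)
    (hdvd : ∀ j ∈ S.youngIndex young, S.x (Sum.inr j) ^ M j ∣ F)
    (hmem : F ∈ maximalIdeal S.Ring ^ (L + ∑ j ∈ S.youngIndex young, M j))
    (hne : leadPoly (L + ∑ j ∈ S.youngIndex young, M j) F ≠ 0)
    (hsmall : ∀ α, (leadPoly (L + ∑ j ∈ S.youngIndex young, M j) F).coeff α ≠ 0 → IsSmall S.q α) :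
    ∃ G ∈ (S.formalCompanion R young).ideal L, G ∈ maximalIdeal S.Ring ^ L ∧ leadPoly L G ≠ 0 ∧
      ∀ α, (leadPoly L G).coeff α ≠ 0 → IsSmall S.q α := by
  classical
  set δ := S.youngExponent young M with hδ
  have hdeg : δ.degree = ∑ j ∈ S.youngIndex young, M j := degree_youngExponent M
  rw [← hdeg] at hmem hne hsmall
  have hd : ∀ i, X i ^ δ i ∣ F := by
    rintro (i | j)
    · rw [hδ, youngExponent_inl, pow_zero]; exact one_dvd _
    · rw [hδ, youngExponent_inr]
      split_ifs with h
      · exact hdvd j h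
      · rw [pow_zero]; exact one_dvd _
  obtain ⟨G, hFG, hG⟩ := exists_eq_monomial_mul hd
  refine ⟨G, IdealisticFiltration.subset_generate ⟨_, hF, ?_⟩, ?_, ?_, ?_⟩
  · have hx : ∀ i, algebraMap S.Ring (FractionRing S.Ring) (S.x i) ≠ 0 := by
      intro i h
      have := (IsFractionRing.injective S.Ring (FractionRing S.Ring)) (h.trans (map_zero _).symm)
      have h2 := congrArg (coeff (Finsupp.single i 1)) this
      rw [x, coeff_index_single_self_X, map_zero] at h2
      exact one_ne_zero h2
    have hmon : (monomial δ (1 : k) : S.Ring) = ∏ i, S.x i ^ δ i := by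
      have h1 : ∀ i, S.x i ^ δ i = ((MvPolynomial.X i ^ δ i : MvPolynomial _ k) : S.Ring) := by
        intro i; simp [x]
      simp_rw [h1]
      rw [← MvPolynomial.coe_monomial, MvPolynomial.monomial_eq, map_one, one_mul,
        Finsupp.prod_fintype _ _ (by simp)]
      exact map_prod (MvPolynomial.coeToMvPowerSeries.ringHom (σ := Fin S.t ⊕ Fin S.r) (R := k)) _ _
    rw [ruc, AddMonoidAlgebra.coeff_single, Finsupp.sum_single_index (by simp), hFG, hmon, map_mul,
      map_prod]
    have h2 : ∀ i, ⌈γ i⌉ = -(δ i : ℤ) := by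
      intro i; rw [hγ, Int.ceil_neg, Int.floor_natCast]
    simp only [h2, zpow_neg, zpow_natCast, map_pow]
    rw [mul_comm (∏ i, _) (algebraMap _ _ G), mul_assoc, ← Finset.prod_mul_distrib,
      Finset.prod_eq_one fun i _ => mul_inv_cancel₀ (pow_ne_zero _ (hx i)), mul_one]
  · rw [mem_maximalIdeal_pow_iff] at hmem ⊢
    intro α hα
    rw [hG]
    exact hmem _ (by rw [map_add]; omega)
  · intro h0
    apply hne
    ext β
    rw [coeff_leadPoly]
    split_ifs with h1
    · by_contra h2
      have h3 := coe_le_pow_X_dvd_iff hd β h2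
      obtain ⟨α, rfl⟩ := exists_add_of_le h3
      rw [map_add] at h1
      have h4 : (leadPoly L G).coeff α = coeff (α + δ) F := by
        rw [coeff_leadPoly_of_eq _ (by omega), hG]
      rw [h0, add_comm α] at h4
      exact h2 h4.symm
    · rfl
  · intro α hα
    have hdα : α.degree = L := by
      by_contra h1
      exact hα (coeff_leadPoly_of_ne _ h1)
    rw [coeff_leadPoly_of_eq _ hdα, hG] at hα
    have h1 := hsmall (α + δ) (by rwa [coeff_leadPoly_of_eq _ (by rw [map_add]; omega)])
    intro i
    have := h1 i
    rwa [Finsupp.add_apply, hδ, youngExponent_inl, add_zero] at this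

/-- The constant term `c` that computes `μ_P`, divided by `M^a`, has exactly the order `μ̃ a` that
its level demands, but level and exponents may be fractional. A power would clear the denominators
and destroy the smallness of the exponents of `x_1, …, x_t`, so these variables are first removed by
a derivative. This is possible unless the derivative uses up the whole level, and in that case
everything is integral from the start. -/
theorem exists_new_element (H : IsLGS S.q S.h) (hR : R.IsFinGen) (hmu0 : S.muTilde R young ≠ 0)
    (hmutop : S.muTilde R young ≠ ⊤) :
    ∃ L, 0 < L ∧ ∃ G ∈ (S.formalCompanion R young).ideal L, G ∈ maximalIdeal S.Ring ^ L ∧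
      leadPoly L G ≠ 0 ∧ ∀ α, (leadPoly L G).coeff α ≠ 0 → IsSmall S.q α := by
  classical
  have hP : S.muP R ≠ ⊤ := by
    intro h; exact hmutop (by rw [muTilde, if_pos h])
  obtain ⟨a, ha, f, hf, hord, hPf⟩ := S.exists_muP H hR hP
  set c := constTerm H (S.coord f) with hc
  obtain ⟨n, hn⟩ := ENat.ne_top_iff_exists.1 hord
  have haR : (0 : ℝ) < a := by exact_mod_cast ha
  have hcm : c ∈ maximalIdeal S.Ring ^ n := by
    rw [mem_maximalIdeal_pow_iff_le_order, hn]
  have hcl : leadPoly n c ≠ 0 := by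
    rw [Ne, leadPoly_eq_zero_iff hcm, mem_maximalIdeal_pow_iff_le_order, ← hn, not_le]
    exact_mod_cast Nat.lt_succ_self n
  -- the multiplicities along the young components
  have hDle : ∀ j, S.muD R j ≤ ((emultiplicity (S.x (Sum.inr j)) c : ℕ∞) : ℝ≥0∞) / (a : ℝ≥0∞) :=
    fun j => S.muD_le H ha hf j
  have hmult : ∀ j, emultiplicity (S.x (Sum.inr j)) c ≠ ⊤ := by
    intro j hj
    apply hcl
    refine leadPoly_of_mem ?_
    have h1 : S.x (Sum.inr j) ^ (n + 1) ∣ c := by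
      rw [pow_dvd_iff_le_emultiplicity, hj]; exact le_top
    obtain ⟨g, hg⟩ := h1
    rw [hg]
    exact Ideal.mul_mem_right _ _ (Ideal.pow_mem_pow (X_mem_maximalIdeal _) _)
  have hDtop : ∀ j, S.muD R j ≠ ⊤ := by
    intro j hj
    have h1 := hDle j
    rw [hj, top_le_iff] at h1
    exact ENNReal.div_ne_top (by simpa using hmult j) (by exact_mod_cast ha.ne') h1
  choose b hb m hbm using fun j => S.exists_muD H hR j (hDtop j)
  set d : Fin S.r → ℝ := fun j => (S.muD R j).toReal with hd
  have hdb : ∀ j, d j * b j = m j := by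
    intro j
    have : (b j : ℝ) ≠ 0 := by exact_mod_cast (hb j).ne'
    rw [hd]
    simp only [hbm, ENNReal.toReal_div, ENNReal.toReal_natCast]
    field_simp
  have hd0 : ∀ j, 0 ≤ d j := fun j => ENNReal.toReal_nonneg
  have hceil : ∀ j, S.x (Sum.inr j) ^ ⌈d j * a⌉₊ ∣ c := by
    intro j
    obtain ⟨m', hm'⟩ := ENat.ne_top_iff_exists.1 (hmult j)
    rw [pow_dvd_iff_le_emultiplicity, ← hm', Nat.cast_le, Nat.ceil_le]
    have h1 := hDle j
    rw [← hm', ENat.toENNReal_coe] at h1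
    have h2 := ENNReal.toReal_mono (ENNReal.div_ne_top (ENNReal.natCast_ne_top m')
      (by exact_mod_cast ha.ne')) h1
    rw [ENNReal.toReal_div, ENNReal.toReal_natCast, ENNReal.toReal_natCast, le_div_iff₀ haR] at h2
    exact h2
  -- the real value of the weak order
  have hmu : S.muTilde R young = S.muP R - ∑ j ∈ S.youngIndex young, S.muD R j := by
    rw [muTilde, if_neg hP]
  have hsumtop : ∑ j ∈ S.youngIndex young, S.muD R j ≠ ⊤ := ENNReal.sum_ne_top.2 fun j _ => hDtop j
  have hmuR : (S.muTilde R young).toReal = n / a - ∑ j ∈ S.youngIndex young, d j := by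
    have hle : ∑ j ∈ S.youngIndex young, S.muD R j ≤ S.muP R := by
      by_contra h
      exact hmu0 (by rw [hmu]; exact tsub_eq_zero_of_le (not_le.1 h).le)
    rw [hmu, ENNReal.toReal_sub_of_le hle hP, ENNReal.toReal_sum fun j _ => hDtop j, hPf, ← hn,
      ENat.toENNReal_coe, ENNReal.toReal_div, ENNReal.toReal_natCast, ENNReal.toReal_natCast]
  have hmupos : 0 < (S.muTilde R young).toReal := ENNReal.toReal_pos hmu0 hmutop
  set lv : ℝ≥0 := (S.muTilde R young * (a : ℝ≥0∞)).toNNReal with hlv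
  have hlvR : (lv : ℝ) = n - ∑ j ∈ S.youngIndex young, d j * a := by
    rw [hlv, ENNReal.toNNReal_mul, NNReal.coe_mul, ENNReal.toNNReal_natCast]
    change (S.muTilde R young).toReal * (a : ℝ) = _
    rw [hmuR, sub_mul, Finset.sum_mul, div_mul_cancel₀ _ haR.ne']
  have hlvpos : (0 : ℝ) < lv := by
    rw [hlv, ENNReal.toNNReal_mul, NNReal.coe_mul, ENNReal.toNNReal_natCast]
    exact mul_pos hmupos haR
  have hQ₁ : (AddMonoidAlgebra.single (S.invMonomial R young a) c, lv) ∈ S.companionQ₁ R young :=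
    Generated.of (Or.inr ⟨a, f, c, hf, (S.isConstTerm_iff H _ _).2 rfl, rfl⟩)
  -- a monomial of the leading form with the highest degree in the first variables
  let dinl : (Fin S.t ⊕ Fin S.r →₀ ℕ) → ℕ := fun γ => ∑ i, γ (Sum.inl i)
  obtain ⟨γ, hγ, hγmax⟩ := Finset.exists_max_image (leadPoly n c).support dinl
    (by rwa [Finset.nonempty_iff_ne_empty, Ne, MvPolynomial.support_eq_empty])
  have hγc : (leadPoly n c).coeff γ ≠ 0 := MvPolynomial.mem_support_iff.1 hγ
  have hγd : γ.degree = n := by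
    by_contra h
    exact hγc (coeff_leadPoly_of_ne _ h)
  rw [coeff_leadPoly_of_eq _ hγd] at hγc
  -- `K` is the part of `γ` in `x_1, …, x_t`; `D_K` does not involve the variables of the young
  -- components, so it is logarithmic.
  set K : Fin S.t ⊕ Fin S.r →₀ ℕ := Finsupp.equivFunOnFinite.symm
    (Sum.elim (fun i => γ (Sum.inl i)) fun _ => 0) with hK
  have hKinl : ∀ i, K (Sum.inl i) = γ (Sum.inl i) := fun i => rfl
  have hKinr : ∀ j, K (Sum.inr j) = 0 := fun j => rfl
  have hKd : K.degree = dinl γ := by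
    rw [Finsupp.degree_eq_sum, Fintype.sum_sum_type]
    simp [hKinl, hKinr, dinl]
  have hγn : K.degree + ∑ j, γ (Sum.inr j) = n := by
    rw [hKd, ← hγd, Finsupp.degree_eq_sum γ, Fintype.sum_sum_type]
  have hγceil : ∀ j, ⌈d j * a⌉₊ ≤ γ (Sum.inr j) := by
    intro j
    by_contra h
    exact hγc (X_pow_dvd_iff.1 (hceil j) γ (by omega))
  have hsum1 : ∑ j ∈ S.youngIndex young, ⌈d j * a⌉₊ ≤ ∑ j, γ (Sum.inr j) :=
    (Finset.sum_le_sum fun j _ => hγceil j).trans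
      (Finset.sum_le_sum_of_subset (Finset.subset_univ _))
  have hsum2 : ∑ j ∈ S.youngIndex young, d j * a ≤ ∑ j ∈ S.youngIndex young, (⌈d j * a⌉₊ : ℝ) :=
    Finset.sum_le_sum fun j _ => Nat.le_ceil _
  have hcsmall : ∀ α, coeff α c ≠ 0 → IsSmall S.q α := fun α hα => H.coeff_constTerm hα
  have hγnR : (K.degree : ℝ) + ∑ j, (γ (Sum.inr j) : ℝ) = n := by exact_mod_cast hγn
  have hsum1R : ∑ j ∈ S.youngIndex young, (⌈d j * a⌉₊ : ℝ) ≤ ∑ j, (γ (Sum.inr j) : ℝ) := by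
    exact_mod_cast hsum1
  -- The rest of `γ` has degree `n - |K|`, and it contains the powers `⌈d j * a⌉` of the young
  -- variables, which divide `c`.
  have hKle : (K.degree : ℝ) ≤ lv := by rw [hlvR]; linarith
  rcases hKle.lt_or_eq with hlt | heq
  · -- a power of a derivative of the constant term
    -- `N` is a common denominator of the `μ_{P,D}`, so that `M^{aN}` has integral exponents.
    set N := ∏ j, b j with hN
    have hNpos : 0 < N := Finset.prod_pos fun j _ => hb j
    have hM : ∀ j, ∃ M : ℕ, (M : ℝ) = N * (d j * a) := by
      intro j
      obtain ⟨b', hb'⟩ : b j ∣ N := Finset.dvd_prod_of_mem _ (Finset.mem_univ j)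
      refine ⟨m j * b' * a, ?_⟩
      rw [hb']
      push_cast
      rw [← hdb j]; ring
    choose M hM using hM
    have hlvK : ((lv - (K.degree : ℝ≥0) : ℝ≥0) : ℝ) = lv - K.degree := by
      rw [NNReal.coe_sub (by exact_mod_cast hKle)]; simp
    have hLR : (N : ℝ) * (lv - K.degree) =
        ((N * n : ℤ) - ∑ j ∈ S.youngIndex young, (M j : ℤ) - N * K.degree : ℤ) := by
      push_cast
      simp_rw [hM]
      rw [hlvR, ← Finset.mul_sum]
      ring
    obtain ⟨L, hL⟩ : ∃ L : ℕ, ((N * n : ℤ) - ∑ j ∈ S.youngIndex young, (M j : ℤ) - N * K.degree : ℤ) = L := by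
      refine Int.eq_ofNat_of_zero_le ?_
      have h1 : (0 : ℝ) ≤ (N : ℝ) * (lv - K.degree) :=
        mul_nonneg (Nat.cast_nonneg _) (sub_nonneg.2 hKle)
      rw [hLR] at h1
      exact_mod_cast h1
    have hLpos : 0 < L := by
      have h1 : (0 : ℝ) < (N : ℝ) * (lv - K.degree) :=
        mul_pos (by exact_mod_cast hNpos) (sub_pos.2 hlt)
      rw [hLR, hL] at h1
      exact_mod_cast h1
    have hKn : K.degree ≤ n := by omega
    have hLdeg : L + ∑ j ∈ S.youngIndex young, M j = (n - K.degree) * N := by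
      zify [hKn]
      rw [← hL]; ring
    have hDm : hasse K c ∈ maximalIdeal S.Ring ^ (n - K.degree) := hasse_mem_pow hcm
    -- A variable `x_i`, `i ≤ t`, left in the initial form of `D_K c` would come from a monomial of
    -- `c` of larger degree in these variables than `γ`.
    have hDcoeff : ∀ α, (leadPoly (n - K.degree) (hasse K c)).coeff α ≠ 0 →
        ∀ i, α (Sum.inl i) = 0 := by
      intro α hα
      have hαd : α.degree = n - K.degree := by
        by_contra h
        exact hα (coeff_leadPoly_of_ne _ h)
      rw [coeff_leadPoly_of_eq _ hαd, coeff_hasse] at hα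
      have h1 := right_ne_zero_of_mul hα
      have h2 : α + K ∈ (leadPoly n c).support := by
        rw [MvPolynomial.mem_support_iff]
        rw [show MvPolynomial.coeff (α + K) (leadPoly n c) = coeff (α + K) c from
          coeff_leadPoly_of_eq _ (by rw [map_add]; omega)]
        exact h1
      have h3 := hγmax _ h2
      have h4 : dinl (α + K) = dinl α + dinl γ := by
        simp [dinl, hKinl, Finset.sum_add_distrib]
      have h5 : dinl α = 0 := by omega
      intro i
      exact Finset.sum_eq_zero_iff.1 h5 i (Finset.mem_univ i)
    have hDne : leadPoly (n - K.degree) (hasse K c) ≠ 0 := by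
      have hKγ : K ≤ γ := by
        rintro (i | j)
        · exact le_of_eq (hKinl i)
        · rw [hKinr]; exact Nat.zero_le _
      intro h0
      -- The binomial coefficient is `1` because `K` agrees with `γ` wherever it is nonzero, so
      -- nothing is lost in characteristic `p`.
      have h1 : (leadPoly (n - K.degree) (hasse K c)).coeff (γ - K) = coeff γ c := by
        have hdeg : (γ - K).degree = n - K.degree := by
          have := congrArg Finsupp.degree (tsub_add_cancel_of_le hKγ)
          rw [map_add] at this
          omega
        rw [coeff_leadPoly_of_eq _ hdeg, coeff_hasse, tsub_add_cancel_of_le hKγ]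
        have : multiChoose γ K = 1 := by
          refine Finset.prod_eq_one fun i _ => ?_
          rcases i with i | j
          · rw [hKinl, Nat.choose_self]
          · rw [hKinr, Nat.choose_zero_right]
        rw [this, Nat.cast_one, one_mul]
      rw [h0] at h1
      exact hγc h1.symm
    have hpow : leadPoly ((n - K.degree) * N) (hasse K c ^ N) =
        leadPoly (n - K.degree) (hasse K c) ^ N := leadPoly_pow hDm N
    have hQ₂ := companionQ₂_pow (mem_companionQ₂_of_op
      (w' := AddMonoidAlgebra.single (S.invMonomial R young a) (hasse K c)) hQ₁
      (isLogDiffOp_hasse hKinr) (fun γ' => by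
        rw [AddMonoidAlgebra.coeff_single, AddMonoidAlgebra.coeff_single, Finsupp.single_apply,
          Finsupp.single_apply]
        split_ifs
        · rfl
        · rw [map_zero])) N
    rw [AddMonoidAlgebra.single_pow] at hQ₂
    have hlevel : N • (lv - (K.degree : ℝ≥0)) = (L : ℝ≥0) := by
      apply NNReal.coe_injective
      rw [nsmul_eq_mul, NNReal.coe_mul, hlvK, NNReal.coe_natCast, NNReal.coe_natCast, hLR, hL]
      simp
    rw [hlevel] at hQ₂
    refine ⟨L, hLpos, exists_mem_formalCompanion M ?_ hQ₂ ?_ ?_ ?_ ?_⟩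
    · rintro (i | j)
      · rw [youngExponent_inl]
        simp [invMonomial]
      · rw [youngExponent_inr]
        simp only [Pi.smul_apply, invMonomial, Sum.elim_inr]
        split_ifs
        · rw [hM, nsmul_eq_mul]; ring
        · simp
    · intro j _
      have h1 : M j ≤ ⌈d j * a⌉₊ * N := by
        have h2 : (M j : ℝ) ≤ ((⌈d j * a⌉₊ * N : ℕ) : ℝ) := by
          rw [hM]; push_cast
          rw [mul_comm]
          exact mul_le_mul_of_nonneg_right (Nat.le_ceil _) (Nat.cast_nonneg _)
        exact_mod_cast h2
      refine (pow_dvd_pow _ h1).trans ?_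
      rw [pow_mul]
      refine pow_dvd_pow_of_dvd ?_ N
      have h3 := hceil j
      rw [x, X_pow_dvd_iff] at h3 ⊢
      intro α hα
      rw [coeff_hasse, h3 (α + K) (by rw [Finsupp.add_apply, hKinr]; omega), mul_zero]
    · rw [hLdeg, pow_mul]
      exact Ideal.pow_mem_pow hDm N
    · rw [hLdeg, hpow]
      exact pow_ne_zero _ hDne
    · rw [hLdeg, hpow]
      intro α hα i
      have h1 : leadPoly (n - K.degree) (hasse K c) ∈
          MvPolynomial.supported k (Set.range (Sum.inr : Fin S.r → Fin S.t ⊕ Fin S.r)) := by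
        rw [MvPolynomial.mem_supported]
        rintro l hl
        rw [Finset.mem_coe, MvPolynomial.mem_vars_iff_mem_support] at hl
        obtain ⟨β, hβ, hl⟩ := hl
        rw [Finsupp.mem_support_iff] at hl
        rcases l with l | l
        · exact absurd (hDcoeff β (MvPolynomial.mem_support_iff.1 hβ) l) hl
        · exact ⟨l, rfl⟩
      have h2 := Subalgebra.pow_mem _ h1 N
      rw [MvPolynomial.mem_supported] at h2
      have h3 : α (Sum.inl i) = 0 := by
        by_contra h4
        obtain ⟨l, hl⟩ := h2 (Finset.mem_coe.2 (MvPolynomial.mem_vars_iff_mem_support _ |>.2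
          ⟨α, MvPolynomial.mem_support_iff.2 hα, Finsupp.mem_support_iff.2 h4⟩))
        cases hl
      rw [h3]
      exact H.pos i
  · -- the constant term itself
    -- Equality of `|K|` with the level leaves no room for rounding: the sums of the `d j * a` and
    -- of their ceilings agree.
    have hint : ∀ j ∈ S.youngIndex young, d j * a = (⌈d j * a⌉₊ : ℝ) := by
      refine (Finset.sum_eq_sum_iff_of_le fun j _ => Nat.le_ceil _).1 ?_
      rw [hlvR] at heq
      linarith
    have hQ₂ := mem_companionQ₂_of_op
      (w' := AddMonoidAlgebra.single (S.invMonomial R young a) c) hQ₁ isLogDiffOp_id (fun γ' => rfl)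
    have hlevel : lv - ((0 : ℕ) : ℝ≥0) = (K.degree : ℝ≥0) := by
      apply NNReal.coe_injective
      simp [← heq]
    rw [hlevel] at hQ₂
    have hdeg : K.degree + ∑ j ∈ S.youngIndex young, ⌈d j * a⌉₊ = n := by
      have h1 : (K.degree : ℝ) + ∑ j ∈ S.youngIndex young, (⌈d j * a⌉₊ : ℝ) = n := by
        rw [← Finset.sum_congr rfl hint, heq, hlvR]; ring
      exact_mod_cast h1
    refine ⟨K.degree, by exact_mod_cast heq ▸ hlvpos,
      exists_mem_formalCompanion (fun j => ⌈d j * a⌉₊) ?_ hQ₂ (fun j _ => hceil j) ?_ ?_ ?_⟩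
    · rintro (i | j)
      · rw [youngExponent_inl]
        simp [invMonomial]
      · rw [youngExponent_inr]
        simp only [invMonomial, Sum.elim_inr]
        split_ifs with h
        · rw [← hint j h]
        · simp
    · rwa [hdeg]
    · rwa [hdeg]
    · rw [hdeg]
      intro α hα
      have hαd : α.degree = n := by
        by_contra h
        exact hα (coeff_leadPoly_of_ne _ h)
      rw [coeff_leadPoly_of_eq _ hαd] at hα
      exact hcsmall α hα

end FormalSystem

end NewElement

/-! ### Elements outside of the leading algebra -/

section Separation

open MvPowerSeries

variable {k : Type u} {O : Type v} [Field k] [CommRing O] [IsLocalRing O] [Algebra k O]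

/-- Some element of `K` has order smaller than its level, or an initial form outside of the leading
algebra of the differential saturation of `R`. -/
def Separates (k : Type u) {O : Type v} [Field k] [CommRing O] [IsLocalRing O] [Algebra k O]
    (R K : IdealisticFiltration O) : Prop :=
  ∃ n, ∃ g ∈ K.ideal n, g ∈ maximalIdeal O ^ n →
    Ideal.Quotient.mk (maximalIdeal O ^ (n + 1)) g ∉ (R.diffSat k).leadingPart n

namespace FormalSystem

variable {S : FormalSystem k O} {R : IdealisticFiltration O} {young : Set (Ideal O)}

theorem Heart.isLeadForm (hS : S.Heart R young) :
    IsLeadForm (leadSub S.coord (R.diffSat k)) (fun i => Pi.single (Sum.inl i) (1 : k)) S.e := by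
  have h1 := (isCoord_id (k := k) (V := Fin S.t ⊕ Fin S.r)).hasLeadingForm_iff
    (S.complete (R.diffSat k)) (x := S.x) (e := S.e) fun i => X_mem_maximalIdeal _
  have h2 := h1.1 hS.leading
  refine ⟨(Pi.linearIndependent_single_one (Fin S.t ⊕ Fin S.r) k).comp _ Sum.inl_injective, h2.1, fun a => ?_⟩
  rw [← hS.isCoord.leadSub_map (R.diffSat k) a]
  have h3 := h2.2 a
  have h4 : (fun i => linPart (AlgHom.id k S.Ring (S.x (Sum.inl i)))) =
      fun i => Pi.single (Sum.inl i) (1 : k) := by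
    funext i
    exact linPart_X _
  rw [h4] at h3
  exact h3

/-- A monomial with exponents smaller than `p^{e_i}` in `x_i` that lies in `k[x_1^{p^{e_1}}, …,
x_t^{p^{e_t}}]` is constant, but the new element has an initial form of positive degree. -/
theorem separates_of_isCompanion (hS : S.Heart R young) (hR : R.IsFinGen)
    (hmu0 : S.muTilde R young ≠ 0) (hmutop : S.muTilde R young ≠ ⊤) {K : IdealisticFiltration O}
    (hK : S.IsCompanion R young K) : Separates k R K := by
  obtain ⟨L, hL, G, hG, hGm, hne, hsmall⟩ := exists_new_element hS.isLGS hR hmu0 hmutop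
  have hc := hS.isCoord
  have h1 : G ∈ (K.ideal L).map S.coord := by
    rw [← hK] at hG; exact hG
  obtain ⟨g, hg, hgG⟩ := hc.exists_mem_sub_mem (K.ideal L) (L + 1) h1
  have hlp : leadPoly L (S.coord g) = leadPoly L G := by
    have := leadPoly_of_mem hgG
    rw [map_sub, sub_eq_zero] at this
    exact this.symm
  refine ⟨L, g, hg, fun hgm h2 => ?_⟩
  rw [hc.mk_mem_leadingPart_iff _ hgm, hlp, hS.isLeadForm.eq] at h2
  obtain ⟨α, hα⟩ := MvPolynomial.ne_zero_iff.1 hne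
  have h3 := isPowExponent_of_coeff_ne_zero h2 hα
  have h4 := hsmall α hα
  have h5 : α = 0 := by
    ext i
    rcases i with i | j
    · exact Nat.eq_zero_of_dvd_of_lt (h3.1 i) (h4 i)
    · exact h3.2 j
  apply hα
  rw [h5]
  exact coeff_leadPoly_of_ne _ (by simp; omega)

/-- If all linear forms lie in the leading algebra, there are no variables beyond the first `t` and
all `e_i` vanish. The only small exponent is then `0`, and the constant terms of elements of the
maximal ideal are zero. -/
theorem muTilde_eq_top (hS : S.Heart R young) (hsing : R.ClosedPointInSing)
    (h : ∀ j, MvPolynomial.X j ∈ leadSub S.coord (R.diffSat k) 1) : S.muTilde R young = ⊤ := by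
  have hexp : ∀ j, IsPowExponent k S.e (Finsupp.single j 1 : Fin S.t ⊕ Fin S.r →₀ ℕ) := by
    intro j
    have h1 := h j
    rw [hS.isLeadForm.eq] at h1
    refine isPowExponent_of_coeff_ne_zero h1 ?_
    rw [MvPolynomial.coeff_X]
    simp
  have hq : ∀ i, S.q i = 1 := by
    intro i
    have := (hexp (Sum.inl i)).1 i
    rw [Finsupp.single_eq_same] at this
    exact Nat.dvd_one.1 this
  have hzero : ∀ α : Fin S.t ⊕ Fin S.r →₀ ℕ, IsSmall S.q α → α = 0 := by
    intro α hα
    ext i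
    rcases i with i | j
    · have := hα i
      rw [hq] at this
      simpa using this
    · have := (hexp (Sum.inr j)).2 j
      rw [Finsupp.single_eq_same] at this
      exact absurd this one_ne_zero
  have hmuP : S.muP R = ⊤ := by
    rw [S.muP_eq hS.isLGS]
    simp only [iInf_eq_top]
    intro a ha f hf
    have h1 : constTerm hS.isLGS (S.coord f) = 0 := by
      have h2 : f ∈ maximalIdeal O ^ 1 := Ideal.pow_le_pow_right ha (hsing a hf)
      have h3 := hS.isLGS.constTerm_mem (hS.isCoord.mem_iff.2 h2)
      ext α
      rw [map_zero]
      by_contra hα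
      have h4 := hzero α (hS.isLGS.coeff_constTerm hα)
      rw [h4] at hα
      exact hα ((mem_maximalIdeal_pow_iff _ _).1 h3 0 (by simp))
    rw [h1]
    simp [ENNReal.top_div_of_ne_top]
  rw [muTilde, if_pos hmuP]

/-- If the order of `g` is smaller than its level, the saturation of `B` is the unit ideal at level
`1`, and its leading algebra contains all linear forms. The leading algebra of the saturation of `R`
cannot, since `μ̃ ≠ ∞`. -/
theorem exists_leadingPart_ne [Algebra.EssFiniteType k O] [IsNoetherianRing O]
    (hS : S.Heart R young) (hsing : R.ClosedPointInSing) (hmutop : S.muTilde R young ≠ ⊤)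
    {K B : IdealisticFiltration O} (hRK : Separates k R K) (hKB : ∀ a, K.ideal a ≤ B.ideal a) :
    ∃ a, (R.diffSat k).leadingPart a ≠ (B.diffSat k).leadingPart a := by
  have hc := hS.isCoord
  obtain ⟨n, g, hg, hgn⟩ := hRK
  have hgD : g ∈ (B.diffSat k).ideal n := IdealisticFiltration.le_diffSat k B n (hKB n hg)
  by_cases hgm : g ∈ maximalIdeal O ^ n
  · refine ⟨n, fun h => hgn hgm ?_⟩
    rw [h]
    exact ⟨g, ⟨hgD, hgm⟩, rfl⟩
  · refine ⟨1, fun h => hmutop ?_⟩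
    -- a derivative of `g` is a unit at positive level
    rw [← hc.mem_iff, mem_maximalIdeal_pow_iff] at hgm
    push Not at hgm
    obtain ⟨α, hαn, hα⟩ := hgm
    obtain ⟨g', hg', hgg'⟩ := hc.exists_mem_diffSat_hasse B hgD α 1
    have hunit : IsUnit g' := by
      by_contra hn
      rw [← mem_nonunits_iff, ← mem_maximalIdeal, ← pow_one (maximalIdeal O), ← hc.mem_iff] at hn
      have h1 := Ideal.add_mem _ hgg' hn
      rw [sub_add_cancel] at h1
      have h2 := (mem_maximalIdeal_pow_iff _ _).1 h1 0 (by simp)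
      rw [coeff_hasse, zero_add] at h2
      have : multiChoose α α = 1 := Finset.prod_eq_one fun i _ => Nat.choose_self _
      rw [this, Nat.cast_one, one_mul] at h2
      exact hα h2
    have htop : (B.diffSat k).ideal 1 = ⊤ :=
      top_le_iff.1 ((Ideal.eq_top_of_isUnit_mem _ hg' hunit).ge.trans
        ((B.diffSat k).anti (by omega)))
    refine muTilde_eq_top hS hsing fun j => ?_
    rw [hc.leadingPart_eq_iff] at h
    rw [h]
    obtain ⟨x, hx, hxj⟩ := hc.exists_lift_X 1 j
    refine mem_leadSub.2 ⟨x, by rw [htop]; trivial, by rwa [pow_one], ?_⟩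
    have h1 := leadPoly_of_mem hxj
    rwa [map_sub, sub_eq_zero, leadPoly_X] at h1

end FormalSystem

end Separation

/-! ### Coordinates adapted to a blow up -/

section BlowUp

open MvPowerSeries

variable {k A B : Type*} [Field k] [CommRing A] [CommRing B] [IsLocalRing A] [IsLocalRing B]
  [Algebra k A] [Algebra k B]

/-- Regular systems of parameters, and coordinates, adapted to a blow up: after the change of
parameters from `x` to `g`, the center is `g_j = 0` for `j ∈ J`, with `g_{j₀} = y` the equation of the
exceptional divisor, and `g_j = y G_j` for the other `j ∈ J`. -/
structure IsAdapted (φ : A →ₐ[k] B) (C : Ideal A) (y : A) {d : ℕ} (x : Fin d → A) (J : Finset (Fin d))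
    (j₀ : Fin d) (g : Fin d → A) (G : Fin d → B) (cA : A →ₐ[k] MvPowerSeries (Fin d) k)
    (cB : B →ₐ[k] MvPowerSeries (Fin d) k) : Prop where
  mem : j₀ ∈ J
  coordA : IsCoord cA
  coordB : IsCoord cB
  coordA_eq : ∀ i, cA (g i) = X i
  coordB_eq : ∀ i, cB (G i) = X i
  g_eq : g j₀ = y
  G_eq : G j₀ = φ y
  map_of_notMem : ∀ i ∉ J, φ (g i) = G i
  map_of_mem : ∀ i ∈ J, i ≠ j₀ → φ (g i) = φ y * G i
  center_le : C ≤ Ideal.span (g '' (J : Set (Fin d)))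
  strict : ∀ i, strictTransform (φ : A →+* B) (φ y) (Ideal.span {x i}) ≠ ⊤ →
    i ≠ j₀ ∧ strictTransform (φ : A →+* B) (φ y) (Ideal.span {x i}) = Ideal.span {G i}

theorem exists_sum_smul_of_mem_span_image {R ι : Type*} [CommRing R] {v : ι → R} {J : Finset ι} {x : R}
    (h : x ∈ Ideal.span (v '' (J : Set ι))) : ∃ a : ι → R, ∑ j ∈ J, a j • v j = x := by
  classical
  obtain ⟨a, ha⟩ := (Submodule.mem_span_image_finset_iff_exists_fun R).1 h
  refine ⟨fun j => if hj : j ∈ J then a ⟨j, hj⟩ else 0, ?_⟩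
  rw [← ha, ← Finset.sum_attach]
  exact Finset.sum_congr rfl fun j _ => by simp only [dif_pos j.2]

theorem strictTransform_eq_top {φ : A →+* B} {y : B} {x : A} {z : B} (hz : IsUnit z)
    (h : φ x = y * z) : strictTransform φ y (Ideal.span {x}) = ⊤ := by
  rw [Ideal.eq_top_iff_one]
  refine ⟨1, ?_⟩
  obtain ⟨u, rfl⟩ := hz
  rw [Ideal.map_span, Set.image_singleton, Ideal.mem_span_singleton]
  refine ⟨(↑u⁻¹ : B), ?_⟩
  rw [h, mul_assoc, Units.mul_inv, pow_one]

/-- The exceptional equation and `G` are different variables of the completion, so powers of the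
former can be cancelled in divisibilities by the latter. -/
theorem strictTransform_eq_span [IsNoetherianRing B] {V : Type*} [Fintype V] {cB : B →ₐ[k] MvPowerSeries V k}
    (hc : IsCoord cB) {φ : A →+* B} {y : B} {x : A} {G : B} {i j : V} (hij : i ≠ j) (hy : cB y = X j)
    (hG : cB G = X i) (n : ℕ) (h : φ x = y ^ n * G) :
    strictTransform φ y (Ideal.span {x}) = Ideal.span {G} := by
  apply le_antisymm
  · rintro f ⟨m, hm⟩
    rw [Ideal.map_span, Set.image_singleton, Ideal.mem_span_singleton] at hm
    refine hc.comap_map _ ?_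
    rw [Ideal.map_span, Set.image_singleton, Ideal.mem_span_singleton,
      hG, X_dvd_iff]
    intro β hβ
    obtain ⟨b, hb⟩ := hm
    have h1 : X i ∣ X j ^ m * cB f := by
      rw [← hy, ← map_pow, ← map_mul, hb, h, map_mul, map_mul, hG]
      exact Dvd.dvd.mul_right (dvd_mul_left _ _) _
    rw [X_dvd_iff] at h1
    have h2 := h1 (Finsupp.single j m + β) (by
      rw [Finsupp.add_apply, hβ, Finsupp.single_eq_of_ne hij])
    rwa [X_pow_eq, coeff_add_monomial_mul, one_mul] at h2
  · rw [Ideal.span_singleton_le_iff_mem]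
    refine ⟨n, ?_⟩
    rw [Ideal.map_span, Set.image_singleton, ← h]
    exact Ideal.mem_span_singleton_self _

theorem IsLocalBlowUp.map_ne_zero {φ : A →ₐ[k] B} {C : Ideal A} {y : A} (h : IsLocalBlowUp φ C y)
    {V : Type*} [Fintype V] {c : A →ₐ[k] MvPowerSeries V k} (hc : IsCoord c) {d : ℕ} {x : Fin d → A}
    (hx : Ideal.span (Set.range x) = maximalIdeal A) (hcard : Fintype.card (Fin d) = Fintype.card V)
    {J : Finset (Fin d)} (hJ : J.Nonempty) (hC : C = Ideal.span (x '' (J : Set (Fin d)))) :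
    φ y ≠ 0 := by
  intro h0
  obtain ⟨j, hj⟩ := hJ
  have h1 : φ (x j) ∈ C.map φ := Ideal.mem_map_of_mem _ (by
    rw [hC]; exact Ideal.subset_span ⟨j, hj, rfl⟩)
  rw [h.map_center, h0, Ideal.mem_span_singleton, zero_dvd_iff] at h1
  have h2 : x j = 0 := h.injective (h1.trans (map_zero φ).symm)
  obtain ⟨c', hc', hcx⟩ := hc.exists_coord_eq_X hx hcard
  have h3 := congrArg (coeff (Finsupp.single j 1)) (hcx j)
  rw [h2, map_zero, map_zero, coeff_index_single_self_X] at h3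
  exact zero_ne_one h3

/-- Write `y` as a combination of the `x j`, `j ∈ J`, and `φ (x j) = φ y * z j`. Some coefficient `a
j₀` and `z j₀` are units, so `y` can replace `x j₀`. The other `x j`, `j ∈ J`, are translated by
multiples of `y`, so that the new point becomes the origin of the chart. -/
theorem IsLocalBlowUp.exists_adapted {φ : A →ₐ[k] B} {C : Ideal A} {y : A} (h : IsLocalBlowUp φ C y)
    (hA : IsClosedPointRing k A) (hB : IsClosedPointRing k B) [IsNoetherianRing B]
    {VA VB : Type*} [Fintype VA] [Fintype VB] {cA₀ : A →ₐ[k] MvPowerSeries VA k}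
    {cB₀ : B →ₐ[k] MvPowerSeries VB k} (hcA : IsCoord cA₀) (hcB : IsCoord cB₀)
    (hcard : Fintype.card VA = Fintype.card VB) {d : ℕ} {x : Fin d → A} (hx : IsRegularSystem x)
    {J : Finset (Fin d)} (hJ : J.Nonempty) (hC : C = Ideal.span (x '' (J : Set (Fin d)))) :
    ∃ j₀ g G cA cB, IsAdapted φ C y x J j₀ g G cA cB := by
  classical
  have := h.domain
  rw [hcA.isRegularSystem_iff hA.regular] at hx
  obtain ⟨hxm, hxc⟩ := hx
  have hxmem : ∀ i, x i ∈ maximalIdeal A := fun i => by rw [← hxm]; exact Ideal.subset_span ⟨i, rfl⟩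
  have hCm : C ≤ maximalIdeal A := by
    rw [hC, ← hxm]; exact Ideal.span_mono (Set.image_subset_range _ _)
  have hφm : ∀ f ∈ maximalIdeal A, φ f ∈ maximalIdeal B := by
    intro f hf
    rw [mem_maximalIdeal, mem_nonunits_iff] at hf ⊢
    exact fun hu => hf (h.localHom.map_nonunit f hu)
  have hy0 : φ y ≠ 0 := h.map_ne_zero hcA hxm hxc hJ hC
  have hz : ∀ j, ∃ z, j ∈ J → φ (x j) = φ y * z := by
    intro j
    by_cases hj : j ∈ J
    · have h1 : φ (x j) ∈ C.map φ := Ideal.mem_map_of_mem _ (by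
        rw [hC]; exact Ideal.subset_span ⟨j, hj, rfl⟩)
      rw [h.map_center, Ideal.mem_span_singleton] at h1
      obtain ⟨z, hz⟩ := h1
      exact ⟨z, fun _ => hz⟩
    · exact ⟨0, fun h => absurd h hj⟩
  choose z hz using hz
  obtain ⟨a, ha⟩ := exists_sum_smul_of_mem_span_image (hC ▸ h.mem)
  have hone : ∑ j ∈ J, φ (a j) * z j = 1 := by
    apply mul_left_cancel₀ hy0
    rw [mul_one, Finset.mul_sum]
    conv_rhs => rw [← ha, map_sum]
    refine Finset.sum_congr rfl fun j hj => ?_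
    rw [smul_eq_mul, map_mul, hz j hj]; ring
  obtain ⟨j₀, hj₀, hu⟩ : ∃ j ∈ J, IsUnit (φ (a j) * z j) := by
    by_contra hcon
    push Not at hcon
    have h1 : (1 : B) ∈ maximalIdeal B := by
      rw [← hone]
      exact Ideal.sum_mem _ fun j hj => (mem_maximalIdeal _).2 (hcon j hj)
    exact (Ideal.ne_top_iff_one _).1 (maximalIdeal.isMaximal B).ne_top h1
  have hua : IsUnit (a j₀) := h.localHom.map_nonunit _ (isUnit_of_mul_isUnit_left hu)
  have huz : IsUnit (z j₀) := isUnit_of_mul_isUnit_right hu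
  choose α hα using fun j => hB.residue (z j)
  let g : Fin d → A := fun j => if j = j₀ then y else if j ∈ J then x j - algebraMap k A (α j) * y else x j
  -- The `z j` are normalized by subtracting their residues `α j`; `g` is changed accordingly, so
  -- that `φ (g j) = φ y * G j` still holds.
  let G : Fin d → B := fun j => if j = j₀ then φ y else if j ∈ J then z j - algebraMap k B (α j) else φ (x j)
  have hg₀ : g j₀ = y := if_pos rfl
  have hG₀ : G j₀ = φ y := if_pos rfl
  have hgJ : ∀ j ∈ J, j ≠ j₀ → g j = x j - algebraMap k A (α j) * y := fun j hj hne => by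
    simp only [g, if_neg hne, if_pos hj]
  have hGJ : ∀ j ∈ J, j ≠ j₀ → G j = z j - algebraMap k B (α j) := fun j hj hne => by
    simp only [G, if_neg hne, if_pos hj]
  have hgN : ∀ j ∉ J, g j = x j := fun j hj => by
    have hne : j ≠ j₀ := by rintro rfl; exact hj hj₀
    simp only [g, if_neg hne, if_neg hj]
  have hGN : ∀ j ∉ J, G j = φ (x j) := fun j hj => by
    have hne : j ≠ j₀ := by rintro rfl; exact hj hj₀
    simp only [G, if_neg hne, if_neg hj]
  have hmapJ : ∀ j ∈ J, j ≠ j₀ → φ (g j) = φ y * G j := by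
    intro j hj hne
    rw [hgJ j hj hne, hGJ j hj hne, map_sub, map_mul, AlgHom.commutes, hz j hj]; ring
  have hmapN : ∀ j ∉ J, φ (g j) = G j := fun j hj => by rw [hgN j hj, hGN j hj]
  -- the center and the maximal ideal of `A`
  have hyJ : y ∈ Ideal.span (g '' (J : Set (Fin d))) := Ideal.subset_span ⟨j₀, hj₀, hg₀⟩
  have hxJ : ∀ j ∈ J, x j ∈ Ideal.span (g '' (J : Set (Fin d))) := by
    have h1 : ∀ j ∈ J, j ≠ j₀ → x j ∈ Ideal.span (g '' (J : Set (Fin d))) := by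
      intro j hj hne
      have h2 : g j ∈ Ideal.span (g '' (J : Set (Fin d))) := Ideal.subset_span ⟨j, hj, rfl⟩
      rw [hgJ j hj hne] at h2
      have := Ideal.add_mem _ h2 (Ideal.mul_mem_left _ (algebraMap k A (α j)) hyJ)
      rwa [sub_add_cancel] at this
    intro j hj
    by_cases hne : j = j₀
    · subst hne
      rw [← Ideal.unit_mul_mem_iff_mem _ hua]
      rw [← Finset.add_sum_erase _ _ hj, smul_eq_mul] at ha
      rw [eq_sub_of_add_eq ha]
      refine Ideal.sub_mem _ hyJ (Ideal.sum_mem _ fun i hi => ?_)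
      rw [Finset.mem_erase] at hi
      exact Ideal.mul_mem_left _ _ (h1 i hi.2 hi.1)
    · exact h1 j hj hne
  have hCg : C ≤ Ideal.span (g '' (J : Set (Fin d))) := by
    rw [hC, Ideal.span_le]
    rintro _ ⟨j, hj, rfl⟩
    exact hxJ j hj
  have hgmem : ∀ j, g j ∈ maximalIdeal A := by
    intro j
    simp only [g]
    split_ifs
    · exact hCm h.mem
    · exact Ideal.sub_mem _ (hxmem j) (Ideal.mul_mem_left _ _ (hCm h.mem))
    · exact hxmem j
  have hgspan : Ideal.span (Set.range g) = maximalIdeal A := by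
    apply le_antisymm
    · rw [Ideal.span_le]; rintro _ ⟨j, rfl⟩; exact hgmem j
    · rw [← hxm, Ideal.span_le]
      rintro _ ⟨j, rfl⟩
      by_cases hj : j ∈ J
      · exact Ideal.span_mono (Set.image_subset_range _ _) (hxJ j hj)
      · rw [← hgN j hj]; exact Ideal.subset_span ⟨j, rfl⟩
  -- the maximal ideal of `B`
  have hGmem : ∀ j, G j ∈ maximalIdeal B := by
    intro j
    simp only [G]
    split_ifs
    · exact hφm _ (hCm h.mem)
    · exact hα j
    · exact hφm _ (hxmem j)
  have hGsub : ∀ j, G j ∈ Ideal.span (Set.range G) := fun j => Ideal.subset_span ⟨j, rfl⟩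
  have hφG : ∀ f ∈ maximalIdeal A, φ f ∈ Ideal.span (Set.range G) := by
    intro f hf
    rw [← hgspan] at hf
    have h1 : φ f ∈ (Ideal.span (Set.range g)).map φ := Ideal.mem_map_of_mem _ hf
    rw [Ideal.map_span] at h1
    refine (Ideal.span_le.2 ?_) h1
    rintro _ ⟨_, ⟨j, rfl⟩, rfl⟩
    change φ (g j) ∈ Ideal.span (Set.range G)
    by_cases hj : j ∈ J
    · by_cases hne : j = j₀
      · subst hne; rw [hg₀, ← hG₀]; exact hGsub _
      · rw [hmapJ j hj hne]; exact Ideal.mul_mem_left _ _ (hGsub j)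
    · rw [hmapN j hj]; exact hGsub j
  have hφres : ∀ f : A, ∃ c : k, φ f - algebraMap k B c ∈ Ideal.span (Set.range G) := by
    intro f
    obtain ⟨c, hc⟩ := hA.residue f
    refine ⟨c, ?_⟩
    have := hφG _ hc
    rwa [map_sub, AlgHom.commutes] at this
  -- The generators of `A[C / y]` are constants modulo the `G j`. An element of the maximal ideal of
  -- `B` is, up to a unit, an element of this subring; its constant must vanish, so the `G j`
  -- generate the maximal ideal.
  have hres : ∀ b ∈ Algebra.adjoin k (Set.range φ ∪ {z | ∃ c ∈ C, z * φ y = φ c}),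
      ∃ c : k, b - algebraMap k B c ∈ Ideal.span (Set.range G) := by
    intro b hb
    induction hb using Algebra.adjoin_induction with
    | mem b hb =>
      rcases hb with ⟨f, rfl⟩ | ⟨c, hc, hbc⟩
      · exact hφres f
      · have h1 := hCg hc
        obtain ⟨b', hb'⟩ := exists_sum_smul_of_mem_span_image h1
        have h2 : b = φ (b' j₀) + ∑ j ∈ J.erase j₀, φ (b' j) * G j := by
          apply mul_right_cancel₀ hy0
          rw [hbc, ← hb', ← Finset.add_sum_erase _ _ hj₀, map_add, map_sum, add_mul, Finset.sum_mul]
          congr 1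
          · rw [smul_eq_mul, map_mul, hg₀]
          · refine Finset.sum_congr rfl fun j hj => ?_
            rw [Finset.mem_erase] at hj
            rw [smul_eq_mul, map_mul, hmapJ j hj.2 hj.1]; ring
        obtain ⟨c', hc'⟩ := hφres (b' j₀)
        refine ⟨c', ?_⟩
        rw [h2, add_sub_right_comm]
        exact Ideal.add_mem _ hc' (Ideal.sum_mem _ fun j _ => Ideal.mul_mem_left _ _ (hGsub j))
    | algebraMap r => exact ⟨r, by rw [sub_self]; exact Ideal.zero_mem _⟩
    | add b b' _ _ ih ih' =>
      obtain ⟨c, hc⟩ := ih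
      obtain ⟨c', hc'⟩ := ih'
      refine ⟨c + c', ?_⟩
      rw [map_add, add_sub_add_comm]
      exact Ideal.add_mem _ hc hc'
    | mul b b' _ _ ih ih' =>
      obtain ⟨c, hc⟩ := ih
      obtain ⟨c', hc'⟩ := ih'
      refine ⟨c * c', ?_⟩
      rw [map_mul, show b * b' - algebraMap k B c * algebraMap k B c' =
        b * (b' - algebraMap k B c') + algebraMap k B c' * (b - algebraMap k B c) by ring]
      exact Ideal.add_mem _ (Ideal.mul_mem_left _ _ hc') (Ideal.mul_mem_left _ _ hc)
  have hGle : Ideal.span (Set.range G) ≤ maximalIdeal B := by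
    rw [Ideal.span_le]; rintro _ ⟨j, rfl⟩; exact hGmem j
  have hGspan : Ideal.span (Set.range G) = maximalIdeal B := by
    refine le_antisymm hGle fun f hf => ?_
    obtain ⟨b, hb, c, -, hc, hfc⟩ := h.localization f
    obtain ⟨β, hβ⟩ := hres b hb
    have h1 : b ∈ maximalIdeal B := by rw [← hfc]; exact Ideal.mul_mem_right _ _ hf
    have h2 : algebraMap k B β ∈ maximalIdeal B := by
      have := Ideal.sub_mem _ h1 (hGle hβ)
      rwa [sub_sub_cancel] at this
    have h3 : β = 0 := by
      by_contra h0
      rw [mem_maximalIdeal, mem_nonunits_iff] at h2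
      exact h2 ((isUnit_iff_ne_zero.2 h0).map (algebraMap k B))
    rw [h3, map_zero, sub_zero, ← hfc] at hβ
    exact (Ideal.mul_unit_mem_iff_mem _ hc).1 hβ
  obtain ⟨cA, hcA', hcAX⟩ := hcA.exists_coord_eq_X hgspan hxc
  obtain ⟨cB, hcB', hcBX⟩ := hcB.exists_coord_eq_X hGspan (hxc.trans hcard)
  refine ⟨j₀, g, G, cA, cB, ⟨hj₀, hcA', hcB', hcAX, hcBX, hg₀, hG₀, hmapN, hmapJ, hCg, fun i hi => ?_⟩⟩
  have hi₀ : i ≠ j₀ := by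
    rintro rfl
    exact hi (strictTransform_eq_top huz (hz i hj₀))
  have hcy : cB (φ y) = X j₀ := by rw [← hG₀, hcBX]
  refine ⟨hi₀, ?_⟩
  by_cases hiJ : i ∈ J
  · have hzi : z i ∈ maximalIdeal B := by
      rw [mem_maximalIdeal, mem_nonunits_iff]
      exact fun hu => hi (strictTransform_eq_top hu (hz i hiJ))
    -- If the strict transform passes through the point, `z i` is not a unit and no translation is
    -- made, so the component is given by `G i` itself.
    have hαi : α i = 0 := by
      have h1 := Ideal.sub_mem _ hzi (hα i)
      rw [sub_sub_cancel] at h1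
      by_contra h0
      rw [mem_maximalIdeal, mem_nonunits_iff] at h1
      exact h1 ((isUnit_iff_ne_zero.2 h0).map (algebraMap k B))
    refine strictTransform_eq_span hcB' hi₀ hcy (hcBX i) 1 ?_
    rw [pow_one, hGJ i hiJ hi₀, hαi, map_zero, sub_zero]
    exact hz i hiJ
  · refine strictTransform_eq_span hcB' hi₀ hcy (hcBX i) 0 ?_
    rw [pow_zero, one_mul, hGN i hiJ]
    rfl

end BlowUp

/-! ### Initial forms and their dehomogenizations -/

section Slice

open MvPowerSeries

variable {k V : Type*} [Field k] [DecidableEq V]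

/-- In the chart where `X_j = Y X_j'` for `j ∈ J`, `j ≠ j₀` and `X_{j₀} = Y`, the part of `F'` which
involves only the `X_j'` is obtained from the initial form of degree `n` of `F`, which involves
only the `X_j`, `j ∈ J`. -/
structure IsSlice (J : Finset V) (j₀ : V) (n : ℕ) (F F' : MvPowerSeries V k) : Prop where
  low : ∀ β : V →₀ ℕ, β.degree < n → coeff β F = 0
  support : ∀ β : V →₀ ℕ, β.degree = n → ¬ β.support ⊆ J → coeff β F = 0
  coeff_eq : ∀ γ : V →₀ ℕ, γ.support ⊆ J.erase j₀ →
    coeff γ F' = if γ.degree ≤ n then coeff (γ + Finsupp.single j₀ (n - γ.degree)) F else 0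

theorem coeff_X_mul_of_eq_zero (F : MvPowerSeries V k) {j : V} {β : V →₀ ℕ} (h : β j = 0) :
    coeff β (X j * F) = 0 :=
  X_dvd_iff.1 (Dvd.intro _ rfl) β h

theorem coeff_single_add_X_mul (F : MvPowerSeries V k) (j : V) (β : V →₀ ℕ) :
    coeff (Finsupp.single j 1 + β) (X j * F) = coeff β F := by
  rw [X, coeff_add_monomial_mul, one_mul]

theorem exists_eq_single_add {j : V} {β : V →₀ ℕ} (h : β j ≠ 0) :
    ∃ β', β = Finsupp.single j 1 + β' :=
  ⟨β - Finsupp.single j 1, (add_tsub_cancel_of_le (by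
    rw [Finsupp.single_le_iff]; omega)).symm⟩

namespace IsSlice

variable {J : Finset V} {j₀ : V} {n : ℕ} {F F' G G' : MvPowerSeries V k}

theorem zero : IsSlice J j₀ n (0 : MvPowerSeries V k) 0 where
  low _ _ := map_zero _
  support _ _ _ := map_zero _
  coeff_eq _ _ := by simp

theorem one : IsSlice J j₀ 0 (1 : MvPowerSeries V k) 1 where
  low _ h := absurd h (Nat.not_lt_zero _)
  support β h h' := by
    rw [Finsupp.degree_eq_zero_iff] at h
    subst h
    exact absurd (by simp) h'
  coeff_eq γ _ := by
    by_cases h : γ = 0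
    · subst h; simp
    · have : γ.degree ≠ 0 := fun h' => h ((Finsupp.degree_eq_zero_iff _).1 h')
      rw [if_neg (by omega), coeff_one, if_neg h]

theorem add (h : IsSlice J j₀ n F F') (h' : IsSlice J j₀ n G G') :
    IsSlice J j₀ n (F + G) (F' + G') where
  low β hβ := by rw [map_add, h.low β hβ, h'.low β hβ, add_zero]
  support β hβ hJ := by rw [map_add, h.support β hβ hJ, h'.support β hβ hJ, add_zero]
  coeff_eq γ hγ := by
    rw [map_add, h.coeff_eq γ hγ, h'.coeff_eq γ hγ]
    split_ifs
    · rw [map_add]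
    · rw [add_zero]

theorem sum {ι : Type*} (s : Finset ι) (F F' : ι → MvPowerSeries V k)
    (h : ∀ i ∈ s, IsSlice J j₀ n (F i) (F' i)) : IsSlice J j₀ n (∑ i ∈ s, F i) (∑ i ∈ s, F' i) := by
  classical
  induction s using Finset.induction_on with
  | empty => exact IsSlice.zero
  | insert i s hi ih =>
    rw [Finset.sum_insert hi, Finset.sum_insert hi]
    exact (h i (Finset.mem_insert_self i s)).add (ih fun j hj => h j (Finset.mem_insert_of_mem hj))

/-- In lowest degree `a` acts by its constant term, and on the slice `a'` consists of this constant
term alone. -/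
theorem mul (h : IsSlice J j₀ n F F') {a a' : MvPowerSeries V k}
    (h0 : constantCoeff a' = constantCoeff a)
    (ha : ∀ γ : V →₀ ℕ, γ ≠ 0 → γ.support ⊆ J.erase j₀ → coeff γ a' = 0) :
    IsSlice J j₀ n (a * F) (a' * F') := by
  have hF : ∀ β : V →₀ ℕ, β.degree ≤ n → coeff β (a * F) = constantCoeff a * coeff β F := by
    intro β hβ
    rw [coeff_mul, Finset.sum_eq_single (0, β), coeff_zero_eq_constantCoeff_apply]
    · rintro ⟨u, v⟩ huv hne
      rw [Finset.HasAntidiagonal.mem_antidiagonal] at huv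
      dsimp only at huv ⊢
      have hd : u.degree + v.degree = β.degree := by rw [← map_add, huv]
      have hu : u.degree ≠ 0 := by
        intro hu
        rw [Finsupp.degree_eq_zero_iff] at hu
        subst hu
        rw [zero_add] at huv
        exact hne (by rw [huv])
      rw [h.low v (by omega), mul_zero]
    · intro hc
      exact absurd (by rw [Finset.HasAntidiagonal.mem_antidiagonal]; simp) hc
  refine ⟨fun β hβ => ?_, fun β hβ hJ => ?_, fun γ hγ => ?_⟩
  · rw [hF β hβ.le, h.low β hβ, mul_zero]
  · rw [hF β hβ.le, h.support β hβ hJ, mul_zero]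
  · have h1 : coeff γ (a' * F') = constantCoeff a * coeff γ F' := by
      rw [coeff_mul, Finset.sum_eq_single (0, γ), coeff_zero_eq_constantCoeff_apply, h0]
      · rintro ⟨u, v⟩ huv hne
        rw [Finset.HasAntidiagonal.mem_antidiagonal] at huv
        dsimp only at huv ⊢
        have hu : u ≠ 0 := by
          rintro rfl
          rw [zero_add] at huv
          exact hne (by rw [huv])
        have hle : u ≤ γ := by rw [← huv]; exact le_self_add
        rw [ha u hu ((Finsupp.support_mono hle).trans hγ), zero_mul]
      · intro hc
        exact absurd (by rw [Finset.HasAntidiagonal.mem_antidiagonal]; simp) hc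
    rw [h1, h.coeff_eq γ hγ]
    split_ifs with hd
    · rw [hF]
      rw [map_add, Finsupp.degree_single]; omega
    · rw [mul_zero]

theorem X_mul (h : IsSlice J j₀ n F F') {j : V} (hj : j ∈ J.erase j₀) :
    IsSlice J j₀ (n + 1) (X j * F) (X j * F') := by
  have hj' := Finset.mem_erase.1 hj
  refine ⟨fun β hβ => ?_, fun β hβ hJ => ?_, fun γ hγ => ?_⟩
  · by_cases h0 : β j = 0
    · exact coeff_X_mul_of_eq_zero _ h0
    · obtain ⟨β, rfl⟩ := exists_eq_single_add h0
      rw [map_add, Finsupp.degree_single] at hβ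
      rw [coeff_single_add_X_mul, h.low _ (by omega)]
  · by_cases h0 : β j = 0
    · exact coeff_X_mul_of_eq_zero _ h0
    · obtain ⟨β, rfl⟩ := exists_eq_single_add h0
      rw [map_add, Finsupp.degree_single] at hβ
      rw [coeff_single_add_X_mul, h.support _ (by omega)]
      intro hs
      refine hJ (Finsupp.support_add.trans (Finset.union_subset ?_ hs))
      exact Finsupp.support_single_subset.trans (by simpa using hj'.2)
  · by_cases h0 : γ j = 0
    · rw [coeff_X_mul_of_eq_zero _ h0]
      split_ifs
      · rw [coeff_X_mul_of_eq_zero]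
        rw [Finsupp.add_apply, h0, Finsupp.single_eq_of_ne hj'.1, add_zero]
      · rfl
    · obtain ⟨γ, rfl⟩ := exists_eq_single_add h0
      rw [map_add, Finsupp.degree_single, coeff_single_add_X_mul, add_assoc, coeff_single_add_X_mul,
        h.coeff_eq γ ((Finsupp.support_mono le_add_self).trans hγ)]
      have : n + 1 - (1 + γ.degree) = n - γ.degree := by omega
      rw [this]
      refine if_congr (by omega) rfl rfl

theorem X_mul_left (h : IsSlice J j₀ n F F') (hj₀ : j₀ ∈ J) :
    IsSlice J j₀ (n + 1) (X j₀ * F) F' := by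
  refine ⟨fun β hβ => ?_, fun β hβ hJ => ?_, fun γ hγ => ?_⟩
  · by_cases h0 : β j₀ = 0
    · exact coeff_X_mul_of_eq_zero _ h0
    · obtain ⟨β, rfl⟩ := exists_eq_single_add h0
      rw [map_add, Finsupp.degree_single] at hβ
      rw [coeff_single_add_X_mul, h.low _ (by omega)]
  · by_cases h0 : β j₀ = 0
    · exact coeff_X_mul_of_eq_zero _ h0
    · obtain ⟨β, rfl⟩ := exists_eq_single_add h0
      rw [map_add, Finsupp.degree_single] at hβ
      rw [coeff_single_add_X_mul, h.support _ (by omega)]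
      intro hs
      refine hJ (Finsupp.support_add.trans (Finset.union_subset ?_ hs))
      exact Finsupp.support_single_subset.trans (by simpa using hj₀)
  · have hγ₀ : γ j₀ = 0 := by
      by_contra h0
      exact Finset.notMem_erase j₀ J (hγ (Finsupp.mem_support_iff.2 h0))
    rw [h.coeff_eq γ hγ]
    rcases lt_trichotomy γ.degree (n + 1) with hd | hd | hd
    · rw [if_pos (by omega), if_pos (by omega), show n + 1 - γ.degree = 1 + (n - γ.degree) by omega,
        Finsupp.single_add, add_left_comm, coeff_single_add_X_mul]
    · rw [if_neg (by omega), if_pos (by omega), hd, Nat.sub_self, Finsupp.single_zero, add_zero,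
        coeff_X_mul_of_eq_zero _ hγ₀]
    · rw [if_neg (by omega), if_neg (by omega)]

end IsSlice

/-- The substitution `X_i ↦ 0` for `i ∉ S`. -/
noncomputable def killVars (S : Finset V) : MvPolynomial V k →ₐ[k] MvPolynomial V k :=
  MvPolynomial.aeval fun i => if i ∈ S then MvPolynomial.X i else 0

theorem coeff_killVars (S : Finset V) (p : MvPolynomial V k) (β : V →₀ ℕ) :
    (killVars S p).coeff β = if β.support ⊆ S then p.coeff β else 0 := by
  have key : ∀ (α : V →₀ ℕ) (a : k), killVars S (MvPolynomial.monomial α a) =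
      if α.support ⊆ S then MvPolynomial.monomial α a else 0 := by
    intro α a
    rw [killVars, MvPolynomial.aeval_monomial, MvPolynomial.algebraMap_eq, Finsupp.prod]
    split_ifs with h
    · rw [MvPolynomial.monomial_eq, Finsupp.prod]
      congr 1
      exact Finset.prod_congr rfl fun i hi => by rw [if_pos (h hi)]
    · obtain ⟨i, hi, hiS⟩ := Finset.not_subset.1 h
      rw [Finset.prod_eq_zero hi, mul_zero]
      rw [if_neg hiS, zero_pow (Finsupp.mem_support_iff.1 hi)]
  induction p using MvPolynomial.induction_on' with
  | monomial α a =>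
    rw [key]
    by_cases hαβ : α = β
    · subst hαβ
      split_ifs <;> simp
    · have h1 : (MvPolynomial.monomial α a).coeff β = 0 := by
        rw [MvPolynomial.coeff_monomial, if_neg hαβ]
      rw [h1]
      split_ifs <;> simp [h1]
  | add p q hp hq =>
    rw [map_add, MvPolynomial.coeff_add, hp, hq, MvPolynomial.coeff_add]
    split_ifs <;> simp

theorem killVars_linPoly [Fintype V] (S : Finset V) (w : V → k) :
    killVars S (linPoly w) = linPoly fun i => if i ∈ S then w i else 0 := by
  rw [linPoly, linPoly, map_sum]
  refine Finset.sum_congr rfl fun i _ => ?_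
  rw [map_mul, killVars, MvPolynomial.aeval_X, ← MvPolynomial.algebraMap_eq, AlgHom.commutes]
  split_ifs <;> simp

theorem killVars_mem_powAlg [Fintype V] {τ : Type*} [Fintype τ] (S : Finset V) {w : τ → V → k} {e : τ → ℕ} {a : ℕ}
    {p : MvPolynomial V k} (hp : p ∈ powAlg w e a) :
    killVars S p ∈ powAlg (fun j i => if i ∈ S then w j i else 0) e a := by
  have h : powAlg w e a ≤
      (powAlg (fun j i => if i ∈ S then w j i else 0) e a).comap (killVars S).toLinearMap := by
    rw [powAlg, Submodule.span_le]
    rintro _ ⟨α, hα, rfl⟩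
    refine Submodule.subset_span ⟨α, hα, ?_⟩
    simp only [AlgHom.toLinearMap_apply, map_prod, map_pow, killVars_linPoly]
  exact h hp

/-- `F'` restricted to the slice is the dehomogenization of the initial form of `F`. If `F'` has
order at least `n`, the dehomogenization has no terms of degree below `n`, so the initial form does
not involve `X_{j₀}` and is the restriction of that of `F'`. -/
theorem IsSlice.leadPoly_eq [Fintype V] {J : Finset V} {j₀ : V} {n : ℕ} {F F' : MvPowerSeries V k}
    (h : IsSlice J j₀ n F F') (hF' : F' ∈ maximalIdeal (MvPowerSeries V k) ^ n) :
    leadPoly n F = killVars (J.erase j₀) (leadPoly n F') := by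
  rw [mem_maximalIdeal_pow_iff] at hF'
  ext β
  rw [coeff_killVars]
  by_cases hβ : β.degree = n
  · rw [coeff_leadPoly_of_eq _ hβ, coeff_leadPoly_of_eq _ hβ]
    split_ifs with hs
    · rw [h.coeff_eq β hs, if_pos hβ.le, hβ, Nat.sub_self, Finsupp.single_zero, add_zero]
    · by_cases hJ : β.support ⊆ J
      · have h0 : β j₀ ≠ 0 := by
          intro h0
          refine hs fun i hi => Finset.mem_erase.2 ⟨?_, hJ hi⟩
          rintro rfl
          exact Finsupp.mem_support_iff.1 hi h0
        have hsplit : β.erase j₀ + Finsupp.single j₀ (β j₀) = β := by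
          rw [add_comm]; exact Finsupp.single_add_erase j₀ β
        have hd : (β.erase j₀).degree + β j₀ = n := by
          rw [← hβ]
          conv_rhs => rw [← hsplit, map_add, Finsupp.degree_single]
        have hsup : (β.erase j₀).support ⊆ J.erase j₀ := by
          rw [Finsupp.support_erase]; exact Finset.erase_subset_erase _ hJ
        have h1 := h.coeff_eq _ hsup
        rw [hF' _ (by omega), if_pos (by omega), show n - (β.erase j₀).degree = β j₀ by omega, hsplit] at h1
        exact h1.symm
      · exact h.support β hβ hJ
  · rw [coeff_leadPoly_of_ne _ hβ, coeff_leadPoly_of_ne _ hβ, ite_self]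

end Slice

/-! ### Initial forms before and after a blow up -/

namespace IsAdapted

open MvPowerSeries

variable {k A B : Type*} [Field k] [CommRing A] [CommRing B] [IsLocalRing A] [IsLocalRing B]
  [Algebra k A] [Algebra k B] {φ : A →ₐ[k] B} {C : Ideal A} {y : A} {d : ℕ} {x : Fin d → A}
  {J : Finset (Fin d)} {j₀ : Fin d} {g : Fin d → A} {G : Fin d → B}
  {cA : A →ₐ[k] MvPowerSeries (Fin d) k} {cB : B →ₐ[k] MvPowerSeries (Fin d) k}

theorem ne_zero (h : IsAdapted φ C y x J j₀ g G cA cB) : φ y ≠ 0 := by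
  intro h0
  have h1 := congrArg (coeff (Finsupp.single j₀ 1)) (h.coordB_eq j₀)
  rw [h.G_eq, h0, map_zero, map_zero, coeff_index_single_self_X] at h1
  exact zero_ne_one h1

/-- The slice lies in the fibre over the closed point: the image of each parameter of `A` is
divisible by a variable which vanishes on the slice. -/
theorem coeff_map_eq_zero [IsNoetherianRing A] (h : IsAdapted φ C y x J j₀ g G cA cB) {a : A}
    (ha : a ∈ maximalIdeal A) (γ : Fin d →₀ ℕ) (hγ : γ.support ⊆ J.erase j₀) :
    coeff γ (cB (φ a)) = 0 := by
  have hspan := h.coordA.span_eq_maximalIdeal (x := g) fun j => by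
    rw [h.coordA_eq, sub_self]; exact Ideal.zero_mem _
  rw [← hspan] at ha
  have hdvd : ∀ j, ∃ i ∉ J.erase j₀, X i ∣ cB (φ (g j)) := by
    intro j
    by_cases hj : j ∈ J
    · refine ⟨j₀, Finset.notMem_erase _ _, ?_⟩
      by_cases hjj : j = j₀
      · rw [hjj, h.g_eq, ← h.G_eq, h.coordB_eq]
      · rw [h.map_of_mem j hj hjj, map_mul, ← h.G_eq, h.coordB_eq]
        exact Dvd.intro _ rfl
    · refine ⟨j, fun hj' => hj (Finset.mem_of_mem_erase hj'), ?_⟩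
      rw [h.map_of_notMem j hj, h.coordB_eq]
  rw [Ideal.mem_span_range_iff_exists_fun] at ha
  obtain ⟨b, rfl⟩ := ha
  rw [map_sum, map_sum, map_sum]
  refine Finset.sum_eq_zero fun j _ => ?_
  obtain ⟨i, hi, hd⟩ := hdvd j
  rw [map_mul, map_mul]
  refine X_dvd_iff.1 (Dvd.dvd.mul_left hd _) γ ?_
  by_contra h0
  exact hi (hγ (Finsupp.mem_support_iff.2 h0))

/-- Induction on `n`, writing elements of `C` as combinations of the `g j`, `j ∈ J`. After division
by `φ y`, a factor `g j` becomes `G j`, and the factor `y` becomes `1`. -/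
theorem exists_isSlice [IsNoetherianRing A] (h : IsAdapted φ C y x J j₀ g G cA cB)
    (hA : ∀ f : A, ∃ c : k, f - algebraMap k A c ∈ maximalIdeal A) (n : ℕ) {f : A} (hf : f ∈ C ^ n) :
    ∃ f', φ f = φ y ^ n * f' ∧ IsSlice J j₀ n (cA f) (cB f') := by
  classical
  have hmul : ∀ (a : A) (F F' : MvPowerSeries (Fin d) k) (n : ℕ), IsSlice J j₀ n F F' →
      IsSlice J j₀ n (cA a * F) (cB (φ a) * F') := by
    intro a F F' n hF
    obtain ⟨c, hc⟩ := hA a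
    have h1 : ∀ γ : Fin d →₀ ℕ, γ.support ⊆ J.erase j₀ →
        coeff γ (cB (φ a)) = coeff γ (algebraMap k (MvPowerSeries (Fin d) k) c) := by
      intro γ hγ
      have := h.coeff_map_eq_zero hc γ hγ
      rwa [map_sub, map_sub, map_sub, AlgHom.commutes, AlgHom.commutes, sub_eq_zero] at this
    refine hF.mul ?_ fun γ h0 hγ => ?_
    · have h2 := h1 0 (by simp)
      have h3 := h.coordA.mem_iff'.2 hc
      rw [mem_maximalIdeal_iff_constantCoeff, map_sub, map_sub, AlgHom.commutes, sub_eq_zero] at h3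
      rw [coeff_zero_eq_constantCoeff_apply, coeff_zero_eq_constantCoeff_apply] at h2
      rw [h2, h3]
    · rw [h1 γ hγ, MvPowerSeries.algebraMap_apply, coeff_C, if_neg h0]
  induction n generalizing f with
  | zero =>
    refine ⟨φ f, by rw [pow_zero, one_mul], ?_⟩
    have := hmul f 1 1 0 IsSlice.one
    rwa [mul_one, mul_one] at this
  | succ n ih =>
    rw [pow_succ'] at hf
    refine Submodule.mul_induction_on hf ?_ ?_
    · intro c hc f hf
      obtain ⟨f', hf', hs⟩ := ih hf
      obtain ⟨a, ha⟩ := exists_sum_smul_of_mem_span_image (h.center_le hc)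
      have hj : ∀ j ∈ J, ∃ w, φ (a j • g j * f) = φ y ^ (n + 1) * w ∧
          IsSlice J j₀ (n + 1) (cA (a j • g j * f)) (cB w) := by
        intro j hj
        by_cases hjj : j = j₀
        · refine ⟨φ (a j) * f', ?_, ?_⟩
          · rw [smul_eq_mul, map_mul, map_mul, hf', hjj, h.g_eq]; ring
          · rw [smul_eq_mul, mul_assoc, map_mul, map_mul, map_mul, h.coordA_eq, hjj]
            exact hmul _ _ _ _ (hs.X_mul_left h.mem)
        · refine ⟨φ (a j) * (G j * f'), ?_, ?_⟩
          · rw [smul_eq_mul, map_mul, map_mul, hf', h.map_of_mem j hj hjj]; ring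
          · rw [smul_eq_mul, mul_assoc, map_mul, map_mul, map_mul, map_mul, h.coordA_eq, h.coordB_eq]
            exact hmul _ _ _ _ (hs.X_mul (Finset.mem_erase.2 ⟨hjj, hj⟩))
      choose! w hw hws using hj
      refine ⟨∑ j ∈ J, w j, ?_, ?_⟩
      · rw [← ha, Finset.sum_mul, map_sum, Finset.mul_sum]
        exact Finset.sum_congr rfl hw
      · rw [← ha, Finset.sum_mul, map_sum, map_sum]
        exact IsSlice.sum _ _ _ hws
    · rintro f₁ f₂ ⟨f₁', h₁, hs₁⟩ ⟨f₂', h₂, hs₂⟩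
      refine ⟨f₁' + f₂', by rw [map_add, h₁, h₂, mul_add], ?_⟩
      rw [map_add, map_add]
      exact hs₁.add hs₂

/-- The initial form of an element of order `n` along the center is obtained from the initial form of its
transformation. -/
theorem leadPoly_eq [IsNoetherianRing A] [IsDomain B] (h : IsAdapted φ C y x J j₀ g G cA cB)
    (hA : ∀ f : A, ∃ c : k, f - algebraMap k A c ∈ maximalIdeal A) {n : ℕ} {f : A} (hf : f ∈ C ^ n)
    {f' : B} (hf' : φ y ^ n * f' = φ f) (hm : f' ∈ maximalIdeal B ^ n) :
    leadPoly n (cA f) = killVars (J.erase j₀) (leadPoly n (cB f')) := by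
  obtain ⟨f'', h1, h2⟩ := h.exists_isSlice hA n hf
  obtain rfl : f' = f'' := mul_left_cancel₀ (pow_ne_zero n h.ne_zero) (hf'.trans h1)
  exact h2.leadPoly_eq (h.coordB.mem_iff.2 hm)

end IsAdapted

/-! ### Separating elements survive blow ups with the same `σ` -/

section Transport

open MvPowerSeries

variable {k : Type u} [Field k]

theorem IsCoord.leadPoly_pow_eq {O : Type*} [CommRing O] [IsLocalRing O] [Algebra k O] {V : Type*}
    [Fintype V] {c : O →ₐ[k] MvPowerSeries V k} (hc : IsCoord c) {x : O} (hx : x ∈ maximalIdeal O) (q : ℕ) :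
    leadPoly q (c (x ^ q)) = linPoly (linPart (c x)) ^ q := by
  have := leadPoly_pow (n := 1) (f := c x) (by rw [pow_one, hc.mem_iff']; exact hx) q
  rw [one_mul] at this
  rw [map_pow, this, leadPoly_one_eq]

/-- The `h i` lie in the completion of `R` itself, not merely of its saturation, so modulo higher
order they are replaced by elements of `R`. These can be transformed under the blow up, which
elements of the saturation could not directly. -/
theorem FormalSystem.Heart.exists_generators {O : Type v} [CommRing O] [IsLocalRing O] [Algebra k O]
    [IsNoetherianRing O] (hO : IsRegularLocalRing O) {S : FormalSystem k O} {R : IdealisticFiltration O}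
    {young : Set (Ideal O)} (hS : S.Heart R young) {V : Type*} [Fintype V]
    {c : O →ₐ[k] MvPowerSeries V k} (hc : IsCoord c) :
    ∃ v : Fin S.t → V → k, IsLeadForm (leadSub c (R.diffSat k)) v S.e ∧
      ∀ i, ∃ f ∈ R.ideal (S.q i), leadPoly (S.q i) (c f) = linPoly (v i) ^ S.q i := by
  classical
  have hcS := hS.isCoord
  have hb : LinearIndependent k fun i : Fin S.t ⊕ Fin S.r => (Pi.single i 1 : Fin S.t ⊕ Fin S.r → k) :=
    Pi.linearIndependent_single_one _ k
  obtain ⟨x, hx, hxb⟩ := hcS.exists_regularSystem hb rfl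
  have hxm : ∀ i, x i ∈ maximalIdeal O := fun i => by rw [← hx]; exact Ideal.subset_span ⟨_, rfl⟩
  have hform : HasLeadingForm k (R.diffSat k) x S.e := by
    rw [hcS.hasLeadingForm_iff _ fun i => hxm _]
    refine ⟨hS.isLeadForm.expChar, fun a => ?_⟩
    rw [hS.isLeadForm.eq]
    simp only [hxb]
  obtain ⟨-, hlead⟩ := hc.isLeadForm_of_hasLeadingForm hO ((hcS.isRegularSystem_iff hO x).2 ⟨hx, rfl⟩) hform
  refine ⟨_, hlead, fun i => ?_⟩
  obtain ⟨f, hf, hfh⟩ := hcS.exists_mem_sub_mem (R.ideal (S.q i)) (S.q i + 1) (hS.mem i)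
  have h1 : S.x (Sum.inl i) ^ S.q i - S.coord f ∈ maximalIdeal S.Ring ^ (S.q i + 1) := by
    have := Ideal.sub_mem _ hfh (hS.congr i)
    rwa [sub_sub_sub_cancel_left] at this
  have hXm : S.x (Sum.inl i) ^ S.q i ∈ maximalIdeal S.Ring ^ S.q i :=
    Ideal.pow_mem_pow (X_mem_maximalIdeal _) _
  have hfm : f ∈ maximalIdeal O ^ S.q i := by
    rw [← hcS.mem_iff]
    have := Ideal.sub_mem _ hXm (Ideal.pow_le_pow_right (Nat.le_succ _) h1)
    rwa [sub_sub_cancel] at this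
  have hxq : x (Sum.inl i) ^ S.q i ∈ maximalIdeal O ^ S.q i := Ideal.pow_mem_pow (hxm _) _
  refine ⟨f, hf, ?_⟩
  rw [← hc.leadPoly_pow_eq (hxm _), ← hc.mk_eq_mk_iff hfm hxq, hcS.mk_eq_mk_iff hfm hxq, hcS.leadPoly_pow_eq (hxm _), hxb, linPoly_single]
  have h2 := leadPoly_of_mem h1
  rw [map_sub, sub_eq_zero] at h2
  rw [← h2]
  have h3 := leadPoly_pow (n := 1) (f := S.x (Sum.inl i)) (by
    rw [pow_one]; exact X_mem_maximalIdeal _) (S.q i)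
  rw [one_mul, FormalSystem.x, leadPoly_X] at h3
  exact h3

theorem IsAdapted.center_le_maximalIdeal {A B : Type*} [CommRing A] [CommRing B] [IsLocalRing A]
    [IsLocalRing B] [Algebra k A] [Algebra k B] {φ : A →ₐ[k] B} {C : Ideal A} {y : A} {d : ℕ}
    {x : Fin d → A} {J : Finset (Fin d)} {j₀ : Fin d} {g : Fin d → A} {G : Fin d → B}
    {cA : A →ₐ[k] MvPowerSeries (Fin d) k} {cB : B →ₐ[k] MvPowerSeries (Fin d) k}
    (h : IsAdapted φ C y x J j₀ g G cA cB) : C ≤ maximalIdeal A := by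
  refine h.center_le.trans (Ideal.span_le.2 ?_)
  rintro _ ⟨j, -, rfl⟩
  rw [SetLike.mem_coe, ← h.coordA.mem_iff', h.coordA_eq]
  exact X_mem_maximalIdeal j

/-- Setting variables to zero carries the initial forms of the transformed leading generators to
those of the old ones. Hence the old leading algebra lies in the image of the new one, and equal
counts make them equal. If the transformation of a separating element had its initial form in the
new leading algebra, the old initial form would lie in the old one. -/
theorem IsAdapted.separates_transform {A B : Type v} [CommRing A] [CommRing B] [IsLocalRing A] [IsLocalRing B]
    [Algebra k A] [Algebra k B] [IsNoetherianRing A] [IsDomain B] {φ : A →ₐ[k] B} {C : Ideal A} {y : A}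
    {d : ℕ} {x : Fin d → A} {J : Finset (Fin d)} {j₀ : Fin d} {g : Fin d → A} {G : Fin d → B}
    {cA : A →ₐ[k] MvPowerSeries (Fin d) k} {cB : B →ₐ[k] MvPowerSeries (Fin d) k}
    (h : IsAdapted φ C y x J j₀ g G cA cB)
    (hA : ∀ f : A, ∃ c : k, f - algebraMap k A c ∈ maximalIdeal A)
    (hmap : C.map φ = Ideal.span {φ y}) {R K : IdealisticFiltration A} (hR : R.CenterInSing C)
    (hK : K.CenterInSing C) (hsing : (R.transform (φ : A →+* B) (φ y)).ClosedPointInSing)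
    {t : ℕ} {v : Fin t → Fin d → k} {e : Fin t → ℕ} (hv : IsLeadForm (leadSub cA (R.diffSat k)) v e)
    (hgen : ∀ i, ∃ f ∈ R.ideal (ringExpChar k ^ e i),
      leadPoly (ringExpChar k ^ e i) (cA f) = linPoly (v i) ^ ringExpChar k ^ e i)
    {t' : ℕ} {w : Fin t' → Fin d → k} {e' : Fin t' → ℕ}
    (hw : IsLeadForm (leadSub cB ((R.transform (φ : A →+* B) (φ y)).diffSat k)) w e')
    (hcard : ∀ m, (Finset.univ.filter fun i => e i ≤ m).card =
      (Finset.univ.filter fun i => e' i ≤ m).card)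
    (hsep : Separates k R K) :
    Separates k (R.transform (φ : A →+* B) (φ y)) (K.transform (φ : A →+* B) (φ y)) := by
  have hle : ∀ a, powAlg v e a ≤ powAlg (fun j i => if i ∈ J.erase j₀ then w j i else 0) e' a := by
    refine powAlg_le (one_mem_powAlg _ _) (fun a b f g => mul_mem_powAlg) fun i => ?_
    obtain ⟨f, hf, hfv⟩ := hgen i
    obtain ⟨f', hf'⟩ := IdealisticFiltration.exists_transform_eq (φ : A →+* B) hmap hR hf
    have hmem := IdealisticFiltration.mem_transform (φ : A →+* B) (φ y) hf hf'
    have hm := hsing _ hmem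
    rw [← hfv, h.leadPoly_eq hA (hR _ hf) hf' hm]
    refine killVars_mem_powAlg _ ?_
    rw [← hw.eq, mem_leadSub]
    exact ⟨f', IdealisticFiltration.le_diffSat k _ _ hmem, hm, rfl⟩
  have heq := powAlg_eq_of_le_of_card_eq hv.indep hv.expChar hw.expChar hle hcard
  obtain ⟨n, g, hg, hgn⟩ := hsep
  obtain ⟨g', hg'⟩ := IdealisticFiltration.exists_transform_eq (φ : A →+* B) hmap hK hg
  refine ⟨n, g', IdealisticFiltration.mem_transform (φ : A →+* B) (φ y) hg hg', fun hm hmem => ?_⟩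
  have hgm : g ∈ maximalIdeal A ^ n := Ideal.pow_right_mono h.center_le_maximalIdeal n (hK n hg)
  refine hgn hgm ?_
  rw [h.coordB.mk_mem_leadingPart_iff _ hm, hw.eq] at hmem
  rw [h.coordA.mk_mem_leadingPart_iff _ hgm, hv.eq, heq, h.leadPoly_eq hA (hK n hg) hg' hm]
  exact killVars_mem_powAlg _ hmem

end Transport

/-! ### Properties preserved along a resolution sequence -/

section Sequence

open MvPowerSeries

variable {k : Type u} [Field k]

theorem IsClosedPointRing.isNoetherianRing {A : Type*} [CommRing A] [IsLocalRing A] [Algebra k A]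
    (h : IsClosedPointRing k A) : IsNoetherianRing A :=
  have := h.regular
  inferInstance

theorem FormalSystem.Heart.sigma_eq {O : Type v} [CommRing O] [IsLocalRing O] [Algebra k O]
    [IsNoetherianRing O] (hO : IsRegularLocalRing O) {S : FormalSystem k O} {R : IdealisticFiltration O}
    {young : Set (Ideal O)} (hS : S.Heart R young) :
    sigma k R = fun n => (S.t + S.r) - (Finset.univ.filter fun i => S.e i ≤ n).card := by
  refine hS.isCoord.sigma_eq hO ((hS.isCoord.isSigma_iff hO _ _).2 ⟨_, _, _, hS.isLeadForm, ?_⟩)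
  simp

/-- The eventual value of `σ` is `r`. As the number `t` is preserved by the transformation of the
leading generator system, equal `σ` implies equal dimension of the two local rings. -/
theorem FormalSystem.Heart.exists_sigma_eq {O : Type v} [CommRing O] [IsLocalRing O] [Algebra k O]
    [IsNoetherianRing O] (hO : IsRegularLocalRing O) {S : FormalSystem k O} {R : IdealisticFiltration O}
    {young : Set (Ideal O)} (hS : S.Heart R young) : ∃ N, ∀ n ≥ N, sigma k R n = S.r := by
  refine ⟨Finset.univ.sup S.e, fun n hn => ?_⟩
  rw [hS.sigma_eq hO]
  have : (Finset.univ.filter fun i => S.e i ≤ n) = Finset.univ :=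
    Finset.filter_true_of_mem fun i hi => (Finset.le_sup hi).trans hn
  simp [this]

theorem strictBoundary_finite {A B : Type*} [CommRing A] [CommRing B] (φ : A →+* B) (y : B)
    {E : Set (Ideal A)} (hE : E.Finite) : (strictBoundary φ y E).Finite := by
  refine (hE.image (strictTransform φ y)).subset ?_
  rintro _ ⟨-, D, hD, rfl⟩
  exact ⟨D, hD, rfl⟩

/-- The components that survive are given by variables `G i` with `i ≠ j₀` and the exceptional
divisor by `G j₀`, so different components stay different and none becomes exceptional. -/
theorem IsAdapted.disjoint_strictBoundary {A B : Type*} [CommRing A] [CommRing B] [IsLocalRing A]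
    [IsLocalRing B] [Algebra k A] [Algebra k B] {φ : A →ₐ[k] B} {C : Ideal A} {y : A} {d : ℕ}
    {x : Fin d → A} {J : Finset (Fin d)} {j₀ : Fin d} {g : Fin d → A} {G : Fin d → B}
    {cA : A →ₐ[k] MvPowerSeries (Fin d) k} {cB : B →ₐ[k] MvPowerSeries (Fin d) k}
    (h : IsAdapted φ C y x J j₀ g G cA cB) {E F : Set (Ideal A)} (hEF : Disjoint E F)
    (hE : ∀ D ∈ E, ∃ i, D = Ideal.span {x i}) (hF : ∀ D ∈ F, ∃ i, D = Ideal.span {x i}) :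
    Disjoint (strictBoundary (φ : A →+* B) (φ y) E ∪ {Ideal.span {φ y}})
      (strictBoundary (φ : A →+* B) (φ y) F) := by
  have hinj : ∀ i j, Ideal.span {G i} = Ideal.span {G j} → i = j := by
    intro i j hij
    have h1 : G j ∈ Ideal.span {G i} := by rw [hij]; exact Ideal.mem_span_singleton_self _
    rw [Ideal.mem_span_singleton] at h1
    have h2 := map_dvd cB h1
    rw [h.coordB_eq, h.coordB_eq, X_dvd_iff] at h2
    by_contra hne
    have h3 := h2 (Finsupp.single j 1) (Finsupp.single_eq_of_ne hne)
    rw [coeff_index_single_self_X] at h3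
    exact one_ne_zero h3
  rw [Set.disjoint_left]
  rintro D hD ⟨hD₁, D₁, hD₁F, rfl⟩
  obtain ⟨i, rfl⟩ := hF _ hD₁F
  obtain ⟨hi, hi'⟩ := h.strict i hD₁
  rcases hD with ⟨-, D₂, hD₂E, hD₂⟩ | hD
  · obtain ⟨j, rfl⟩ := hE _ hD₂E
    rw [hD₂] at hD₁
    obtain ⟨-, hj'⟩ := h.strict j hD₁
    rw [hi', hj'] at hD₂
    obtain rfl := hinj _ _ hD₂
    exact Set.disjoint_left.1 hEF hD₂E hD₁F
  · rw [Set.mem_singleton_iff, hi', ← h.G_eq] at hD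
    exact hi (hinj _ _ hD)

theorem le_boundaryModification {O : Type*} [CommRing O] (K : IdealisticFiltration O)
    (aged : Set (Ideal O)) (a : ℕ) : K.ideal a ≤ (boundaryModification K aged).ideal a :=
  fun _ hf => IdealisticFiltration.subset_generate (Or.inl hf)

namespace Year

/-- The properties of the years of a resolution sequence which are preserved by the passage to the next
year. -/
structure IsAdmissible (Y : Year.{u, v} k) : Prop where
  point : IsClosedPointRing k Y.O
  heart : Y.lgs.Heart Y.R Y.young
  isFinGen : Y.R.IsFinGen
  sing : Y.R.ClosedPointInSing
  young_finite : Y.young.Finite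
  aged_finite : Y.aged.Finite
  disjoint : Disjoint Y.young Y.aged
  le_comp : ¬ Y.Terminal → ∀ a, Y.R.ideal a ≤ Y.comp.ideal a
  comp_le : ¬ Y.Terminal → ∀ a, Y.comp.ideal a ≤ Y.bdry.ideal a
  separates : ¬ Y.Terminal → Y.mu ≠ 0 → Y.mu ≠ ⊤ → Separates k Y.R Y.comp

variable {Y Z : Year.{u, v} k}

theorem IsStart.isAdmissible {R₀ : IdealisticFiltration Y.O} (h : Y.IsStart R₀) : Y.IsAdmissible := by
  have := h.point.isNoetherianRing
  have := h.point.essFiniteType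
  have hfin : Y.R.IsFinGen := by
    rw [h.R_eq]; exact h.heart.isCoord.isFinGen_diffSat h.ifg.isFinGen
  refine ⟨h.point, h.heart, hfin, ?_, ?_, ?_, ?_, fun ht => ?_, fun ht => ?_, fun ht h0 htop => ?_⟩
  · rw [h.R_eq]; exact IdealisticFiltration.diffSat_closedPointInSing k h.sing
  · rw [h.young_eq]; exact Set.finite_empty
  · obtain ⟨d, x, -, hx⟩ := h.snc
    refine (Set.finite_range fun i => Ideal.span {x i}).subset fun D hD => ?_
    obtain ⟨i, rfl⟩ := hx D hD
    exact ⟨i, rfl⟩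
  · rw [h.young_eq]; exact Set.empty_disjoint _
  · exact FormalSystem.le_of_isCompanion h.heart.isCoord (h.comp_eq ht)
  · rw [h.bdry_eq ht]; exact le_boundaryModification _ _
  · exact FormalSystem.separates_of_isCompanion h.heart hfin h0 htop (h.comp_eq ht)

variable {φ : Y.O →ₐ[k] Z.O} {C : Ideal Y.O} {y : Y.O}

theorem IsNext.card_eq (h : IsNext Y Z φ C y) (hY : Y.IsAdmissible) (hσ : SameSigma Y Z φ y) :
    Fintype.card (Fin Y.lgs.t ⊕ Fin Y.lgs.r) = Fintype.card (Fin Z.lgs.t ⊕ Fin Z.lgs.r) := by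
  have := hY.point.isNoetherianRing
  have := h.point.isNoetherianRing
  obtain ⟨ψ, -, τ, -⟩ := h.lgs_same hσ
  have ht : Y.lgs.t = Z.lgs.t := by simpa using Fintype.card_congr τ
  obtain ⟨N, hN⟩ := hY.heart.exists_sigma_eq hY.point.regular
  obtain ⟨N', hN'⟩ := h.heart.exists_sigma_eq h.point.regular
  have hr : Y.lgs.r = Z.lgs.r := by
    rw [← hN (max N N') (le_max_left _ _), ← hN' (max N N') (le_max_right _ _), h.R_same hσ]
    exact (congrFun hσ _).symm
  simp [ht, hr]

/-- While `σ` is constant no new aged components appear: if `s` was zero it stays zero. A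
modification inherited from the previous year therefore existed in that year. -/
theorem IsNext.not_terminal (h : IsNext Y Z φ C y) (hY : Y.IsAdmissible) (hσ : SameSigma Y Z φ y)
    (hμ : Z.mu = Y.mu) (hZ : ¬ Z.Terminal) : ¬ Y.Terminal := by
  rintro ⟨hμY, hs⟩
  refine hZ ⟨by rwa [hμ], ?_⟩
  rw [Year.s, Set.ncard_eq_zero hY.aged_finite] at hs
  rw [Year.s, h.aged_same hσ, hs]
  have : strictBoundary (φ : Y.O →+* Z.O) (φ y) ∅ = ∅ := by
    rw [Set.eq_empty_iff_forall_notMem]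
    rintro _ ⟨-, D, hD, -⟩
    exact hD
  rw [this, Set.ncard_empty]

theorem IsNext.separates (h : IsNext Y Z φ C y) (hY : Y.IsAdmissible) (hσ : SameSigma Y Z φ y)
    (ht : ¬ Y.Terminal) (h0 : Y.mu ≠ 0) (htop : Y.mu ≠ ⊤) :
    Separates k Z.R (Y.comp.transform (φ : Y.O →+* Z.O) (φ y)) := by
  have := hY.point.isNoetherianRing
  have := h.point.isNoetherianRing
  have := h.blowUp.domain
  obtain ⟨d, x, hx, ⟨J, hJ, hC⟩, -⟩ := h.center
  obtain ⟨j₀, g, G, cA, cB, hadp⟩ := h.blowUp.exists_adapted hY.point h.point hY.heart.isCoord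
    h.heart.isCoord (h.card_eq hY hσ) hx hJ hC
  obtain ⟨v, hv, hgen⟩ := hY.heart.exists_generators hY.point.regular hadp.coordA
  obtain ⟨w, hw, -⟩ := h.heart.exists_generators h.point.regular hadp.coordB
  obtain ⟨ψ, -, τ, hτ⟩ := h.lgs_same hσ
  rw [h.R_same hσ] at hw ⊢
  refine hadp.separates_transform hY.point.residue h.blowUp.map_center h.center_sing
    -- The center lies in the singular locus of `R'`, hence in that of `Comp(R)`, which is smaller
    -- as a filtration.
    (fun a => (hY.comp_le ht a).trans (h.center_sing' ht a)) h.sing hv hgen hw (fun m => ?_)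
    (hY.separates ht h0 htop)
  refine Finset.card_equiv τ fun i => ?_
  simp [(hτ i).1]

theorem IsNext.isAdmissible (h : IsNext Y Z φ C y) (hY : Y.IsAdmissible) : Z.IsAdmissible := by
  classical
  have := hY.point.isNoetherianRing
  have := h.point.isNoetherianRing
  have := h.point.essFiniteType
  have := h.blowUp.domain
  obtain ⟨d, x, hx, ⟨J, hJ, hC⟩, hE⟩ := h.center
  have hx' := (hY.heart.isCoord.isRegularSystem_iff hY.point.regular x).1 hx
  have hy := h.blowUp.map_ne_zero hY.heart.isCoord hx'.1 hx'.2 hJ hC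
  have hfin' : (Y.R.transform (φ : Y.O →+* Z.O) (φ y)).IsFinGen :=
    hY.isFinGen.transform _ hy h.blowUp.map_center h.center_sing
  have hfin : Z.R.IsFinGen := by
    by_cases hσ : SameSigma Y Z φ y
    · rw [h.R_same hσ]; exact hfin'
    · rw [h.R_drop hσ]; exact h.heart.isCoord.isFinGen_diffSat hfin'
  refine ⟨h.point, h.heart, hfin, ?_, ?_, ?_, ?_, fun ht => ?_, fun ht => ?_, fun ht h0 htop => ?_⟩
  · by_cases hσ : SameSigma Y Z φ y
    · rw [h.R_same hσ]; exact h.sing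
    · rw [h.R_drop hσ]; exact IdealisticFiltration.diffSat_closedPointInSing k h.sing
  · by_cases hσ : SameSigma Y Z φ y
    · rw [h.young_same hσ]
      exact (strictBoundary_finite _ _ hY.young_finite).union (Set.finite_singleton _)
    · rw [h.young_drop hσ]; exact Set.finite_empty
  · by_cases hσ : SameSigma Y Z φ y
    · rw [h.aged_same hσ]
      exact strictBoundary_finite _ _ hY.aged_finite
    · rw [h.aged_drop hσ]
      exact (strictBoundary_finite _ _ (hY.young_finite.union hY.aged_finite)).union
        (Set.finite_singleton _)
  · by_cases hσ : SameSigma Y Z φ y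
    · rw [h.young_same hσ, h.aged_same hσ]
      obtain ⟨j₀, g, G, cA, cB, hadp⟩ := h.blowUp.exists_adapted hY.point h.point hY.heart.isCoord
        h.heart.isCoord (h.card_eq hY hσ) hx hJ hC
      exact hadp.disjoint_strictBoundary hY.disjoint (fun D hD => hE D (Or.inl hD))
        fun D hD => hE D (Or.inr hD)
    · rw [h.young_drop hσ]; exact Set.empty_disjoint _
  · by_cases hσ : SameSigma Y Z φ y ∧ Z.mu = Y.mu
    · rw [h.comp_same ht hσ, h.R_same hσ.1]
      exact IdealisticFiltration.transform_mono _ _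
        (hY.le_comp (h.not_terminal hY hσ.1 hσ.2 ht))
    · exact FormalSystem.le_of_isCompanion h.heart.isCoord (h.comp_drop ht hσ)
  · by_cases hσ : SameSigma Y Z φ y ∧ Z.mu = Y.mu ∧ Z.s = Y.s
    · rw [h.comp_same ht ⟨hσ.1, hσ.2.1⟩, h.bdry_same ht hσ]
      exact IdealisticFiltration.transform_mono _ _
        (hY.comp_le (h.not_terminal hY hσ.1 hσ.2.1 ht))
    · rw [h.bdry_drop ht hσ]; exact le_boundaryModification _ _
  · by_cases hσ : SameSigma Y Z φ y ∧ Z.mu = Y.mu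
    · rw [h.comp_same ht hσ]
      rw [hσ.2] at h0 htop
      exact h.separates hY hσ.1 (h.not_terminal hY hσ.1 hσ.2 ht) h0 htop
    · exact FormalSystem.separates_of_isCompanion h.heart hfin h0 htop (h.comp_drop ht hσ)

theorem InSequence.isAdmissible (hY : Y.InSequence) : Y.IsAdmissible := by
  induction hY with
  | start Y R₀ h => exact h.isAdmissible
  | next Y Z φ C y _ h ih => exact h.isAdmissible ih

namespace IsAdmissible

theorem leadingPart_subset (h : Y.IsAdmissible) (hmod : ¬ Y.Terminal) (a : ℕ) :
    (Y.R.diffSat k).leadingPart a ⊆ (Y.bdry.diffSat k).leadingPart a :=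
  (h.heart.isCoord.leadingPart_subset_iff _ _ a).2 (leadSub_mono
    (IdealisticFiltration.diffSat_mono k (fun b => (h.le_comp hmod b).trans (h.comp_le hmod b)) a))

theorem exists_leadingPart_ne (h : Y.IsAdmissible) (hmod : ¬ Y.Terminal) (h0 : Y.mu ≠ 0)
    (htop : Y.mu ≠ ⊤) : ∃ a, (Y.R.diffSat k).leadingPart a ≠ (Y.bdry.diffSat k).leadingPart a := by
  have := h.point.isNoetherianRing
  have := h.point.essFiniteType
  exact FormalSystem.exists_leadingPart_ne h.heart h.sing htop (h.separates hmod h0 htop)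
    (h.comp_le hmod)

theorem isSigma [IsAlgClosed k] (h : Y.IsAdmissible) (R : IdealisticFiltration Y.O) :
    IsSigma k R (Idealistic.sigma k R) := by
  have := h.point.isNoetherianRing
  have := h.point.essFiniteType
  exact isSigma_sigma (h.heart.isCoord.exists_isSigma h.point.regular R)

theorem sigma'_le [IsAlgClosed k] (h : Y.IsAdmissible) (hmod : ¬ Y.Terminal) : Y.sigma' ≤ Y.sigma := by
  have := h.point.isNoetherianRing
  exact h.heart.isCoord.sigma_le_of_le h.point.regular (h.isSigma Y.R) (h.isSigma Y.bdry)
    fun a => (h.heart.isCoord.leadingPart_subset_iff _ _ a).1 (h.leadingPart_subset hmod a)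

theorem sigma'_lt [IsAlgClosed k] (h : Y.IsAdmissible) (hmod : ¬ Y.Terminal) (h0 : Y.mu ≠ 0)
    (htop : Y.mu ≠ ⊤) : toLex Y.sigma' < toLex Y.sigma := by
  have := h.point.isNoetherianRing
  refine lt_of_le_of_ne (Pi.toLex_monotone (h.sigma'_le hmod)) fun heq => ?_
  have heq' : Y.sigma' = Y.sigma := toLex.injective heq
  obtain ⟨a, ha⟩ := h.exists_leadingPart_ne hmod h0 htop
  -- Equal values of `σ` would force the nested leading algebras to coincide.
  refine ha ((h.heart.isCoord.leadingPart_eq_iff _ _ a).2 ?_)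
  refine h.heart.isCoord.leadSub_eq_of_sigma_eq h.point.regular (h.isSigma Y.R) ?_
    (fun a => (h.heart.isCoord.leadingPart_subset_iff _ _ a).1 (h.leadingPart_subset hmod a)) a
  have := h.isSigma Y.bdry
  rwa [show Idealistic.sigma k Y.bdry = Idealistic.sigma k Y.R from heq'] at this

theorem numE'_lt (h : Y.IsAdmissible) (hs : Y.s ≠ 0) : Y.numE' < Y.numE := by
  rw [Year.numE', Year.numE, boundary, boundary', Set.ncard_union_eq h.disjoint h.young_finite h.aged_finite]
  exact Nat.lt_add_of_pos_right (Nat.pos_of_ne_zero hs)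

end IsAdmissible

end Year

end Sequence

end Idealistic

theorem proposition3 {k : Type u} [Field k] [IsAlgClosed k]
    (Y : Idealistic.Year.{u, v} k) (hY : Y.InSequence) (hmod : ¬ Y.Terminal) :
    Idealistic.IsSigma k Y.R Y.sigma ∧ Idealistic.IsSigma k Y.bdry Y.sigma' ∧
    toLex (toLex Y.sigma', Y.numE') < toLex (toLex Y.sigma, Y.numE) ∧
    (Y.mu ≠ 0 → Y.mu ≠ ⊤ →
      (∀ a, (Y.R.diffSat k).leadingPart a ⊆ (Y.bdry.diffSat k).leadingPart a) ∧
      (∃ a, (Y.R.diffSat k).leadingPart a ≠ (Y.bdry.diffSat k).leadingPart a) ∧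
      toLex Y.sigma' < toLex Y.sigma) ∧
    (Y.mu = 0 ∨ Y.mu = ⊤ → Y.s ≠ 0 ∧ Y.numE' < Y.numE) := by
  have h := hY.isAdmissible
  have hend : Y.mu = 0 ∨ Y.mu = ⊤ → Y.s ≠ 0 ∧ Y.numE' < Y.numE := by
    intro hμ
    have hs : Y.s ≠ 0 := fun hs => hmod ⟨hμ.symm, hs⟩
    exact ⟨hs, h.numE'_lt hs⟩
  refine ⟨h.isSigma Y.R, h.isSigma Y.bdry, ?_, fun h0 htop => ⟨h.leadingPart_subset hmod,
    h.exists_leadingPart_ne hmod h0 htop, h.sigma'_lt hmod h0 htop⟩, hend⟩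
  rw [Prod.Lex.toLex_lt_toLex]
  by_cases hμ : Y.mu = 0 ∨ Y.mu = ⊤
  -- For `μ̃` equal to `0` or `∞` the value of `σ` may drop or not; only if it does not is the count
  -- of the boundary needed.
  · rcases (Pi.toLex_monotone (h.sigma'_le hmod)).lt_or_eq with hlt | heq
    · exact Or.inl hlt
    · exact Or.inr ⟨heq, (hend hμ).2⟩
  · rw [not_or] at hμ
    exact Or.inl (h.sigma'_lt hmod hμ.1 hμ.2)
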